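/- **Proposition 4.2.** *Notation.* Let $(z,w)$ be the coordinates of $\mathbb C^2$. For a real-valued smooth function $\rho$ put $L=-\rho_w\partial_z+\rho_z\partial_w$, $\bar L=-\rho_{\bar w}\partial_{\bar z}+\rho_{\bar z}\partial_{\bar w}$, and for a real-valued smooth function $R$ let $R_{Z^2}(L,L)=R_{zz}\rho_w^2-2R_{zw}\rho_z\rho_w+R_{ww}\rho_z^2$. Let $A_3(\rho)$ be the $5\times5$ matrix whose rows are $(f,\bar Lf,\bar L^2f,\bar L^3f,\bar L^4f)$ for $f=\rho_w^3,\ \rho_z\rho_w^2,\ \rho_z^2\rho_w,\ \rho_z^3,\ \rho_{Z^2}(L,L)$, and let $$\tilde J=\det\begin{pmatrix}\rho_z&\bar L\rho_z\\ \rho_w&\bar L\rho_w\end{pmatrix},\qquad Q=\frac{\det A_3(\rho)}{\tilde J^{25/3}} .$$ For $\rho$ defined on an open set $\Omega$ let $M=\{p\in\Omega:\rho(p)=0\}$. The *umbilical locus* of $M$ is $\mathcal U=\{p\in M:\tilde J(p)\ne0,\ Q(p)=0\}$ (the condition $\tilde J\neq 0$ is automatic where $M$ is strictly pseudoconvex).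 The *umbilical index* of a closed curve in $M\setminus\mathcal U$ is $-\tfrac12$ times the winding number of $Q$ along it. A point $p\in\mathcal U$ is *stable* if every neighborhood of $p$ contains a closed curve in $M\setminus\mathcal U$ of non-zero umbilical index; where $\mathcal U$ is a smooth curve at $p$, this says that the local index (the umbilical index of a small circle around $\mathcal U$ in a disk in $M$ transversal to $\mathcal U$ at $p$) is non-zero. *Statement.* Let $\Omega\subset\mathbb C^2$ be an open neighborhood of the unit sphere $S^3$, let $\rho^0=|z|^2+|w|^2-1$, let $\rho'$ and, for all small $\varepsilon>0$, $\rho^\varepsilon$ be real-valued $C^\infty$ functions on $\Omega$, and suppose that $$\rho^\varepsilon=\rho^0+\varepsilon\rho'+O(\varepsilon^2)\qquad(\varepsilon\to0^+),$$ where each partial derivative of the remainder (including the remainder itself) is $O(\varepsilon^2)$ uniformly on each compact subset of $\Omega$. Let $M_\varepsilon=\{p\in\Omega:\rho^\varepsilon(p)=0\}$, let $\mathcal U_\varepsilon$ be its umbilical locus, and let $$Q'=\bar L_0^4\big(\rho'_{Z^2}(L_0,L_0)\big),\qquad L_0=-\bar w\,\partial_z+\bar z\,\partial_w .$$ Suppose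 that there is a closed curve $\Gamma$ on $S^3$ such that $Q'\ne0$ on $\Gamma$ and the winding number of $Q'$ along $\Gamma$, $\frac1{2\pi i}\int_\Gamma\frac{dQ'}{Q'}$, is not $0$. Then for all sufficiently small $\varepsilon>0$ the following hold. 1. $\mathcal U_\varepsilon$ contains a non-trivial curve, in the sense of a compact connected set with more than one point. 2. Either $\mathcal U_\varepsilon$ contains a 2-dimensional piece, in the sense that there is a connected, relatively open set $O\subset M_\varepsilon$ for which $O\setminus\mathcal U_\varepsilon$ is empty or disconnected; or there is a compact connected set with more than one point which consists of stable points of $\mathcal U_\varepsilon$. 3. If $\rho^\varepsilon$ is real-analytic on $\Omega$, then $\mathcal U_\varepsilon$ contains either a smooth 2-surface (the image of an open disk under an injective smooth immersion), or a smooth curve (the image of an open interval under a smooth embedding) which consists of stable points, and at each point of which $\mathcal U_\varepsilon$ is a smooth curve, i.e. coincides near that point with the given curve. -/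

import Mathlib

open Set Filter Topology
open scoped ContDiff

namespace CRUmbilic

noncomputable section

/-! ### Wirtinger derivatives on `ℂ²`, with coordinates `(z, w)` -/

/-- `∂f/∂z = (∂f/∂x - i ∂f/∂y) / 2`, where `z = x + i y`. -/
def dz (f : ℂ × ℂ → ℂ) (p : ℂ × ℂ) : ℂ :=
  (1 / 2) * (fderiv ℝ f p (1, 0) - Complex.I * fderiv ℝ f p (Complex.I, 0))

/-- `∂f/∂w`. -/
def dw (f : ℂ × ℂ → ℂ) (p : ℂ × ℂ) : ℂ :=
  (1 / 2) * (fderiv ℝ f p (0, 1) - Complex.I * fderiv ℝ f p (0, Complex.I))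

/-- `∂f/∂z̄`. -/
def dzbar (f : ℂ × ℂ → ℂ) (p : ℂ × ℂ) : ℂ :=
  (1 / 2) * (fderiv ℝ f p (1, 0) + Complex.I * fderiv ℝ f p (Complex.I, 0))

/-- `∂f/∂w̄`. -/
def dwbar (f : ℂ × ℂ → ℂ) (p : ℂ × ℂ) : ℂ :=
  (1 / 2) * (fderiv ℝ f p (0, 1) + Complex.I * fderiv ℝ f p (0, Complex.I))

/-- A real-valued function, regarded as complex-valued. -/
def toC (ρ : ℂ × ℂ → ℝ) (p : ℂ × ℂ) : ℂ := (ρ p : ℂ)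

/-! ### The umbilical tensor of the level set of a defining function -/

/-- The conjugate `L̄ = -ρ_w̄ ∂/∂z̄ + ρ_z̄ ∂/∂w̄` of the tangential `(1,0)` vector field
`L = -ρ_w ∂/∂z + ρ_z ∂/∂w`. -/
def Lbar (ρ : ℂ × ℂ → ℝ) (f : ℂ × ℂ → ℂ) (p : ℂ × ℂ) : ℂ :=
  -(dwbar (toC ρ) p) * dzbar f p + dzbar (toC ρ) p * dwbar f p

/-- `R_{Z²}(L, L)`: the holomorphic Hessian of `R`, evaluated on the coefficient vector
`(-ρ_w, ρ_z)` of the field `L` belonging to `ρ`. -/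
def holHessLL (R ρ : ℂ × ℂ → ℝ) (p : ℂ × ℂ) : ℂ :=
  dz (dz (toC R)) p * (dw (toC ρ) p) ^ 2
    - 2 * dw (dz (toC R)) p * (dz (toC ρ) p * dw (toC ρ) p)
    + dw (dw (toC R)) p * (dz (toC ρ) p) ^ 2

/-- The functions in the first column of `A₃(ρ)`. -/
def rowFn (ρ : ℂ × ℂ → ℝ) : Fin 5 → ℂ × ℂ → ℂ :=
  ![fun p => (dw (toC ρ) p) ^ 3,
    fun p => dz (toC ρ) p * (dw (toC ρ) p) ^ 2,
    fun p => (dz (toC ρ) p) ^ 2 * dw (toC ρ) p,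
    fun p => (dz (toC ρ) p) ^ 3,
    holHessLL ρ ρ]

/-- The matrix `A₃(ρ)`: its `j`-th column is `L̄^j` of its `0`-th column. -/
def A3 (ρ : ℂ × ℂ → ℝ) (p : ℂ × ℂ) : Matrix (Fin 5) (Fin 5) ℂ :=
  Matrix.of fun i j => ((Lbar ρ)^[(j : ℕ)] (rowFn ρ i)) p

/-- The Levi determinant `det (ρ_z, L̄ρ_z ; ρ_w, L̄ρ_w)`, normalized in sign so that it is `1` for
the unit sphere; on `ρ = 0` it is Fefferman's Monge-Ampère determinant `J(ρ)`, is real, and vanishes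
exactly where the Levi form (or `dρ`) degenerates. -/
def Jtilde (ρ : ℂ × ℂ → ℝ) (p : ℂ × ℂ) : ℂ :=
  Matrix.det !![dz (toC ρ) p, Lbar ρ (dz (toC ρ)) p;
                dw (toC ρ) p, Lbar ρ (dw (toC ρ)) p]

/-- Cartan's umbilical tensor `Q = det A₃ / J̃^{25/3}` as a function (principal power; `J̃ > 0` for
a strictly pseudoconvex level set). -/
def Q (ρ : ℂ × ℂ → ℝ) (p : ℂ × ℂ) : ℂ :=
  (A3 ρ p).det / (Jtilde ρ p) ^ (25 / 3 : ℂ)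

/-- The level set `M = {ρ = 0}` in the domain `Ω` of `ρ`. -/
def hypersurface (Ω : Set (ℂ × ℂ)) (ρ : ℂ × ℂ → ℝ) : Set (ℂ × ℂ) := {p | p ∈ Ω ∧ ρ p = 0}

/-- The umbilical locus: the zero locus of `Q` on `M`. The condition `J̃ ≠ 0` says only that `Q` is
really defined at the point; it holds everywhere on a strictly pseudoconvex hypersurface. -/
def umbilicLocus (Ω : Set (ℂ × ℂ)) (ρ : ℂ × ℂ → ℝ) : Set (ℂ × ℂ) :=
  {p | p ∈ hypersurface Ω ρ ∧ Jtilde ρ p ≠ 0 ∧ Q ρ p = 0}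

/-! ### Winding numbers, indices and stable umbilical points -/

/-- `γ`, restricted to `[0,1]`, is a closed curve in `A`. -/
def IsClosedCurveIn (γ : ℝ → ℂ × ℂ) (A : Set (ℂ × ℂ)) : Prop :=
  ContinuousOn γ (Icc 0 1) ∧ γ 0 = γ 1 ∧ MapsTo γ (Icc 0 1) A

/-- The closed curve `f : [0,1] → ℂ ∖ {0}` has winding number `n` about `0`: a continuous logarithm
of `f` grows by `2πi n`. (For a piecewise `C¹` curve the growth is `∫ df / f`. As the exponential
has no zero, this entails that `f` has none.) -/
def HasWinding (f : ℝ → ℂ) (n : ℤ) : Prop :=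
  ∃ θ : ℝ → ℂ, ContinuousOn θ (Icc 0 1) ∧ (∀ t ∈ Icc (0 : ℝ) 1, Complex.exp (θ t) = f t) ∧
    θ 1 - θ 0 = 2 * Real.pi * Complex.I * n

/-- The umbilical index of `γ` is `I`, i.e. `I` is `-1/2` times the winding number of `Q`
along `γ`. -/
def HasUmbilicalIndex (ρ : ℂ × ℂ → ℝ) (γ : ℝ → ℂ × ℂ) (I : ℚ) : Prop :=
  ∃ n : ℤ, HasWinding (fun t => Q ρ (γ t)) n ∧ I = -(1 / 2) * n

/-- A stable umbilical point: arbitrarily close to it there are closed curves in `M`, off the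
umbilical locus, of non-zero umbilical index. At a point where the umbilical locus is a smooth curve
its complement in a small ball of `M` has its homology generated by a small circle about the curve
in a transversal disk, so there this says that the local index is non-zero. -/
def IsStableUmbilic (Ω : Set (ℂ × ℂ)) (ρ : ℂ × ℂ → ℝ) (p : ℂ × ℂ) : Prop :=
  p ∈ umbilicLocus Ω ρ ∧ ∀ V ∈ 𝓝 p, ∃ γ : ℝ → ℂ × ℂ,
    IsClosedCurveIn γ (V ∩ (hypersurface Ω ρ \ umbilicLocus Ω ρ)) ∧
    ∃ I : ℚ, I ≠ 0 ∧ HasUmbilicalIndex ρ γ I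

/-! ### Curves and surfaces -/

/-- A nondegenerate continuum: a compact connected set with more than one point. -/
def IsNondegenerateContinuum (C : Set (ℂ × ℂ)) : Prop :=
  IsCompact C ∧ IsConnected C ∧ C.Nontrivial

/-- `U` separates some connected, relatively open subset `O` of `M` (`O ∖ U` is empty or
disconnected). In a 3-manifold this is possible only if `U` has topological dimension at least 2. -/
def LocallySeparates (M U : Set (ℂ × ℂ)) : Prop :=
  ∃ O : Set (ℂ × ℂ), (∃ W : Set (ℂ × ℂ), IsOpen W ∧ O = W ∩ M) ∧ IsConnected O ∧
    ¬ IsConnected (O \ U)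

/-- `U` contains a smooth 2-surface: the image of an open disk under an injective smooth
immersion. -/
def ContainsSmoothSurface (U : Set (ℂ × ℂ)) : Prop :=
  ∃ φ : ℂ → ℂ × ℂ, ContDiffOn ℝ ∞ φ (Metric.ball 0 1) ∧ InjOn φ (Metric.ball 0 1) ∧
    (∀ t ∈ Metric.ball (0 : ℂ) 1, Function.Injective (fderiv ℝ φ t)) ∧
    MapsTo φ (Metric.ball 0 1) U

/-- `Γ` is a smooth arc in `U`, parametrized by an open interval as a regular simple curve `γ`, and
`U` is a smooth curve at each point of `Γ`: near `γ t` the whole set `U` coincides with the image of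
an arbitrarily short interval around `t`. -/
def IsSmoothCurvePiece (U Γ : Set (ℂ × ℂ)) : Prop :=
  ∃ γ : ℝ → ℂ × ℂ, ContDiffOn ℝ ∞ γ (Ioo 0 1) ∧ InjOn γ (Ioo 0 1) ∧
    (∀ t ∈ Ioo (0 : ℝ) 1, deriv γ t ≠ 0) ∧ γ '' Ioo 0 1 = Γ ∧ Γ ⊆ U ∧
    ∀ t ∈ Ioo (0 : ℝ) 1, ∀ δ > 0, ∃ V ∈ 𝓝 (γ t), U ∩ V ⊆ γ '' (Ioo (t - δ) (t + δ) ∩ Ioo 0 1)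

/-! ### Perturbations of the unit sphere -/

/-- `ρ⁰ = |z|² + |w|² - 1`. -/
def rho0 (p : ℂ × ℂ) : ℝ := ‖p.1‖ ^ 2 + ‖p.2‖ ^ 2 - 1

/-- The unit sphere `S³` in `ℂ²`. -/
def S3 : Set (ℂ × ℂ) := {p | rho0 p = 0}

/-- `ρ^ε = ρ⁰ + ε ρ' + O(ε²)` for `ε → 0⁺`, with `ρ'` and `ρ^ε` smooth on `Ω`, and with the
remainder `O(ε²)` together with each of its derivatives, uniformly on compact subsets of `Ω`. -/
def IsSpherePerturbation (Ω : Set (ℂ × ℂ)) (ρ : ℝ → ℂ × ℂ → ℝ) (ρ' : ℂ × ℂ → ℝ) : Prop :=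
  ContDiffOn ℝ ∞ ρ' Ω ∧ (∀ᶠ ε in 𝓝[>] (0 : ℝ), ContDiffOn ℝ ∞ (ρ ε) Ω) ∧
  ∀ (k : ℕ) (K : Set (ℂ × ℂ)), IsCompact K → K ⊆ Ω →
    ∃ C : ℝ, ∀ᶠ ε in 𝓝[>] (0 : ℝ), ∀ p ∈ K,
      ‖iteratedFDeriv ℝ k (fun q => ρ ε q - rho0 q - ε * ρ' q) p‖ ≤ C * ε ^ 2

/-- `Q' = L̄₀⁴ (ρ'_{Z²}(L₀, L₀))`, with `L₀ = -w̄ ∂/∂z + z̄ ∂/∂w` the field `L` of `ρ⁰`. -/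
def Qprime (ρ' : ℂ × ℂ → ℝ) : ℂ × ℂ → ℂ := (Lbar rho0)^[4] (holHessLL ρ' rho0)

end

end CRUmbilic

/-!
# Umbilical points of small perturbations of the unit sphere in `ℂ²`

At the unit sphere the first four rows of `A₃` are `L̄`-derivatives of cubics in `z̄`, `w̄`, which
`L̄₀⁴` annihilates, and the last row vanishes. Hence `det A₃(ρ^ε) = 12 ε Q' + o(ε)`
(`IsSpherePerturbation.tendsto_det_A3`), while `J̃ → 1`. For small `ε` the hypersurface `M_ε` is a
radial graph over the sphere, and off one radius it is parametrized by `ℝ³`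
(`IsRadialShell.exists_isGlobalChart`). The missing radius passes through a point with `Q' ≠ 0`, so
in this chart `F = det A₃` has a continuous logarithm near infinity; along the image of a curve near
`Γ` it has the winding number of `Q'`, which is not zero
(`IsSpherePerturbation.exists_isUmbilicChart`). The umbilical locus is the zero set `Z` of `F`, and
`Q` has the same winding numbers as `F`, because `J̃` has a logarithm.

The theorem then rests on a topological fact about `ℝ³` (`log_periodic_of_isTotallyDisconnected`).
Let `Y ⊆ Z` be compact and totally disconnected. Suppose that `Z` separates no convex open set
disjoint from `Y`, and that `F` has a logarithm off `Z` near every point off `Y` and near infinity.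
Then `F` has winding number `0` along all closed curves off `Z`. Indeed, on a fine cubical lattice
the differences of the local logarithms form a `1`-cochain that is closed away from `Y`. Its
coboundary is carried by finitely many small boxes around the pieces of `Y`; as the second
cohomology with compact supports of `ℝ³` vanishes (`exists_primitive_of_closed_two`), the cochain
can be changed in these boxes so as to become closed, hence a gradient. So the local logarithms fit
together along curves that avoid the boxes. Consequently such a `Y` contains a continuum as soon as
some winding number is not `0` (`IsUmbilicChart.exists_continuum`).

* With `Y = Z` the hypotheses are trivial, and `Z` contains a continuum.
* If `Z` does not separate locally, let `Y` be the closed set of stable points. Near a point of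
  `Z \ Y` all small closed curves have winding number `0`, so `F` has a logarithm there, and `Y`
  contains a continuum.
* If `ρ^ε` is real analytic, `Z` is the zero set of the analytic function `|F|²`. If it contains no
  surface, then it is an analytic arc near all but countably many of its points
  (`countable_not_isCurvePoint`): by Weierstrass preparation
  (`exists_weierstrass_polynomial`) and elimination (`exists_discriminant`) the other points lie
  over zeros of discriminants. Then the cones over `Z` have Hausdorff dimension at most `2`, so two
  points of a convex open set can be joined by a broken line off `Z`, and `Z` does not separate
  locally (`isConnected_diff_zeros`). The continuum of stable points, being uncountable, contains
  one of these arcs (`exists_arc_subset`).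
-/

namespace CRUmbilic

section

open scoped NNReal ENNReal

/-! ### Power series with parameters, and the Weierstrass polynomial -/

/-- A sum of power series that converges absolutely as a double series is a power series. -/
theorem hasFPowerSeriesOnBall_tsum {E F : Type*} [NormedAddCommGroup E] [NormedSpace ℝ E]
    [NormedAddCommGroup F] [NormedSpace ℝ F] [CompleteSpace F]
    {g : ℕ → E → F} {p : ℕ → FormalMultilinearSeries ℝ E F} {x : E} {R : ℝ≥0} (hR : 0 < R)
    (hg : ∀ k, HasFPowerSeriesOnBall (g k) (p k) x R)
    (hs : Summable fun s : ℕ × ℕ => ‖p s.1 s.2‖₊ * R ^ s.2) :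
    HasFPowerSeriesOnBall (fun y => ∑' k, g k y) (fun n => ∑' k, p k n) x R := by
  obtain ⟨a, ha⟩ : ∃ a : ℕ → ℕ → ℝ≥0, ∀ k n, ‖p k n‖₊ * R ^ n = a k n := ⟨_, fun _ _ => rfl⟩
  simp only [ha] at hs
  have hsw : Summable fun s : ℕ × ℕ => a s.2 s.1 := hs.prod_symm
  have hn : ∀ n, Summable fun k => ‖p k n‖₊ := fun n => by
    have h : Summable fun k => a k n :=
      NNReal.summable_comp_injective hs (i := fun k : ℕ => (k, n)) fun _ _ h => congrArg Prod.fst h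
    simp only [← ha] at h
    exact (summable_mul_right_iff (pow_pos hR n).ne').1 h
  have hle : ∀ n, ‖∑' k, p k n‖₊ * R ^ n ≤ ∑' k, a k n := fun n => by
    simp only [← ha]
    rw [NNReal.tsum_mul_right]
    exact mul_le_mul_left (nnnorm_tsum_le (hn n)) _
  have hrad : (R : ℝ≥0∞) ≤ FormalMultilinearSeries.radius fun n => ∑' k, p k n :=
    FormalMultilinearSeries.le_radius_of_summable_nnnorm _ (NNReal.summable_of_le hle
      (NNReal.summable_sigma.1 ((Equiv.sigmaEquivProd ℕ ℕ).summable_iff.2 hsw)).2)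
  refine ⟨hrad, by exact_mod_cast hR, fun {y} hy => ?_⟩
  have hy' : ‖y‖₊ ≤ R := by
    have : ‖y‖ < R := by simpa [enorm_eq_nnnorm] using hy
    exact this.le
  obtain ⟨b, hb⟩ : ∃ b : ℕ → ℕ → F, ∀ k n, p k n (fun _ => y) = b k n := ⟨_, fun _ _ => rfl⟩
  have hba : ∀ k n, ‖b k n‖₊ ≤ a k n := fun k n => by
    rw [← hb, ← ha]
    refine (ContinuousMultilinearMap.le_opNNNorm _ _).trans ?_
    simp only [Finset.prod_const, Finset.card_univ, Fintype.card_fin]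
    gcongr
  have hsum : Summable fun s : ℕ × ℕ => b s.1 s.2 :=
    .of_nnnorm_bounded hs fun s => hba s.1 s.2
  have h1 : HasSum (fun k => g k (x + y)) (∑' s : ℕ × ℕ, b s.1 s.2) :=
    hsum.hasSum.prod_fiberwise fun k => by
      simpa only [hb] using (hg k).hasSum hy
  have h2 : HasSum (fun s : ℕ × ℕ => b s.2 s.1) (∑' s : ℕ × ℕ, b s.1 s.2) :=
    (Equiv.prodComm ℕ ℕ).hasSum_iff.2 hsum.hasSum
  rw [h1.tsum_eq]
  refine h2.prod_fiberwise fun n => ?_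
  have h3 := ContinuousMultilinearMap.hasSum_eval (Summable.of_nnnorm (hn n)).hasSum fun _ => y
  simpa only [hb] using h3

/-- Substituting an element of a Banach algebra for the last variable of an analytic function. -/
theorem exists_analytic_substitution {E : Type*} [NormedAddCommGroup E] [NormedSpace ℝ E]
    {f : E × ℝ → ℝ} {x₀ : E} {y₀ : ℝ} (hf : AnalyticAt ℝ f (x₀, y₀)) :
    ∃ (c : ℕ → E → ℝ) (r : ℝ), 0 < r ∧
      (∀ᶠ x in 𝓝 x₀, ∀ t, |t| < r → HasSum (fun k => c k x * t ^ k) (f (x, y₀ + t))) ∧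
      ∀ (A : Type) [NormedRing A] [NormedAlgebra ℝ A] [CompleteSpace A] [NormOneClass A] (S : A),
        ‖S‖ < r → AnalyticAt ℝ (fun x => ∑' k, c k x • S ^ k) x₀ := by
  obtain ⟨p, r₁, hp⟩ := hf
  obtain ⟨r₂, hr₂0, hr₂⟩ : ∃ r : ℝ≥0, 0 < r ∧ ((r + r : ℝ≥0) : ℝ≥0∞) < r₁ := by
    obtain ⟨s, hs0, hs⟩ := ENNReal.lt_iff_exists_nnreal_btwn.1 hp.r_pos
    refine ⟨s / 2, by simpa using hs0, by simpa using hs⟩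
  have hrad : ((r₂ : ℝ≥0∞) + r₂) < p.radius := by
    exact_mod_cast hr₂.trans_le hp.r_le
  have hpr : 0 < p.radius := hp.r_pos.trans_le hp.r_le
  have hle : (r₂ : ℝ≥0∞) ≤ p.radius := le_self_add.trans hrad.le
  set e : E × ℝ := (0, 1) with he
  have hen : ‖e‖ = 1 := by simp [he, Prod.norm_def]
  let c : ℕ → E → ℝ := fun k x => p.changeOrigin (x - x₀, 0) k fun _ => e
  have hbd : ∀ᶠ x in 𝓝 x₀, ‖((x - x₀, (0 : ℝ)) : E × ℝ)‖₊ < r₂ := by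
    have : Tendsto (fun x : E => ‖((x - x₀, (0 : ℝ)) : E × ℝ)‖₊) (𝓝 x₀)
        (𝓝 ‖((x₀ - x₀, (0 : ℝ)) : E × ℝ)‖₊) := by
      apply Continuous.tendsto (by fun_prop)
    rw [sub_self] at this
    exact this.eventually_lt_const (by simpa using hr₂0)
  have hsum2 : Summable fun s : ℕ × ℕ => ‖p.changeOriginSeries s.1 s.2‖₊ * r₂ ^ s.2 * r₂ ^ s.1 := by
    have h1 := NNReal.summable_sigma.1 (p.changeOriginSeries_summable_aux₁ hrad)
    have h2 : ∀ k l, ‖p.changeOriginSeries k l‖₊ * r₂ ^ l * r₂ ^ k ≤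
        ∑' _ : { s : Finset (Fin (k + l)) // s.card = l }, ‖p (k + l)‖₊ * r₂ ^ l * r₂ ^ k := by
      intro k l
      rw [NNReal.tsum_mul_right, NNReal.tsum_mul_right]
      gcongr
      exact p.nnnorm_changeOriginSeries_le_tsum k l
    have h3 : ∀ k, Summable fun l => ‖p.changeOriginSeries k l‖₊ * r₂ ^ l * r₂ ^ k := fun k =>
      NNReal.summable_of_le (h2 k) (NNReal.summable_sigma.1 (h1.1 k)).2
    refine (Equiv.sigmaEquivProd ℕ ℕ).summable_iff.1 (NNReal.summable_sigma.2 ⟨h3, ?_⟩)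
    refine NNReal.summable_of_le (fun k => ?_) h1.2
    rw [(h1.1 k).tsum_sigma' (NNReal.summable_sigma.1 (h1.1 k)).1]
    exact (h3 k).tsum_le_tsum (h2 k) (NNReal.summable_sigma.1 (h1.1 k)).2
  refine ⟨c, r₂, by exact_mod_cast hr₂0, ?_, ?_⟩
  · filter_upwards [hbd] with x hx t ht
    have hx' : (‖((x - x₀, (0 : ℝ)) : E × ℝ)‖₊ : ℝ≥0∞) < r₂ := by exact_mod_cast hx
    have h1 := hp.changeOrigin (y := (x - x₀, (0 : ℝ)))
      (hx'.trans (lt_of_le_of_lt (by simp) hr₂))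
    have h2 := h1.hasSum (y := t • e) (by
      have h3 : ‖t • e‖₊ < r₂ := by
        rw [← NNReal.coe_lt_coe]
        simpa [norm_smul, hen] using ht
      have h4 : ‖t • e‖₊ + ‖((x - x₀, (0 : ℝ)) : E × ℝ)‖₊ < r₂ + r₂ := add_lt_add h3 hx
      rw [mem_eball_zero_iff, lt_tsub_iff_right, enorm_eq_nnnorm]
      exact lt_trans (by exact_mod_cast h4) hr₂)
    convert! h2 using 1
    · ext k
      rw [ContinuousMultilinearMap.map_smul_univ]
      simp [c, mul_comm]
    · simp [he]
  · intro A _ _ _ _ S hS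
    let L : ∀ k : ℕ, ((E × ℝ) [×k]→L[ℝ] ℝ) →L[ℝ] A := fun k =>
      (ContinuousLinearMap.toSpanSingleton ℝ (S ^ k)).comp
        (ContinuousMultilinearMap.apply ℝ (fun _ : Fin k => E × ℝ) ℝ fun _ => e)
    have hLv : ∀ k m, L k m = m (fun _ => e) • S ^ k := fun k m => by simp [L]
    have hL : ∀ k l, ‖(L k).compContinuousMultilinearMap (p.changeOriginSeries k l)‖₊ ≤
        ‖p.changeOriginSeries k l‖₊ * r₂ ^ k := fun k l => by
      rw [← NNReal.coe_le_coe]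
      push_cast
      refine ContinuousMultilinearMap.opNorm_le_bound (by positivity) fun m => ?_
      rw [ContinuousLinearMap.compContinuousMultilinearMap_coe, Function.comp_apply, hLv, norm_smul]
      have h1 : ‖p.changeOriginSeries k l m (fun _ => e)‖ ≤
          ‖p.changeOriginSeries k l‖ * ∏ i, ‖m i‖ := by
        refine (ContinuousMultilinearMap.le_opNorm _ _).trans ?_
        simp only [hen, Finset.prod_const_one, mul_one]
        exact ContinuousMultilinearMap.le_opNorm _ _
      have h2 : ‖S ^ k‖ ≤ r₂ ^ k := (norm_pow_le S k).trans (by gcongr)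
      calc _ ≤ (‖p.changeOriginSeries k l‖ * ∏ i, ‖m i‖) * (r₂ : ℝ) ^ k := by gcongr
        _ = _ := by ring
    have key := hasFPowerSeriesOnBall_tsum (g := fun k X => L k (p.changeOrigin X k))
      (p := fun k => (L k).compFormalMultilinearSeries (p.changeOriginSeries k)) (x := 0) hr₂0
      (fun k => (L k).comp_hasFPowerSeriesOnBall
        ((p.hasFPowerSeriesOnBall_changeOrigin k hpr).mono (by exact_mod_cast hr₂0) hle))
      (NNReal.summable_of_le (fun s => by
        refine (mul_le_mul_left (hL s.1 s.2) _).trans_eq ?_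
        ring) hsum2)
    have h3 : AnalyticAt ℝ (fun x : E => ((x - x₀, (0 : ℝ)) : E × ℝ)) x₀ := by fun_prop
    have h4 := AnalyticAt.fun_comp (g := fun X => ∑' k, L k (p.changeOrigin X k))
      (f := fun x : E => ((x - x₀, (0 : ℝ)) : E × ℝ)) (x := x₀)
      (by rw [sub_self]; exact key.analyticAt) h3
    simpa only [hLv] using h4

/-- A space of coefficient sequences of power series in one variable, on which multiplication by the
variable is a contraction. Working with this interface keeps the instances of the only space used,
that of all bounded sequences, out of the way of elaboration. -/
structure ShiftSpace (V : Type) [NormedAddCommGroup V] [NormedSpace ℝ V] where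
  /-- the coefficients -/
  coord : ℕ → V →L[ℝ] ℝ
  /-- the power series `1` -/
  one : V
  /-- multiplication by the variable -/
  shiftRight : V →L[ℝ] V
  /-- removal of the constant coefficient -/
  shiftLeft : V →L[ℝ] V
  abs_coord_le : ∀ k a, |coord k a| ≤ ‖a‖
  ext : ∀ a b, (∀ k, coord k a = coord k b) → a = b
  coord_one_zero : coord 0 one = 1
  shiftLeft_one : shiftLeft one = 0
  norm_shiftRight_le : ‖shiftRight‖ ≤ 1
  coord_shiftRight_zero : ∀ a, coord 0 (shiftRight a) = 0
  coord_shiftRight_succ : ∀ k a, coord (k + 1) (shiftRight a) = coord k a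
  coord_shiftLeft : ∀ k a, coord k (shiftLeft a) = coord (k + 1) a

/-- The bounded sequence with prescribed entries and bound. -/
def mkBddSeq (f : ℕ → ℝ) (C : ℝ) (h : ∀ k, ‖f k‖ ≤ C) : lp (fun _ : ℕ => ℝ) ∞ :=
  ⟨f, memℓp_infty ⟨C, by rintro _ ⟨k, rfl⟩; exact h k⟩⟩

/-- The bounded sequences, with the supremum norm, form a shift space. -/
theorem exists_shiftSpace : ∃ (V : Type) (_ : NormedAddCommGroup V) (_ : NormedSpace ℝ V)
    (_ : CompleteSpace V) (_ : Nontrivial V), Nonempty (ShiftSpace V) := by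
  refine ⟨lp (fun _ : ℕ => ℝ) ∞, inferInstance, inferInstance, inferInstance,
    NormOneClass.nontrivial, ⟨?_⟩⟩
  have hle : ∀ (a : lp (fun _ : ℕ => ℝ) ∞) (k : ℕ), ‖a k‖ ≤ ‖a‖ := fun a k =>
    lp.norm_apply_le_norm ENNReal.top_ne_zero a k
  refine
    { coord := fun k => LinearMap.mkContinuous
        { toFun := fun a => a k, map_add' := fun _ _ => rfl, map_smul' := fun _ _ => rfl } 1
        fun a => by rw [one_mul]; exact hle a k
      one := mkBddSeq (fun k => if k = 0 then 1 else 0) 1 fun k => by split_ifs <;> simp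
      shiftRight := LinearMap.mkContinuous
        { toFun := fun a => mkBddSeq (fun k => Nat.casesOn k 0 fun j => a j) ‖a‖ (by
            rintro (_ | k)
            · simp
            · exact hle a k)
          map_add' := fun a b => by
            ext (_ | k)
            · exact (add_zero (0 : ℝ)).symm
            · rfl
          map_smul' := fun c a => by ext (_ | k) <;> simp [mkBddSeq] } 1 fun a => by
        rw [one_mul]
        refine lp.norm_le_of_forall_le (norm_nonneg a) ?_
        rintro (_ | k)
        · simp [mkBddSeq]
        · exact hle a k
      shiftLeft := LinearMap.mkContinuous
        { toFun := fun a => mkBddSeq (fun k => a (k + 1)) ‖a‖ (fun k => hle a (k + 1))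
          map_add' := fun a b => by ext; rfl
          map_smul' := fun c a => by ext; simp [mkBddSeq] } 1 fun a => by
        rw [one_mul]
        exact lp.norm_le_of_forall_le (norm_nonneg a) fun k => hle a (k + 1)
      abs_coord_le := fun k a => hle a k
      ext := fun a b h => lp.ext (funext h)
      coord_one_zero := rfl
      shiftLeft_one := by ext k; simp [mkBddSeq]
      norm_shiftRight_le := LinearMap.mkContinuous_norm_le _ zero_le_one _
      coord_shiftRight_zero := fun a => rfl
      coord_shiftRight_succ := fun k a => rfl
      coord_shiftLeft := fun k a => rfl }

namespace ShiftSpace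

variable {V : Type} [NormedAddCommGroup V] [NormedSpace ℝ V] (P : ShiftSpace V)

theorem shiftLeft_mul_shiftRight : P.shiftLeft * P.shiftRight = 1 := by
  ext a
  exact P.ext _ _ fun k => by simp [P.coord_shiftLeft, P.coord_shiftRight_succ]

theorem shiftLeft_pow_mul_shiftRight_pow (m : ℕ) : P.shiftLeft ^ m * P.shiftRight ^ m = 1 := by
  induction m with
  | zero => simp
  | succ m ih =>
    rw [pow_succ, pow_succ', mul_assoc, ← mul_assoc P.shiftLeft, P.shiftLeft_mul_shiftRight,
      one_mul, ih]

theorem coord_shiftLeft_pow (m : ℕ) (a : V) (k : ℕ) :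
    P.coord k ((P.shiftLeft ^ m) a) = P.coord (k + m) a := by
  induction m generalizing k with
  | zero => simp
  | succ m ih =>
    rw [pow_succ', mul_apply_eq_comp, P.coord_shiftLeft, ih, add_right_comm, add_assoc]

theorem shiftLeft_pow_mul_shiftRight_pow_add (m j : ℕ) :
    P.shiftLeft ^ m * P.shiftRight ^ (m + j) = P.shiftRight ^ j := by
  rw [pow_add, ← mul_assoc, P.shiftLeft_pow_mul_shiftRight_pow, one_mul]

/-- Evaluation at `s` of the power series with bounded coefficients. -/
noncomputable def evalSeries (s : ℝ) (hs : |s| < 1) : V →L[ℝ] ℝ :=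
  have hsum : ∀ a : V, Summable fun k => P.coord k a * s ^ k := fun a => by
    refine Summable.of_norm_bounded ((summable_geometric_of_lt_one (abs_nonneg s) hs).mul_left ‖a‖)
      fun k => ?_
    rw [norm_mul, norm_pow, Real.norm_eq_abs s]
    exact mul_le_mul_of_nonneg_right (P.abs_coord_le k a) (by positivity)
  LinearMap.mkContinuous
    { toFun := fun a => ∑' k, P.coord k a * s ^ k
      map_add' := fun a b => by
        rw [← (hsum a).tsum_add (hsum b)]; simp [add_mul]
      map_smul' := fun c a => by
        simp [mul_assoc, tsum_mul_left] } (1 - |s|)⁻¹ fun a => by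
    rw [mul_comm]
    refine tsum_of_norm_bounded ((hasSum_geometric_of_lt_one (abs_nonneg s) hs).mul_left ‖a‖)
      fun k => ?_
    rw [norm_mul, norm_pow, Real.norm_eq_abs s]
    exact mul_le_mul_of_nonneg_right (P.abs_coord_le k a) (by positivity)

theorem hasSum_evalSeries (s : ℝ) (hs : |s| < 1) (a : V) :
    HasSum (fun k => P.coord k a * s ^ k) (P.evalSeries s hs a) := by
  refine Summable.hasSum ?_
  refine Summable.of_norm_bounded ((summable_geometric_of_lt_one (abs_nonneg s) hs).mul_left ‖a‖)
      fun k => ?_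
  rw [norm_mul, norm_pow, Real.norm_eq_abs s]
  exact mul_le_mul_of_nonneg_right (P.abs_coord_le k a) (by positivity)

theorem norm_evalSeries_le (s : ℝ) (hs : |s| < 1) (a : V) :
    |P.evalSeries s hs a| ≤ (1 - |s|)⁻¹ * ‖a‖ := by
  change ‖∑' k, P.coord k a * s ^ k‖ ≤ _
  rw [mul_comm]
  refine tsum_of_norm_bounded ((hasSum_geometric_of_lt_one (abs_nonneg s) hs).mul_left ‖a‖)
    fun k => ?_
  rw [norm_mul, norm_pow, Real.norm_eq_abs s]
  exact mul_le_mul_of_nonneg_right (P.abs_coord_le k a) (by positivity)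

theorem evalSeries_eq (s : ℝ) (hs : |s| < 1) (a : V) :
    P.evalSeries s hs a = P.coord 0 a + s * P.evalSeries s hs (P.shiftLeft a) := by
  have h1 := (hasSum_nat_add_iff' 1).2 (P.hasSum_evalSeries s hs a)
  have h2 := (P.hasSum_evalSeries s hs (P.shiftLeft a)).mul_left s
  have h3 := h1.unique (by convert! h2 using 2 with k; rw [P.coord_shiftLeft]; ring_nf)
  simp at h3
  linarith

theorem evalSeries_shiftRight_pow (s : ℝ) (hs : |s| < 1) (a : V) (k : ℕ) :
    P.evalSeries s hs ((P.shiftRight ^ k) a) = s ^ k * P.evalSeries s hs a := by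
  induction k with
  | zero => simp
  | succ k ih =>
    rw [pow_succ', mul_apply_eq_comp, P.evalSeries_eq, P.coord_shiftRight_zero, zero_add,
      ← mul_apply_eq_comp, P.shiftLeft_mul_shiftRight, one_apply_eq_self, ih]
    ring

theorem evalSeries_of_shiftLeft_pow_eq_zero (s : ℝ) (hs : |s| < 1) (a : V) (m : ℕ)
    (h : (P.shiftLeft ^ m) a = 0) :
    P.evalSeries s hs a = ∑ k ∈ Finset.range m, P.coord k a * s ^ k := by
  refine (P.hasSum_evalSeries s hs a).unique (hasSum_sum_of_ne_finset_zero fun k hk => ?_)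
  obtain ⟨j, rfl⟩ := Nat.exists_eq_add_of_le (not_lt.1 fun h => hk (Finset.mem_range.2 h))
  rw [add_comm m j, ← P.coord_shiftLeft_pow m a j, h, map_zero, zero_mul]

end ShiftSpace

theorem analyticAt_clm_apply {E F G : Type*} [NormedAddCommGroup E] [NormedSpace ℝ E]
    [NormedAddCommGroup F] [NormedSpace ℝ F] [NormedAddCommGroup G] [NormedSpace ℝ G]
    {T : E → F →L[ℝ] G} {v : E → F} {x : E} (hT : AnalyticAt ℝ T x) (hv : AnalyticAt ℝ v x) :
    AnalyticAt ℝ (fun y => T y (v y)) x :=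
  ((ContinuousLinearMap.id ℝ (F →L[ℝ] G)).analyticAt_bilinear (T x, v x)).comp₂ hT hv

/-- **Weierstrass preparation**: near a point at which it does not vanish identically in the last
variable, an analytic function is, up to a factor without zeros, a monic polynomial in the last
variable with analytic coefficients. -/
theorem exists_weierstrass_polynomial {E : Type*} [NormedAddCommGroup E] [NormedSpace ℝ E]
    {f : E × ℝ → ℝ} {x₀ : E} {y₀ : ℝ} (hf : AnalyticAt ℝ f (x₀, y₀))
    (hne : ¬ ∀ᶠ t in 𝓝 y₀, f (x₀, t) = 0) :
    ∃ (m : ℕ) (a : ℕ → E → ℝ) (u : E × ℝ → ℝ), (∀ k, AnalyticAt ℝ (a k) x₀) ∧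
      ∀ᶠ p in 𝓝 (x₀, y₀), u p ≠ 0 ∧
        (p.2 - y₀) ^ m + ∑ k ∈ Finset.range m, a k p.1 * (p.2 - y₀) ^ k = f p * u p := by
  obtain ⟨V, _, _, _, _, ⟨P⟩⟩ := exists_shiftSpace
  obtain ⟨c, r, hr, hc, hT⟩ := exists_analytic_substitution hf
  have hc0 := hc.self_of_nhds
  -- `m` is the order of vanishing in the last variable
  have hex : ∃ m, c m x₀ ≠ 0 := by
    by_contra! h
    refine hne ?_
    filter_upwards [Metric.ball_mem_nhds y₀ hr] with t ht
    have := hc0 (t - y₀) (by simpa [Real.dist_eq] using ht)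
    simpa using this.unique (by simp [h, hasSum_zero])
  obtain ⟨m, hm, hlt⟩ : ∃ m, c m x₀ ≠ 0 ∧ ∀ k < m, c k x₀ = 0 :=
    ⟨Nat.find hex, Nat.find_spec hex, fun k hk => by simpa using Nat.find_min hex hk⟩
  -- a radius `δ` so small that the leading coefficient dominates
  obtain ⟨δ, hδ0, hδr, hδ⟩ : ∃ δ, 0 < δ ∧ δ < r ∧
      (∑' k, |c (k + 1 + m) x₀| * δ ^ (k + 1)) < |c m x₀| := by
    have hsm := ((hc0 (r / 2) (by rw [abs_of_pos (half_pos hr)]; linarith)).summable.norm).comp_injective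
      (add_left_injective (1 + m))
    have hsm' : Summable fun k => |c (k + 1 + m) x₀| * (r / 2) ^ k := by
      refine (hsm.mul_right ((r / 2) ^ (1 + m))⁻¹).congr fun k => ?_
      have : r / 2 ≠ 0 := (half_pos hr).ne'
      simp only [Function.comp_apply, norm_mul, Real.norm_eq_abs, abs_pow, abs_of_pos (half_pos hr)]
      rw [pow_add _ k, ← mul_assoc, mul_assoc _ _ (_)⁻¹, mul_inv_cancel₀ (by positivity), mul_one,
        ← add_assoc]
    set M := ∑' k, |c (k + 1 + m) x₀| * (r / 2) ^ k with hM
    have hM0 : 0 ≤ M := tsum_nonneg fun k => by positivity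
    have hcm := abs_pos.2 hm
    refine ⟨min (r / 2) (|c m x₀| / (M + 1)), by positivity,
      (min_le_left _ _).trans_lt (by linarith), ?_⟩
    set δ := min (r / 2) (|c m x₀| / (M + 1)) with hδ
    have hδ0 : 0 < δ := by positivity
    have h1 : ∀ k, |c (k + 1 + m) x₀| * δ ^ (k + 1) ≤ δ * (|c (k + 1 + m) x₀| * (r / 2) ^ k) := by
      intro k
      have h : δ ^ k ≤ (r / 2) ^ k := by
        gcongr
        exact min_le_left _ _
      calc _ = δ * (|c (k + 1 + m) x₀| * δ ^ k) := by rw [pow_succ]; ring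
        _ ≤ _ := by gcongr
    have h2 : ∑' k, |c (k + 1 + m) x₀| * δ ^ (k + 1) ≤ δ * M := by
      rw [hM, ← tsum_mul_left]
      exact (Summable.of_nonneg_of_le (fun k => by positivity) h1 (hsm'.mul_left δ)).tsum_le_tsum h1
        (hsm'.mul_left δ)
    refine h2.trans_lt ?_
    have h3 : δ * (M + 1) ≤ |c m x₀| :=
      (le_div_iff₀ (by positivity)).1 (min_le_right _ _)
    linarith
  set S : V →L[ℝ] V := δ • P.shiftRight with hS
  have hSn : ‖S‖ ≤ δ := by
    rw [hS, norm_smul, Real.norm_of_nonneg hδ0.le]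
    exact mul_le_of_le_one_right hδ0.le P.norm_shiftRight_le
  set T : E → V →L[ℝ] V := fun x => ∑' k, c k x • S ^ k with hTdef
  have hTan : AnalyticAt ℝ T x₀ := hT _ S (hSn.trans_lt hδr)
  set W : E → V →L[ℝ] V := fun x => P.shiftLeft ^ m * T x with hW
  have hWan : AnalyticAt ℝ W x₀ := analyticAt_const.mul hTan
  have hTsum : ∀ᶠ x in 𝓝 x₀, Summable fun k => c k x • S ^ k := by
    filter_upwards [hc] with x hx
    have h1 := (hx δ (by rwa [abs_of_pos hδ0])).summable.norm
    refine Summable.of_norm_bounded h1 fun k => ?_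
    rw [norm_smul, norm_mul, norm_pow δ, Real.norm_of_nonneg hδ0.le]
    gcongr
    exact (norm_pow_le S k).trans (by gcongr)
  have hW0 : IsUnit (W x₀) ∧ ∀ a, P.coord 0 (W x₀ a) = δ ^ m * c m x₀ * P.coord 0 a := by
    set N := ∑' k, c (k + 1 + m) x₀ • S ^ (k + 1) with hN
    have hδa : |δ| < r := by rwa [abs_of_pos hδ0]
    have hsm : Summable fun k => |c (k + 1 + m) x₀| * δ ^ (k + 1) := by
      have h1 := ((hc0 δ hδa).summable.norm).comp_injective (add_left_injective (1 + m))
      refine (h1.mul_right (δ ^ m)⁻¹).congr fun k => ?_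
      simp only [Function.comp_apply, norm_mul, Real.norm_eq_abs, abs_pow, abs_of_pos hδ0]
      rw [← add_assoc, pow_add _ (k + 1), ← mul_assoc, mul_assoc _ _ (_)⁻¹,
        mul_inv_cancel₀ (by positivity), mul_one]
    have hNb : ∀ k, ‖c (k + 1 + m) x₀ • S ^ (k + 1)‖ ≤ |c (k + 1 + m) x₀| * δ ^ (k + 1) := by
      intro k
      rw [norm_smul, Real.norm_eq_abs]
      gcongr
      exact (norm_pow_le S _).trans (by gcongr)
    have hNs : HasSum (fun k => c (k + 1 + m) x₀ • S ^ (k + 1)) N :=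
      (Summable.of_norm_bounded hsm hNb).hasSum
    have hNn : ‖N‖ < |c m x₀| := (tsum_of_norm_bounded hsm.hasSum hNb).trans_lt hδ
    have hWx : W x₀ = δ ^ m • (c m x₀ • 1 + N) := by
      have h1 : HasSum (fun k => P.shiftLeft ^ m * (c k x₀ • S ^ k)) (W x₀) :=
        hTsum.self_of_nhds.hasSum.mul_left _
      have h2 := (hasSum_nat_add_iff' (m + 1)).2 h1
      have h3 : ∀ j, P.shiftLeft ^ m * (c (m + j) x₀ • S ^ (m + j)) =
          δ ^ m • c (m + j) x₀ • S ^ j := fun j => by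
        rw [hS, smul_pow, smul_pow, mul_smul_comm, mul_smul_comm,
          P.shiftLeft_pow_mul_shiftRight_pow_add, pow_add, smul_smul, smul_smul, smul_smul]
        congr 1; ring
      have h4 : ∑ k ∈ Finset.range (m + 1), P.shiftLeft ^ m * (c k x₀ • S ^ k) =
          δ ^ m • c m x₀ • 1 := by
        rw [Finset.sum_range_succ, Finset.sum_eq_zero fun k hk => by
          rw [hlt k (Finset.mem_range.1 hk), zero_smul, mul_zero], zero_add]
        simpa using h3 0
      rw [h4] at h2
      have h5 : HasSum (fun k => P.shiftLeft ^ m * (c (k + (m + 1)) x₀ • S ^ (k + (m + 1))))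
          (δ ^ m • N) := by
        convert! hNs.const_smul (δ ^ m) using 2 with k
        rw [show k + (m + 1) = m + (k + 1) by ring, h3, show m + (k + 1) = k + 1 + m by ring]
      rw [smul_add]
      exact (sub_eq_iff_eq_add'.1 (h2.unique h5))
    have hN0 : ∀ a, P.coord 0 (N a) = 0 := fun a => by
      have h1 := (hNs.mapL (ContinuousLinearMap.apply ℝ V a)).mapL (P.coord 0)
      refine h1.unique ?_
      convert! hasSum_zero using 2 with k
      simp [hS, smul_pow, pow_succ', P.coord_shiftRight_zero]
    refine ⟨?_, fun a => ?_⟩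
    · have h1 : W x₀ = (δ ^ m * c m x₀) • (1 - -((c m x₀)⁻¹ • N)) := by
        rw [hWx, sub_neg_eq_add, mul_smul, smul_add (c m x₀), smul_smul (c m x₀), mul_inv_cancel₀ hm,
          one_smul]
      have h2 : ‖-((c m x₀)⁻¹ • N)‖ < 1 := by
        rw [norm_neg, norm_smul, norm_inv, Real.norm_eq_abs, inv_mul_lt_iff₀ (abs_pos.2 hm), mul_one]
        exact hNn
      rw [h1]
      exact (isUnit_one_sub_of_norm_lt_one h2).smul
        (Units.mk0 (δ ^ m * c m x₀) (mul_ne_zero (pow_pos hδ0 m).ne' hm))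
    · rw [hWx]
      simp only [smul_apply, add_apply, map_smul, map_add,
        one_apply_eq_self, hN0, smul_eq_mul, add_zero]
      ring
  obtain ⟨hWu, hWc⟩ := hW0
  let o : V := P.one
  let q : E → V := fun x => Ring.inverse (W x) o
  have hinv : AnalyticAt ℝ (fun x => Ring.inverse (W x)) x₀ := by
    obtain ⟨w, hw⟩ := hWu
    exact AnalyticAt.fun_comp (by rw [← hw]; exact analyticAt_inverse w) hWan
  have hq : AnalyticAt ℝ q x₀ := analyticAt_clm_apply hinv analyticAt_const
  have hWq : ∀ᶠ x in 𝓝 x₀, W x (q x) = o := by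
    have : ∀ᶠ x in 𝓝 x₀, IsUnit (W x) :=
      hWan.continuousAt.eventually (Units.isOpen.mem_nhds hWu)
    filter_upwards [this] with x hx
    rw [← mul_apply_eq_comp, Ring.mul_inverse_cancel _ hx,
      one_apply_eq_self]
  let R : E → V := fun x => (P.shiftRight ^ m) o - T x (q x)
  have hR : AnalyticAt ℝ R x₀ := analyticAt_const.sub (analyticAt_clm_apply hTan hq)
  have hq0 : P.coord 0 (q x₀) ≠ 0 := by
    have h1 := hWc (q x₀)
    rw [hWq.self_of_nhds] at h1
    intro h2
    rw [h2, mul_zero] at h1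
    exact one_ne_zero (P.coord_one_zero.symm.trans h1)
  refine ⟨m, fun k x => -(δ ^ m * (P.coord k (R x) / δ ^ k)),
    fun p => if h : |(p.2 - y₀) / δ| < 1 then δ ^ m * P.evalSeries _ h (q p.1) else 0, ?_, ?_⟩
  · intro k
    have : AnalyticAt ℝ (fun x => P.coord k (R x)) x₀ :=
      ((P.coord k).analyticAt _).fun_comp hR
    exact (analyticAt_const.mul (this.div analyticAt_const (pow_pos hδ0 k).ne')).neg
  · have hfst : Tendsto (Prod.fst : E × ℝ → E) (𝓝 (x₀, y₀)) (𝓝 x₀) := continuous_fst.tendsto _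
    have hs0 : Tendsto (fun p : E × ℝ => |(p.2 - y₀) / δ|) (𝓝 (x₀, y₀)) (𝓝 0) := by
      have : Continuous fun p : E × ℝ => |(p.2 - y₀) / δ| := by fun_prop
      simpa using this.tendsto (x₀, y₀)
    have hqc : Tendsto (fun p : E × ℝ => q p.1) (𝓝 (x₀, y₀)) (𝓝 (q x₀)) :=
      hq.continuousAt.tendsto.comp hfst
    have hsmall : ∀ᶠ p in 𝓝 (x₀, y₀), |(p.2 - y₀) / δ| * ((1 - |(p.2 - y₀) / δ|)⁻¹ *
        ‖P.shiftLeft (q p.1)‖) < |P.coord 0 (q p.1)| := by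
      have h1 : Tendsto (fun p : E × ℝ => |(p.2 - y₀) / δ| * ((1 - |(p.2 - y₀) / δ|)⁻¹ *
          ‖P.shiftLeft (q p.1)‖)) (𝓝 (x₀, y₀)) (𝓝 (0 * ((1 - 0)⁻¹ * ‖P.shiftLeft (q x₀)‖))) :=
        hs0.mul (((tendsto_const_nhds.sub hs0).inv₀ (by norm_num)).mul
          ((P.shiftLeft.continuous.tendsto _).comp hqc).norm)
      have h2 : Tendsto (fun p : E × ℝ => |P.coord 0 (q p.1)|) (𝓝 (x₀, y₀)) (𝓝 |P.coord 0 (q x₀)|) :=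
        (((P.coord 0).continuous.tendsto _).comp hqc).abs
      exact h1.eventually_lt h2 (by simpa using hq0)
    filter_upwards [hs0.eventually_lt_const one_pos, hfst.eventually hc, hfst.eventually hTsum,
      hfst.eventually hWq, hsmall] with p hp hcp hTp hWp hsm
    rw [dif_pos hp]
    set s := (p.2 - y₀) / δ with hs
    have hsδ : p.2 - y₀ = s * δ := by rw [hs]; field_simp
    have hsδr : |s * δ| < r := by
      rw [abs_mul, abs_of_pos hδ0]
      nlinarith [abs_nonneg s]
    refine ⟨mul_ne_zero (pow_pos hδ0 m).ne' fun h0 => ?_, ?_⟩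
    · rw [P.evalSeries_eq] at h0
      have h1 : |P.coord 0 (q p.1)| = |s * P.evalSeries s hp (P.shiftLeft (q p.1))| := by
        rw [← abs_neg]; congr 1; linarith
      rw [abs_mul] at h1
      have h2 := P.norm_evalSeries_le s hp (P.shiftLeft (q p.1))
      have h3 := mul_le_mul_of_nonneg_left h2 (abs_nonneg s)
      linarith
    · have hev : P.evalSeries s hp (T p.1 (q p.1)) = f p * P.evalSeries s hp (q p.1) := by
        have h1 : HasSum (fun k => P.evalSeries s hp ((c k p.1 • S ^ k) (q p.1)))
            (P.evalSeries s hp (T p.1 (q p.1))) :=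
          ((hTp.hasSum.mapL (ContinuousLinearMap.apply ℝ _ (q p.1)))).mapL (P.evalSeries s hp)
        have h2 := (hcp (s * δ) hsδr).mul_right (P.evalSeries s hp (q p.1))
        rw [← hsδ, add_sub_cancel] at h2
        refine h1.unique ?_
        convert! h2 using 2 with k
        rw [hS, smul_pow, smul_apply, smul_apply, map_smul,
          map_smul, P.evalSeries_shiftRight_pow, hsδ]
        simp only [smul_eq_mul]
        ring_nf
      have hRm : (P.shiftLeft ^ m) (R p.1) = 0 := by
        simp only [R, map_sub]
        rw [← mul_apply_eq_comp, P.shiftLeft_pow_mul_shiftRight_pow,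
          ← mul_apply_eq_comp]
        change o - W p.1 (q p.1) = 0
        rw [hWp, sub_self]
      have h3 : P.evalSeries s hp (R p.1) = s ^ m - f p * P.evalSeries s hp (q p.1) := by
        simp only [R, map_sub]
        rw [hev, P.evalSeries_shiftRight_pow, P.evalSeries_of_shiftLeft_pow_eq_zero s hp o 1]
        · simp [o, P.coord_one_zero]
        · simpa using P.shiftLeft_one
      rw [P.evalSeries_of_shiftLeft_pow_eq_zero s hp _ m hRm] at h3
      have h4 : ∑ k ∈ Finset.range m, -(δ ^ m * (P.coord k (R p.1) / δ ^ k)) * (p.2 - y₀) ^ k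
          = -(δ ^ m * ∑ k ∈ Finset.range m, P.coord k (R p.1) * s ^ k) := by
        rw [Finset.mul_sum, ← Finset.sum_neg_distrib]
        refine Finset.sum_congr rfl fun k _ => ?_
        rw [hsδ, mul_pow]
        field_simp
      have h5 : (p.2 - y₀) ^ m = s ^ m * δ ^ m := by rw [hsδ, mul_pow]
      rw [h4, h3, h5]
      ring

/-! ### Zero sets of analytic functions of three variables -/

open Polynomial in
/-- Generic simplicity of roots: after inverting a single non-zero element `d` of the coefficient
domain, a monic polynomial `p` has the same roots as a divisor `h` with `h` and `h'` coprime. -/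
theorem exists_separable_reduction {R : Type*} [CommRing R] [IsDomain R] [CharZero R] {p : R[X]}
    (hp : p ≠ 0) :
    ∃ (d : R) (h g k u v : R[X]) (n : ℕ), d ≠ 0 ∧ C d * p = h * g ∧ C d * h ^ n = p * k ∧
      u * h + v * derivative h = C d := by
  let K := FractionRing R
  have hinj : Function.Injective (algebraMap R K) := IsFractionRing.injective R K
  have : CharZero K := charZero_of_injective_algebraMap hinj
  have hpK : p.map (algebraMap R K) ≠ 0 := (Polynomial.map_ne_zero_iff hinj).2 hp
  obtain ⟨y, n, hy, ⟨g₀, hg₀⟩, ⟨k₀, hk₀⟩⟩ := exists_squarefree_dvd_pow_of_ne_zero hpK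
  -- clear the denominators of `y`
  have clear : ∀ f : K[X], ∃ b : R, b ≠ 0 ∧ ∃ q : R[X], q.map (algebraMap R K) =
      C (algebraMap R K b) * f := fun f => by
    obtain ⟨b, hb, h⟩ := IsLocalization.integerNormalization_spec (nonZeroDivisors R) f
    refine ⟨b, nonZeroDivisors.ne_zero hb, _, h.trans ?_⟩
    rw [Algebra.smul_def]; rfl
  obtain ⟨b, hb, h, hh⟩ := clear y
  have hbK : algebraMap R K b ≠ 0 := fun h0 => hb (hinj (h0.trans (map_zero _).symm))
  have hsep : y.Separable := PerfectField.separable_iff_squarefree.2 hy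
  obtain ⟨u₀, v₀, huv⟩ := hsep
  obtain ⟨b₁, hb₁, g, hg⟩ := clear g₀
  obtain ⟨b₂, hb₂, k, hk⟩ := clear k₀
  obtain ⟨b₃, hb₃, u, hu⟩ := clear u₀
  obtain ⟨b₄, hb₄, v, hv⟩ := clear v₀
  have mi := Polynomial.map_injective (algebraMap R K) hinj
  refine ⟨b * b₁ * b₂ * b₃ * b₄, h, C (b₂ * b₃ * b₄) * g, C (b ^ (n + 1) * b₁ * b₃ * b₄) * k,
    C (b₁ * b₂ * b₄) * u, C (b₁ * b₂ * b₃) * v, n, ?_, mi ?_, mi ?_, mi ?_⟩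
  · simp only [mul_ne_zero_iff]; tauto
  · simp only [Polynomial.map_mul, Polynomial.map_C, hh, hg, hg₀, map_mul]
    ring
  · simp only [Polynomial.map_mul, Polynomial.map_pow, Polynomial.map_C, hh, hk, map_mul, map_pow,
      mul_pow]
    rw [hk₀]
    ring
  · simp only [Polynomial.map_mul, Polynomial.map_add, Polynomial.map_C, hh, hu, hv, map_mul,
      ← Polynomial.derivative_map, derivative_C_mul]
    linear_combination (C (algebraMap R K b) * C (algebraMap R K b₁) * C (algebraMap R K b₂) *
      C (algebraMap R K b₃) * C (algebraMap R K b₄)) * huv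

/-- The ring of restrictions to `U` of functions analytic on a neighbourhood of `U`. -/
def analyticRing {E : Type*} [NormedAddCommGroup E] [NormedSpace ℝ E] (U : Set E) :
    Subring (U → ℝ) where
  carrier := {g | ∃ G : E → ℝ, AnalyticOnNhd ℝ G U ∧ ∀ x : U, G x = g x}
  mul_mem' := by
    rintro _ _ ⟨G, hG, h⟩ ⟨G', hG', h'⟩
    exact ⟨G * G', hG.mul hG', fun x => by simp [h, h']⟩
  one_mem' := ⟨1, analyticOnNhd_const, fun _ => rfl⟩
  add_mem' := by
    rintro _ _ ⟨G, hG, h⟩ ⟨G', hG', h'⟩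
    exact ⟨G + G', hG.add hG', fun x => by simp [h, h']⟩
  zero_mem' := ⟨0, analyticOnNhd_const, fun _ => rfl⟩
  neg_mem' := by
    rintro _ ⟨G, hG, h⟩
    exact ⟨-G, hG.neg, fun x => by simp [h]⟩

/-- The ring of analytic functions on a connected open set is a domain, by the identity theorem. -/
theorem isDomain_analyticRing {E : Type*} [NormedAddCommGroup E] [NormedSpace ℝ E] {U : Set E}
    (hU : IsOpen U) (hc : IsConnected U) : IsDomain (analyticRing U) := by
  have : Nonempty U := hc.nonempty.to_subtype
  have hz : ∀ {G : E → ℝ} {x : E}, AnalyticOnNhd ℝ G U → x ∈ U → (∀ᶠ y in 𝓝 x, G y = 0) →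
      ∀ y ∈ U, G y = 0 := fun hG hx h y hy =>
    hG.eqOn_zero_of_preconnected_of_eventuallyEq_zero hc.isPreconnected hx h hy
  have : NoZeroDivisors (analyticRing U) := by
    refine ⟨?_⟩
    rintro ⟨a, G, hG, h⟩ ⟨b, G', hG', h'⟩ hab
    have hab' : ∀ x (hx : x ∈ U), G x * G' x = 0 := fun x hx => by
      rw [h ⟨x, hx⟩, h' ⟨x, hx⟩]
      exact congrFun (congrArg Subtype.val hab) ⟨x, hx⟩
    by_cases hG0 : ∀ x ∈ U, G x = 0
    · left
      ext x
      exact (h x).symm.trans (hG0 x x.2)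
    · right
      push Not at hG0
      obtain ⟨x, hx, hx0⟩ := hG0
      have h1 : ∀ᶠ y in 𝓝 x, G' y = 0 := by
        filter_upwards [(hG x hx).continuousAt.eventually_ne hx0, hU.mem_nhds hx] with y hy hyU
        exact (mul_eq_zero.1 (hab' y hyU)).resolve_left hy
      ext y
      exact (h' y).symm.trans (hz hG' hx h1 y y.2)
  exact NoZeroDivisors.to_isDomain _

/-- Implicit function theorem for the zero set of a scalar analytic function. -/
theorem exists_analytic_implicit {E : Type*} [NormedAddCommGroup E] [NormedSpace ℝ E]
    [CompleteSpace E] {f : E × ℝ → ℝ} {x₀ : E} {y₀ : ℝ} (hf : AnalyticAt ℝ f (x₀, y₀))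
    (h0 : f (x₀, y₀) = 0) (hd : fderiv ℝ f (x₀, y₀) (0, 1) ≠ 0) :
    ∃ φ : E → ℝ, AnalyticAt ℝ φ x₀ ∧ φ x₀ = y₀ ∧
      ∀ᶠ p in 𝓝 (x₀, y₀), f p = 0 ↔ p.2 = φ p.1 := by
  have hc : ContDiffAt ℝ ω f (x₀, y₀) := hf.contDiffAt
  have hinv : (fderiv ℝ f (x₀, y₀) ∘L .inr ℝ E ℝ).IsInvertible := by
    refine ⟨ContinuousLinearEquiv.unitsEquivAut ℝ (Units.mk0 _ hd), ?_⟩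
    ext; simp
  refine ⟨hc.implicitFunction (by simp) hinv, ?_, hc.implicitFunction_apply_self (by simp) hinv, ?_⟩
  · exact (hc.contDiffAt_implicitFunction (by simp) hinv).analyticAt
  · have := hc.eventually_apply_eq_iff_implicitFunction (by simp) hinv
    filter_upwards [this] with p hp
    rw [h0] at hp
    rw [hp, eq_comm]

open Polynomial in
/-- Near a point where it does not vanish identically in the last variable, an analytic function has
finite zero fibres, and over the complement of the zero set of a nontrivial analytic function `h`
(a discriminant) its zero set consists of graphs of analytic functions. -/
theorem exists_discriminant {E : Type*} [NormedAddCommGroup E] [NormedSpace ℝ E] [CompleteSpace E]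
    {f : E × ℝ → ℝ} {x₀ : E} {y₀ : ℝ} (hf : AnalyticAt ℝ f (x₀, y₀))
    (hne : ¬ ∀ᶠ t in 𝓝 y₀, f (x₀, t) = 0) :
    ∃ (h : E → ℝ) (U : Set (E × ℝ)), U ∈ 𝓝 (x₀, y₀) ∧ AnalyticAt ℝ h x₀ ∧
      (¬ ∀ᶠ x in 𝓝 x₀, h x = 0) ∧
      (∀ x y, (x, y) ∈ U → f (x, y) = 0 → h x ≠ 0 → ∃ φ : E → ℝ, AnalyticAt ℝ φ x ∧ φ x = y ∧
        ∀ᶠ p in 𝓝 (x, y), f p = 0 ↔ p.2 = φ p.1) ∧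
      ∀ x, {y | (x, y) ∈ U ∧ f (x, y) = 0}.Finite := by
  obtain ⟨m, a, u, ha, hau⟩ := exists_weierstrass_polynomial hf hne
  have ha' : ∀ᶠ x in 𝓝 x₀, ∀ k ∈ Finset.range m, AnalyticAt ℝ (a k) x :=
    (Finset.eventually_all _).2 fun k _ => (ha k).eventually_analyticAt
  rw [nhds_prod_eq, eventually_prod_iff] at hau
  obtain ⟨pa, hpa, pb, hpb, hab⟩ := hau
  obtain ⟨r', hr', hball'⟩ := Metric.eventually_nhds_iff_ball.1 hpb
  obtain ⟨r, hr, hball⟩ := Metric.eventually_nhds_iff_ball.1 (ha'.and hpa)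
  set B := Metric.ball x₀ r with hB
  have hBo : IsOpen B := Metric.isOpen_ball
  have hBc : IsConnected B := (convex_ball x₀ r).isConnected ⟨x₀, Metric.mem_ball_self hr⟩
  have := isDomain_analyticRing hBo hBc
  have hx₀B : x₀ ∈ B := Metric.mem_ball_self hr
  let ev : B → analyticRing B →+* ℝ := fun x => (Pi.evalRingHom (fun _ : B => ℝ) x).comp
    (analyticRing B).subtype
  have hev : ∀ x c, ev x c = c.1 x := fun _ _ => rfl
  have : CharZero (analyticRing B) := ⟨fun i j hij => by
    have := congrArg (ev ⟨x₀, hx₀B⟩) hij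
    simpa using this⟩
  choose! ext hext hexteq using fun c : analyticRing B => c.2
  let A : ℕ → analyticRing B := fun k => if hk : k ∈ Finset.range m then
    ⟨fun x => a k x, a k, fun x hx => (hball x hx).1 k hk, fun _ => rfl⟩ else 0
  have hA : ∀ k ∈ Finset.range m, ∀ x : B, ev x (A k) = a k x := fun k hk x => by
    simp only [A, dif_pos hk, hev]
  let P : (analyticRing B)[X] := X ^ m + ∑ k ∈ Finset.range m, C (A k) * X ^ k
  have hPm : P.coeff m = 1 := by
    simp [P, coeff_X_pow]
  have hP0 : P ≠ 0 := fun h => by simp [h] at hPm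
  have hPe : ∀ (x : B) (y : ℝ), (P.map (ev x)).eval y =
      y ^ m + ∑ k ∈ Finset.range m, a k x * y ^ k := fun x y => by
    simp only [P, Polynomial.map_add, Polynomial.map_pow, map_X, Polynomial.map_sum,
      Polynomial.map_mul, map_C, eval_add, eval_pow, eval_X, eval_finsetSum, eval_mul, eval_C]
    congr 1
    exact Finset.sum_congr rfl fun k hk => by rw [hA k hk x]
  obtain ⟨d, q, g, k, s, t, n, hd, hdp, hdq, hst⟩ := exists_separable_reduction hP0
  let U : Set (E × ℝ) := B ×ˢ Metric.ball y₀ r'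
  have hU : ∀ (x : B) (y : ℝ), y ∈ Metric.ball y₀ r' → (f (x, y) = 0 ↔ (P.map (ev x)).eval (y - y₀) = 0) := by
    intro x y hy
    obtain ⟨h1, h2⟩ := hab (hball x x.2).2 (hball' y hy)
    rw [hPe, h2, mul_eq_zero, or_iff_left h1]
  have hroot : ∀ (x : B) (y : ℝ), d.1 x ≠ 0 →
      ((P.map (ev x)).eval y = 0 ↔ (q.map (ev x)).eval y = 0) := by
    intro x y hdx
    have h1 := congrArg (fun w => (w.map (ev x)).eval y) hdp
    have h2 := congrArg (fun w => (w.map (ev x)).eval y) hdq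
    simp only [Polynomial.map_mul, Polynomial.map_pow, map_C, eval_mul, eval_C, eval_pow,
      hev] at h1 h2
    constructor
    · intro h
      rw [h, zero_mul, mul_eq_zero, or_iff_right hdx] at h2
      by_contra hq; exact pow_ne_zero n hq h2
    · intro h
      rw [h, zero_mul, mul_eq_zero, or_iff_right hdx] at h1
      exact h1
  refine ⟨ext d, U, prod_mem_nhds (hBo.mem_nhds hx₀B) (Metric.ball_mem_nhds y₀ hr'), hext d x₀ hx₀B, ?_, ?_, ?_⟩
  · intro h
    have := (hext d).eqOn_zero_of_preconnected_of_eventuallyEq_zero hBc.isPreconnected hx₀B h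
    exact hd (Subtype.ext (funext fun x => (hexteq d x).symm.trans (this x.2)))
  · rintro x y ⟨hx, hy⟩ hfxy hdx
    have hpos : ∀ x : B, ext d x ≠ 0 → d.1 x ≠ 0 := fun x h => by rwa [← hexteq d x]
    let Q : E × ℝ → ℝ := fun p => ∑ i ∈ Finset.range (q.natDegree + 1),
      ext (q.coeff i) p.1 * (p.2 - y₀) ^ i
    have hQ : ∀ (x : B) (y : ℝ), Q (x, y) = (q.map (ev x)).eval (y - y₀) := fun x y => by
      rw [eval_map, eval₂_eq_sum_range]
      exact Finset.sum_congr rfl fun i _ => by rw [hexteq]; rfl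
    have hQa : AnalyticAt ℝ Q (x, y) := by
      refine Finset.analyticAt_fun_sum _ fun i _ => ?_
      refine AnalyticAt.mul ?_ ((analyticAt_snd.sub analyticAt_const).pow i)
      exact (hext (q.coeff i) x hx).fun_comp_of_eq analyticAt_fst rfl
    have hq0 : (q.map (ev ⟨x, hx⟩)).eval (y - y₀) = 0 :=
      (hroot _ _ (hpos ⟨x, hx⟩ hdx)).1 ((hU ⟨x, hx⟩ y hy).1 hfxy)
    have hder : fderiv ℝ Q (x, y) (0, 1) ≠ 0 := by
      have h1 : HasDerivAt (fun t => Q (x, t)) (fderiv ℝ Q (x, y) (0, 1)) y := by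
        have h2 : HasDerivAt (fun t : ℝ => (x, t)) ((0 : E), (1 : ℝ)) y :=
          (hasDerivAt_const y x).prodMk (hasDerivAt_id y)
        exact hQa.differentiableAt.hasFDerivAt.comp_hasDerivAt y h2
      have h3 : HasDerivAt (fun t => Q (x, t)) ((derivative (q.map (ev ⟨x, hx⟩))).eval (y - y₀)) y := by
        have h4 := ((q.map (ev ⟨x, hx⟩)).hasDerivAt (y - y₀)).comp_sub_const y y₀
        exact h4.congr_of_eventuallyEq (Eventually.of_forall fun t => hQ ⟨x, hx⟩ t)
      rw [h1.unique h3]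
      intro h5
      have h6 := congrArg (fun w => (w.map (ev ⟨x, hx⟩)).eval (y - y₀)) hst
      simp only [Polynomial.map_mul, Polynomial.map_add, map_C, eval_mul, eval_add, eval_C, hq0,
        ← derivative_map, h5, mul_zero, add_zero] at h6
      exact hpos ⟨x, hx⟩ hdx h6.symm
    obtain ⟨φ, hφ, hφx, hφe⟩ := exists_analytic_implicit hQa
      ((hQ ⟨x, hx⟩ y).trans hq0) hder
    refine ⟨φ, hφ, hφx, ?_⟩
    have hcd : ContinuousAt (fun p : E × ℝ => ext d p.1) (x, y) :=
      ((hext d x hx).continuousAt.comp_of_eq continuousAt_fst rfl)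
    filter_upwards [hφe, (hBo.prod Metric.isOpen_ball).mem_nhds ⟨hx, hy⟩, hcd.eventually_ne hdx]
      with p hp hpU hpd
    rw [← hp, show Q p = Q (p.1, p.2) from rfl, hQ ⟨p.1, hpU.1⟩ p.2,
      ← hroot _ _ (hpos ⟨p.1, hpU.1⟩ hpd), ← hU ⟨p.1, hpU.1⟩ p.2 hpU.2]
  · intro x
    by_cases hx : x ∈ B
    · have hP' : P.map (ev ⟨x, hx⟩) ≠ 0 := fun h => by
        have := congrArg (fun w => w.coeff m) h
        simp [coeff_map, hPm] at this
      refine ((P.map (ev ⟨x, hx⟩)).roots.toFinset.finite_toSet.preimage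
        (sub_left_injective (b := y₀)).injOn).subset ?_
      rintro y ⟨⟨-, hy⟩, hfy⟩
      simp only [mem_preimage, Finset.mem_coe, Multiset.mem_toFinset]
      exact (mem_roots hP').2 ((hU ⟨x, hx⟩ y hy).1 hfy)
    · exact Set.finite_empty.subset fun y hy => hx hy.1.1

section structureTheory

variable {V : Type*} [NormedAddCommGroup V] [NormedSpace ℝ V]

/-- Near `q` the set `A` is an analytic arc, parametrized by a linear coordinate `ℓ`. -/
def IsCurvePoint (A : Set V) (q : V) : Prop :=
  ∃ (ℓ : V →L[ℝ] ℝ) (γ : ℝ → V), AnalyticAt ℝ γ (ℓ q) ∧ γ (ℓ q) = q ∧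
    (∀ᶠ t in 𝓝 (ℓ q), ℓ (γ t) = t) ∧ ∀ᶠ q' in 𝓝 q, q' ∈ A ↔ γ (ℓ q') = q'

/-- `A` contains a piece of an analytic surface, parametrized by two linear coordinates `π`. -/
def ContainsAnalyticSurface (A : Set V) : Prop :=
  ∃ (π : V →L[ℝ] ℝ × ℝ) (ψ : ℝ × ℝ → V) (x : ℝ × ℝ), AnalyticAt ℝ ψ x ∧
    ∀ᶠ y in 𝓝 x, π (ψ y) = y ∧ ψ y ∈ A

theorem IsCurvePoint.of_equiv {W : Type*} [NormedAddCommGroup W] [NormedSpace ℝ W] (e : W ≃L[ℝ] V)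
    {A : Set V} {q : W} (h : IsCurvePoint (e ⁻¹' A) q) : IsCurvePoint A (e q) := by
  obtain ⟨ℓ, γ, h1, h2, h3, h4⟩ := h
  refine ⟨ℓ.comp (e.symm : V →L[ℝ] W), fun t => e (γ t), ?_, ?_, ?_, ?_⟩
  · simpa using (e.analyticAt _).fun_comp h1
  · simp [h2]
  · simpa using h3
  · have h5 : Tendsto e.symm (𝓝 (e q)) (𝓝 q) := by
      simpa using e.symm.continuous.tendsto (e q)
    filter_upwards [h5.eventually h4] with q' hq'
    rw [mem_preimage, e.apply_symm_apply] at hq'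
    rw [hq', ContinuousLinearMap.comp_apply, ContinuousLinearEquiv.coe_coe, e.eq_symm_apply]

theorem ContainsAnalyticSurface.of_equiv {W : Type*} [NormedAddCommGroup W] [NormedSpace ℝ W]
    (e : W ≃L[ℝ] V) {A : Set V} (h : ContainsAnalyticSurface (e ⁻¹' A)) :
    ContainsAnalyticSurface A := by
  obtain ⟨π, ψ, x, h1, h2⟩ := h
  refine ⟨π.comp (e.symm : V →L[ℝ] W), fun t => e (ψ t), x, (e.analyticAt _).fun_comp h1, ?_⟩
  simpa using h2

theorem exists_equiv_prod_real {E : Type*} [NormedAddCommGroup E] [NormedSpace ℝ E]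
    [FiniteDimensional ℝ E] [FiniteDimensional ℝ V]
    (hd : Module.finrank ℝ V = Module.finrank ℝ E + 1) {v : V} (hv : v ≠ 0) :
    ∃ e : (E × ℝ) ≃L[ℝ] V, e (0, 1) = v := by
  obtain ⟨W, hW⟩ := Submodule.exists_isCompl (ℝ ∙ v)
  have h1 : Module.finrank ℝ E = Module.finrank ℝ W := by
    have h2 := Submodule.finrank_add_eq_of_isCompl hW
    rw [finrank_span_singleton hv] at h2
    omega
  let e := ((LinearEquiv.ofFinrankEq E W h1).prodCongr
    (LinearEquiv.toSpanNonzeroSingleton ℝ V v hv)).trans (W.prodEquivOfIsCompl _ hW.symm)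
  refine ⟨e.toContinuousLinearEquiv, ?_⟩
  simp [e]

/-- A nontrivial analytic germ is nontrivial along some direction, which can be taken as the last
coordinate. -/
theorem exists_equiv_not_eventually_zero {E : Type*} [NormedAddCommGroup E] [NormedSpace ℝ E]
    [FiniteDimensional ℝ E] [FiniteDimensional ℝ V]
    (hd : Module.finrank ℝ V = Module.finrank ℝ E + 1) {f : V → ℝ} {p : V} (hf : AnalyticAt ℝ f p)
    (h0 : f p = 0) (hne : ¬ ∀ᶠ q in 𝓝 p, f q = 0) :
    ∃ e : (E × ℝ) ≃L[ℝ] V, ¬ ∀ᶠ t in 𝓝 (e.symm p).2, f (e ((e.symm p).1, t)) = 0 := by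
  obtain ⟨r, hr, hball⟩ := Metric.eventually_nhds_iff_ball.1 hf.eventually_analyticAt
  obtain ⟨p', hp', hfp'⟩ : ∃ p' ∈ Metric.ball p r, f p' ≠ 0 := by
    by_contra! h
    exact hne (Metric.eventually_nhds_iff_ball.2 ⟨r, hr, h⟩)
  have hv : p' - p ≠ 0 := by
    rw [sub_ne_zero]; rintro rfl; exact hfp' h0
  obtain ⟨e, he⟩ := exists_equiv_prod_real hd hv
  refine ⟨e, fun h => hfp' ?_⟩
  set x := e.symm p with hx
  have hline : ∀ t : ℝ, e (x.1, t) = p + (t - x.2) • (p' - p) := fun t => by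
    rw [← he, ← e.map_smul, ← e.apply_symm_apply p, ← map_add, ← hx]
    congr 1
    ext <;> simp
  let L : ℝ → V := fun t => e (x.1, t)
  have hL : ∀ t, AnalyticAt ℝ L t := fun t =>
    (e.analyticAt _).fun_comp (analyticAt_const.prod analyticAt_id)
  have hconv : Convex ℝ (L ⁻¹' Metric.ball p r) := by
    have : L = fun t => AffineMap.lineMap (p - x.2 • (p' - p)) (p - x.2 • (p' - p) + (p' - p)) t := by
      ext t
      simp only [L, hline, AffineMap.lineMap_apply, vsub_eq_sub, vadd_eq_add]
      module
    rw [this]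
    exact (convex_ball p r).affine_preimage (AffineMap.lineMap _ _)
  have han : AnalyticOnNhd ℝ (fun t => f (L t)) (L ⁻¹' Metric.ball p r) := fun t ht =>
    (hball _ ht).fun_comp (hL t)
  have hmem0 : x.2 ∈ L ⁻¹' Metric.ball p r := by
    simp [L, hline, hr]
  have hmem1 : x.2 + 1 ∈ L ⁻¹' Metric.ball p r := by
    simpa [L, hline] using hp'
  have := han.eqOn_zero_of_preconnected_of_eventuallyEq_zero hconv.isPreconnected hmem0 h hmem1
  simpa [L, hline] using this

/-- Zeros of an analytic function of two variables, off one fibre near a given point, are locally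
graphs. -/
theorem eventually_exists_graph {g : ℝ × ℝ → ℝ} {s y : ℝ} (hg : AnalyticAt ℝ g (s, y))
    (hne : ¬ ∀ᶠ t in 𝓝 y, g (s, t) = 0) :
    ∀ᶠ p in 𝓝 (s, y), g p = 0 → p.1 ≠ s → ∃ φ : ℝ → ℝ, AnalyticAt ℝ φ p.1 ∧ φ p.1 = p.2 ∧
      ∀ᶠ p' in 𝓝 p, g p' = 0 ↔ p'.2 = φ p'.1 := by
  obtain ⟨h, U, hU, hh, hh0, hgr, -⟩ := exists_discriminant hg hne
  have h1 := (hh.eventually_eq_zero_or_eventually_ne_zero).resolve_left hh0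
  rw [eventually_nhdsWithin_iff] at h1
  have h2 : Tendsto (Prod.fst : ℝ × ℝ → ℝ) (𝓝 (s, y)) (𝓝 s) := continuous_fst.tendsto _
  filter_upwards [hU, h2.eventually h1] with p hpU hp hgp hps
  exact hgr p.1 p.2 hpU hgp (hp hps)

theorem isCurvePoint_of_graphs {F : (ℝ × ℝ) × ℝ → ℝ} {ψ φ : ℝ → ℝ} {s z y : ℝ}
    (hψ : AnalyticAt ℝ ψ s) (hφ : AnalyticAt ℝ φ s) (hψs : ψ s = z) (hφs : φ s = y)
    (h : ∀ᶠ q in 𝓝 ((s, z), y), F q = 0 ↔ q.1.2 = ψ q.1.1 ∧ q.2 = φ q.1.1) :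
    IsCurvePoint {q | F q = 0} ((s, z), y) := by
  refine ⟨(ContinuousLinearMap.fst ℝ ℝ ℝ).comp (ContinuousLinearMap.fst ℝ (ℝ × ℝ) ℝ),
    fun t => ((t, ψ t), φ t), (analyticAt_id.prod hψ).prod hφ, by simp [hψs, hφs], by simp, ?_⟩
  filter_upwards [h] with q hq
  rw [hq]
  simp [Prod.ext_iff, eq_comm]

/-- If the zeros of `F` near a point lie over the graph of `ψ`, and are isolated in the fibre, then
the other zeros near the point are curve points. -/
theorem eventually_isCurvePoint {F : (ℝ × ℝ) × ℝ → ℝ} {ψ : ℝ → ℝ} {s z y : ℝ}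
    (hF : AnalyticAt ℝ F ((s, z), y)) (hψ : AnalyticAt ℝ ψ s) (hψs : ψ s = z)
    (hz : ∀ᶠ q in 𝓝 ((s, z), y), F q = 0 → q.1.2 = ψ q.1.1)
    (hy : ∀ᶠ t in 𝓝 y, F ((s, z), t) = 0 → t = y) :
    ∀ᶠ q in 𝓝 ((s, z), y), F q = 0 → q ≠ ((s, z), y) → IsCurvePoint {q | F q = 0} q := by
  let G : ℝ × ℝ → ℝ := fun p => F ((p.1, ψ p.1), p.2)
  have hG : AnalyticAt ℝ G (s, y) := by
    have h1 : AnalyticAt ℝ (fun p : ℝ × ℝ => ((p.1, ψ p.1), p.2)) (s, y) :=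
      (analyticAt_fst.prod (hψ.fun_comp_of_eq analyticAt_fst rfl)).prod analyticAt_snd
    exact hF.fun_comp_of_eq h1 (by simp [hψs])
  have hGne : ¬ ∀ᶠ t in 𝓝 y, G (s, t) = 0 := fun h => by
    have h1 : ∀ᶠ t in 𝓝 y, t = y := by
      filter_upwards [h, hy] with t ht hty
      exact hty (by simpa [G, hψs] using ht)
    have h2 : ({y} : Set ℝ) ∈ 𝓝 y := h1
    have := (isOpen_singleton_iff_nhds_eq_pure y).2 (le_antisymm (by simpa using h2) (pure_le_nhds y))
    exact not_isOpen_singleton y this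
  have h1 := eventually_exists_graph hG hGne
  have hpr : Tendsto (fun q : (ℝ × ℝ) × ℝ => (q.1.1, q.2)) (𝓝 ((s, z), y)) (𝓝 (s, y)) :=
    Continuous.tendsto (by fun_prop) ((s, z), y)
  have hpr2 : Tendsto (fun q : (ℝ × ℝ) × ℝ => q.2) (𝓝 ((s, z), y)) (𝓝 y) :=
    Continuous.tendsto (by fun_prop) ((s, z), y)
  have hpr1 : Tendsto (fun q : (ℝ × ℝ) × ℝ => q.1.1) (𝓝 ((s, z), y)) (𝓝 s) :=
    Continuous.tendsto (by fun_prop) ((s, z), y)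
  filter_upwards [hpr.eventually h1, hz.eventually_nhds, hpr2.eventually hy,
    hpr1.eventually hψ.eventually_analyticAt]
  rintro ⟨⟨s', z'⟩, y'⟩ hq1 hq2 hq3 hq4 hq0 hqne
  have hz' : z' = ψ s' := hq2.self_of_nhds hq0
  have hs' : s' ≠ s := by
    rintro rfl
    rw [hψs] at hz'
    subst hz'
    have hy' : y' = y := hq3 hq0
    exact hqne (by rw [hy'])
  obtain ⟨φ, hφ, hφs, hφe⟩ := hq1 (by simpa [G, ← hz'] using hq0) hs'
  refine isCurvePoint_of_graphs hq4 hφ hz'.symm hφs ?_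
  have hpr' : Tendsto (fun q : (ℝ × ℝ) × ℝ => (q.1.1, q.2)) (𝓝 ((s', z'), y')) (𝓝 (s', y')) :=
    Continuous.tendsto (by fun_prop) ((s', z'), y')
  filter_upwards [hq2, hpr'.eventually hφe]
  rintro ⟨⟨s'', z''⟩, y''⟩ h5 h6
  simp only [G] at h6
  constructor
  · intro h7
    have h8 := h5 h7
    simp only at h8
    exact ⟨h8, h6.1 (by rwa [← h8])⟩
  · rintro ⟨h8, h9⟩
    simp only at h8 h9
    rw [h8]
    exact h6.2 h9

theorem eventually_nhds_eq_of_finite {X : Type*} [TopologicalSpace X] [T1Space X] {S : Set X}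
    (hS : S.Finite) (x : X) : ∀ᶠ y in 𝓝 x, y ∈ S → y = x := by
  have h : (S \ {x})ᶜ ∈ 𝓝 x := (hS.subset sdiff_subset).isClosed.isOpen_compl.mem_nhds (by simp)
  filter_upwards [h] with y hy hyS
  by_contra hne
  exact hy ⟨hyS, hne⟩

/-- The local structure of a real analytic subset of a three-dimensional space that contains no
surface: near each of its points, all but countably many of its points are curve points. -/
theorem exists_nhds_countable_not_isCurvePoint [FiniteDimensional ℝ V]
    (hd : Module.finrank ℝ V = 3) {f : V → ℝ} (hf : ∀ q, AnalyticAt ℝ f q)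
    (hns : ¬ ContainsAnalyticSurface {q | f q = 0}) {p : V} (hp : f p = 0) :
    ∃ N ∈ 𝓝 p, (N ∩ {q | f q = 0 ∧ ¬ IsCurvePoint {q | f q = 0} q}).Countable := by
  -- no neighbourhood of `p` consists of zeros, as it would contain a surface
  have hne : ¬ ∀ᶠ q in 𝓝 p, f q = 0 := by
    intro h
    obtain ⟨v, hv⟩ : ∃ v : V, v ≠ 0 := by
      have : Nontrivial V := Module.nontrivial_of_finrank_pos (R := ℝ) (by omega)
      exact exists_ne 0
    obtain ⟨e, -⟩ := exists_equiv_prod_real (E := ℝ × ℝ) (by simp [hd]) hv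
    have han : AnalyticAt ℝ (fun x : ℝ × ℝ => e (x, (e.symm p).2)) (e.symm p).1 :=
      (e.analyticAt _).fun_comp (analyticAt_id.prod analyticAt_const)
    refine hns ⟨(ContinuousLinearMap.fst ℝ (ℝ × ℝ) ℝ).comp (e.symm : V →L[ℝ] (ℝ × ℝ) × ℝ),
      fun x => e (x, (e.symm p).2), (e.symm p).1, han, ?_⟩
    have h1 : Tendsto (fun x : ℝ × ℝ => e (x, (e.symm p).2)) (𝓝 (e.symm p).1) (𝓝 p) := by
      simpa using han.continuousAt.tendsto
    filter_upwards [h1.eventually h] with x hx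
    exact ⟨by simp, hx⟩
  obtain ⟨e₁, he₁⟩ := exists_equiv_not_eventually_zero (E := ℝ × ℝ) (by simp [hd]) (hf p) hp hne
  have hf₁ : ∀ q, AnalyticAt ℝ (fun q => f (e₁ q)) q := fun q => (hf _).fun_comp (e₁.analyticAt q)
  obtain ⟨h, U, hU, hha, hh0, hgr, hfin⟩ := exists_discriminant (x₀ := (e₁.symm p).1)
    (y₀ := (e₁.symm p).2) (hf₁ _) he₁
  -- the zeros lie over the zeros of the discriminant, since the graphs off it are surfaces
  have hzero : ∀ x y, (x, y) ∈ U → f (e₁ (x, y)) = 0 → h x = 0 := by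
    intro x y hxy hfxy
    by_contra hx
    obtain ⟨φ, hφ, hφx, hφe⟩ := hgr x y hxy hfxy hx
    refine hns (ContainsAnalyticSurface.of_equiv e₁ ⟨ContinuousLinearMap.fst ℝ (ℝ × ℝ) ℝ,
      fun x => (x, φ x), x, analyticAt_id.prod hφ, ?_⟩)
    have h1 : Tendsto (fun x' : ℝ × ℝ => (x', φ x')) (𝓝 x) (𝓝 (x, y)) := by
      rw [← hφx]
      exact (analyticAt_id.prod hφ).continuousAt.tendsto
    filter_upwards [h1.eventually hφe] with x' hx'
    exact ⟨rfl, hx'.2 rfl⟩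
  have hhx : h (e₁.symm p).1 = 0 := hzero _ (e₁.symm p).2 (mem_of_mem_nhds hU) (by simpa using hp)
  obtain ⟨e₂, he₂⟩ := exists_equiv_not_eventually_zero (E := ℝ) (by simp) hha hhx hh0
  have hh₂ : AnalyticAt ℝ (fun q => h (e₂ q)) (e₂.symm (e₁.symm p).1) :=
    hha.fun_comp_of_eq (e₂.analyticAt _) (by simp)
  obtain ⟨k, U₂, hU₂, hka, hk0, hgr₂, hfin₂⟩ := exists_discriminant
    (x₀ := (e₂.symm (e₁.symm p).1).1) (y₀ := (e₂.symm (e₁.symm p).1).2) hh₂ he₂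
  have hk1 := (hka.eventually_eq_zero_or_eventually_ne_zero).resolve_left hk0
  rw [eventually_nhdsWithin_iff] at hk1
  -- all coordinates together
  let e : ((ℝ × ℝ) × ℝ) ≃L[ℝ] V := (e₂.prodCongr (ContinuousLinearEquiv.refl ℝ ℝ)).trans e₁
  have hec : ∀ s z y, e ((s, z), y) = e₁ (e₂ (s, z), y) := fun _ _ _ => rfl
  set s₀ := (e₂.symm (e₁.symm p).1).1 with hs₀
  let F : (ℝ × ℝ) × ℝ → ℝ := fun q => f (e q)
  have hF : ∀ q, AnalyticAt ℝ F q := fun q => (hf _).fun_comp (e.analyticAt q)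
  have hep : e.symm p = ((s₀, (e₂.symm (e₁.symm p).1).2), (e₁.symm p).2) := by
    rw [e.symm_apply_eq, hec]
    simp [hs₀]
  let U₁ : Set ((ℝ × ℝ) × ℝ) := {q | (e₂ q.1, q.2) ∈ U}
  have hU₁ : U₁ ∈ 𝓝 (e.symm p) := by
    have h1 : Tendsto (fun q : (ℝ × ℝ) × ℝ => (e₂ q.1, q.2)) (𝓝 (e.symm p)) (𝓝 (e₁.symm p)) := by
      have h2 : Continuous fun q : (ℝ × ℝ) × ℝ => (e₂ q.1, q.2) := by fun_prop
      have h3 := h2.tendsto (e.symm p)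
      rw [hep] at h3 ⊢
      simpa [hs₀] using h3
    exact h1 hU
  let O : Set ((ℝ × ℝ) × ℝ) := {q | U₁ ∈ 𝓝 q ∧ U₂ ∈ 𝓝 q.1 ∧ (q.1.1 ≠ s₀ → k q.1.1 ≠ 0)}
  have hO : O ∈ 𝓝 (e.symm p) := by
    have h1 : Tendsto (fun q : (ℝ × ℝ) × ℝ => q.1) (𝓝 (e.symm p))
        (𝓝 (s₀, (e₂.symm (e₁.symm p).1).2)) := by
      rw [hep]; exact Continuous.tendsto continuous_fst _
    have h2 : Tendsto (fun q : (ℝ × ℝ) × ℝ => q.1.1) (𝓝 (e.symm p)) (𝓝 s₀) := by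
      rw [hep]; exact (Continuous.tendsto (continuous_fst.comp continuous_fst) _)
    filter_upwards [eventually_mem_nhds_iff.2 hU₁, h1.eventually (eventually_mem_nhds_iff.2 hU₂),
      h2.eventually hk1] with q hq1 hq2 hq3
    exact ⟨hq1, hq2, hq3⟩
  let Z : Set ((ℝ × ℝ) × ℝ) := {q | F q = 0}
  have hZh : ∀ s z y, ((s, z), y) ∈ U₁ → F ((s, z), y) = 0 → h (e₂ (s, z)) = 0 :=
    fun s z y hU hF0 => hzero _ _ hU hF0
  have hfinF : ∀ x : ℝ × ℝ, {y | (x, y) ∈ U₁ ∧ F (x, y) = 0}.Finite := fun x => hfin (e₂ x)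
  -- the exceptional points over `s₀` are finite in number
  have hc0 : (O ∩ Z ∩ {q | q.1.1 = s₀}).Countable := by
    refine ((hfin₂ s₀).biUnion fun z _ => ((hfinF (s₀, z)).image
      fun y => ((s₀, z), y))).countable.mono ?_
    rintro ⟨⟨s, z⟩, y⟩ ⟨⟨⟨h1, h2, -⟩, h3⟩, h4⟩
    obtain rfl : s = s₀ := h4
    refine mem_biUnion (x := z) ⟨mem_of_mem_nhds h2, hZh _ _ _ (mem_of_mem_nhds h1) h3⟩ ?_
    exact ⟨y, ⟨mem_of_mem_nhds h1, h3⟩, rfl⟩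
  -- the other ones are isolated
  have hiso : ∀ q ∈ O ∩ Z ∩ {q | q.1.1 ≠ s₀}, ∀ᶠ q' in 𝓝 q, q' ∈ Z → q' ≠ q → IsCurvePoint Z q' := by
    rintro ⟨⟨s, z⟩, y⟩ ⟨⟨⟨h1, h2, h3⟩, h4⟩, h5⟩
    obtain ⟨ψ, hψ, hψs, hψe⟩ := hgr₂ s z (mem_of_mem_nhds h2)
      (hZh _ _ _ (mem_of_mem_nhds h1) h4) (h3 h5)
    refine eventually_isCurvePoint (hF _) hψ hψs ?_ ?_
    · have h6 : Tendsto (fun q : (ℝ × ℝ) × ℝ => q.1) (𝓝 ((s, z), y)) (𝓝 (s, z)) :=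
        Continuous.tendsto continuous_fst _
      filter_upwards [h1, h6.eventually hψe]
      rintro ⟨⟨s', z'⟩, y'⟩ h7 h8 h9
      exact h8.1 (hZh _ _ _ h7 h9)
    · have h6 : Tendsto (fun t : ℝ => ((s, z), t)) (𝓝 y) (𝓝 ((s, z), y)) :=
        Continuous.tendsto (by fun_prop) _
      filter_upwards [eventually_nhds_eq_of_finite (hfinF (s, z)) y, h6 h1] with t ht h7 h8
      exact ht ⟨h7, h8⟩
  have hc1 : (O ∩ Z ∩ {q | q.1.1 ≠ s₀} ∩ {q | ¬ IsCurvePoint Z q}).Countable := by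
    set D := O ∩ Z ∩ {q | q.1.1 ≠ s₀} ∩ {q | ¬ IsCurvePoint Z q} with hD
    have : DiscreteTopology D := by
      rw [discreteTopology_subtype_iff]
      intro q hq
      rw [inf_principal_eq_bot, mem_nhdsWithin_iff_eventually]
      filter_upwards [hiso q hq.1] with q' h1 h2 h3
      exact h3.2 (h1 h3.1.1.2 h2)
    exact (TopologicalSpace.separableSpace_iff_countable.1 inferInstance : Countable D).to_set
  have hcount : (O ∩ {q | F q = 0 ∧ ¬ IsCurvePoint Z q}).Countable := by
    refine (hc0.union hc1).mono ?_
    rintro q ⟨h1, h2, h3⟩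
    by_cases h4 : q.1.1 = s₀
    · exact Or.inl ⟨⟨h1, h2⟩, h4⟩
    · exact Or.inr ⟨⟨⟨h1, h2⟩, h4⟩, h3⟩
  refine ⟨e '' O, ?_, (hcount.image e).mono ?_⟩
  · have := e.toHomeomorph.isOpenMap.image_mem_nhds hO
    simpa using this
  · rintro _ ⟨⟨q, hq, rfl⟩, h1, h2⟩
    exact ⟨q, ⟨hq, h1, fun h3 => h2 (IsCurvePoint.of_equiv e h3)⟩, rfl⟩

/-- An analytic subset of a three-dimensional space that contains no surface is an analytic arc near
all but countably many of its points. -/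
theorem countable_not_isCurvePoint [FiniteDimensional ℝ V]
    (hd : Module.finrank ℝ V = 3) {f : V → ℝ} (hf : ∀ q, AnalyticAt ℝ f q)
    (hns : ¬ ContainsAnalyticSurface {q | f q = 0}) :
    {q | f q = 0 ∧ ¬ IsCurvePoint {q | f q = 0} q}.Countable := by
  have : SecondCountableTopology V := by
    have := FiniteDimensional.proper ℝ V
    infer_instance
  have hN : ∀ p : V, ∃ N ∈ 𝓝 p, f p = 0 →
      (N ∩ {q | f q = 0 ∧ ¬ IsCurvePoint {q | f q = 0} q}).Countable := by
    intro p
    by_cases hp : f p = 0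
    · obtain ⟨N, hN, hc⟩ := exists_nhds_countable_not_isCurvePoint hd hf hns hp
      exact ⟨N, hN, fun _ => hc⟩
    · exact ⟨univ, univ_mem, fun h => absurd h hp⟩
  choose N hN hNc using hN
  obtain ⟨t, ht, htc, hcov⟩ := TopologicalSpace.countable_cover_nhdsWithin
    (s := {q | f q = 0 ∧ ¬ IsCurvePoint {q | f q = 0} q}) (f := N)
    fun x _ => mem_nhdsWithin_of_mem_nhds (hN x)
  refine (htc.biUnion fun x hx => hNc x (ht hx).1).mono fun q hq => ?_
  obtain ⟨x, hx, hqx⟩ := mem_iUnion₂.1 (hcov hq)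
  exact mem_iUnion₂.2 ⟨x, hx, hqx, hq⟩

end structureTheory

/-! ### Cones over thin sets, and arcs in continua -/

section cones

variable {V : Type*} [NormedAddCommGroup V] [NormedSpace ℝ V]

/-- The union of the lines through `u` and the points of `A`. -/
def lineCone (u : V) (A : Set V) : Set V := {x | ∃ a ∈ A, ∃ s : ℝ, x = u + s • (a - u)}

theorem lineCone_mono {u : V} {A B : Set V} (h : A ⊆ B) : lineCone u A ⊆ lineCone u B :=
  fun _ ⟨a, ha, s, hs⟩ => ⟨a, h ha, s, hs⟩

/-- The cone over a `C¹` curve is contained in a `C¹` image of a strip in the plane. -/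
theorem dimH_lineCone_image_le (u : V) {γ : ℝ → V} {I : Set ℝ} (hI : Convex ℝ I)
    (hγ : ContDiffOn ℝ 1 γ I) : dimH (lineCone u (γ '' I)) ≤ 2 := by
  have h1 : lineCone u (γ '' I) ⊆ (fun x : ℝ × ℝ => u + x.2 • (γ x.1 - u)) '' (I ×ˢ univ) := by
    rintro x ⟨_, ⟨t, ht, rfl⟩, s, rfl⟩
    exact ⟨(t, s), ⟨ht, mem_univ _⟩, rfl⟩
  have h2 : ContDiffOn ℝ 1 (fun x : ℝ × ℝ => u + x.2 • (γ x.1 - u)) (I ×ˢ univ) := by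
    refine contDiffOn_const.add (contDiff_snd.contDiffOn.smul (ContDiffOn.sub ?_ contDiffOn_const))
    exact hγ.comp contDiff_fst.contDiffOn fun x hx => hx.1
  calc dimH (lineCone u (γ '' I)) ≤ dimH (I ×ˢ (univ : Set ℝ)) :=
        (dimH_mono h1).trans (h2.dimH_image_le (hI.prod convex_univ) Subset.rfl)
    _ ≤ dimH (univ : Set (ℝ × ℝ)) := dimH_mono (subset_univ _)
    _ = 2 := by rw [Real.dimH_univ_eq_finrank]; simp

theorem dimH_lineCone_singleton_le (u a : V) : dimH (lineCone u {a}) ≤ 2 := by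
  have := dimH_lineCone_image_le u (γ := fun _ => a) convex_univ contDiffOn_const
  rwa [image_univ, range_const] at this

theorem dimH_lineCone_le_of_curves {A : Set V} [SecondCountableTopology V] [CompleteSpace V] (u : V)
    (hc : {q | q ∈ A ∧ ¬ IsCurvePoint A q}.Countable) : dimH (lineCone u A) ≤ 2 := by
  have hN : ∀ q : V, ∃ N ∈ 𝓝 q, IsCurvePoint A q → dimH (lineCone u (N ∩ A)) ≤ 2 := by
    intro q
    by_cases hq : IsCurvePoint A q
    · obtain ⟨ℓ, γ, h1, h2, h3, h4⟩ := id hq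
      obtain ⟨r, hr, hball⟩ := Metric.eventually_nhds_iff_ball.1 h1.eventually_analyticAt
      have h5 : ∀ᶠ q' in 𝓝 q, ℓ q' ∈ Metric.ball (ℓ q) r :=
        ℓ.continuous.tendsto q (Metric.ball_mem_nhds _ hr)
      refine ⟨_, h4.and h5, fun _ => (dimH_mono (lineCone_mono ?_)).trans
        (dimH_lineCone_image_le u (convex_ball (ℓ q) r) (γ := γ) fun t ht =>
          (hball t ht).contDiffAt.contDiffWithinAt)⟩
      rintro q' ⟨⟨h6, h7⟩, h8⟩
      exact ⟨ℓ q', h7, h6.1 h8⟩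
    · exact ⟨univ, univ_mem, fun h => absurd h hq⟩
  choose N hN hNd using hN
  obtain ⟨t, ht, htc, hcov⟩ := TopologicalSpace.countable_cover_nhdsWithin
    (s := {q | q ∈ A ∧ IsCurvePoint A q}) (f := N)
    fun x _ => mem_nhdsWithin_of_mem_nhds (hN x)
  have h1 : lineCone u A ⊆ (⋃ x ∈ t, lineCone u (N x ∩ A)) ∪
      ⋃ a ∈ {q | q ∈ A ∧ ¬ IsCurvePoint A q}, lineCone u {a} := by
    rintro x ⟨a, ha, s, rfl⟩
    by_cases hq : IsCurvePoint A a
    · obtain ⟨y, hy, hay⟩ := mem_iUnion₂.1 (hcov ⟨ha, hq⟩)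
      exact Or.inl (mem_iUnion₂.2 ⟨y, hy, a, ⟨hay, ha⟩, s, rfl⟩)
    · exact Or.inr (mem_iUnion₂.2 ⟨a, ⟨ha, hq⟩, a, rfl, s, rfl⟩)
  refine (dimH_mono h1).trans ?_
  rw [dimH_union, dimH_bUnion htc, dimH_bUnion hc]
  exact max_le (iSup₂_le fun x hx => hNd x (ht hx).2)
    (iSup₂_le fun a _ => dimH_lineCone_singleton_le u a)

/-- A set whose cones have small dimension does not separate convex open sets: two points can be
joined by a broken line with one suitable corner. -/
theorem isConnected_diff_of_dimH_lineCone_lt [FiniteDimensional ℝ V] {A O : Set V}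
    (hA : ∀ u, dimH (lineCone u A) < Module.finrank ℝ V) (hO : IsOpen O) (hconv : Convex ℝ O)
    (hne : O.Nonempty) : IsConnected (O \ A) := by
  have hseg : ∀ u c, u ∈ O \ A → c ∈ O → c ∉ lineCone u A → segment ℝ u c ⊆ O \ A := by
    intro u c hu hc hcu x hx
    refine ⟨hconv.segment_subset hu.1 hc hx, fun hxA => ?_⟩
    rw [segment_eq_image'] at hx
    obtain ⟨s, -, rfl⟩ := hx
    have hs : s ≠ 0 := by
      rintro rfl
      exact hu.2 (by simpa using hxA)
    exact hcu ⟨_, hxA, s⁻¹, by simp [smul_smul, hs]⟩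
  constructor
  · obtain ⟨u, hu⟩ := hne
    obtain ⟨c, hcO, hc⟩ := (dense_compl_of_dimH_lt_finrank (hA u)).inter_open_nonempty O hO ⟨u, hu⟩
    exact ⟨c, hcO, fun h => hc ⟨c, h, 1, by simp⟩⟩
  · refine isPreconnected_of_forall_pair fun u hu v hv => ?_
    have hd : dimH (lineCone u A ∪ lineCone v A) < Module.finrank ℝ V := by
      rw [dimH_union]; exact max_lt (hA u) (hA v)
    obtain ⟨c, hcO, hc⟩ := (dense_compl_of_dimH_lt_finrank hd).inter_open_nonempty O hO hne
    have hc' := not_or.1 hc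
    refine ⟨segment ℝ u c ∪ segment ℝ v c, union_subset (hseg u c hu hcO hc'.1)
      (hseg v c hv hcO hc'.2), Or.inl (left_mem_segment ℝ u c), Or.inr (left_mem_segment ℝ v c), ?_⟩
    exact (convex_segment u c).isPreconnected.union c (right_mem_segment ℝ u c)
      (right_mem_segment ℝ v c) (convex_segment v c).isPreconnected

/-- The zero set of an analytic function does not separate convex open sets, unless it contains a
surface. -/
theorem isConnected_diff_zeros [FiniteDimensional ℝ V]
    (hd : Module.finrank ℝ V = 3) {f : V → ℝ} (hf : ∀ q, AnalyticAt ℝ f q)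
    (hns : ¬ ContainsAnalyticSurface {q | f q = 0}) {O : Set V} (hO : IsOpen O)
    (hconv : Convex ℝ O) (hne : O.Nonempty) : IsConnected (O \ {q | f q = 0}) := by
  have : SecondCountableTopology V := by
    have := FiniteDimensional.proper ℝ V
    infer_instance
  refine isConnected_diff_of_dimH_lineCone_lt (fun u => ?_) hO hconv hne
  have := FiniteDimensional.complete ℝ V
  refine (dimH_lineCone_le_of_curves u (countable_not_isCurvePoint hd hf hns)).trans_lt ?_
  rw [hd]
  norm_num

end cones

section arcs

variable {V : Type*} [NormedAddCommGroup V] [NormedSpace ℝ V]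

/-- A connected subset of an analytic set with at most countably many points that are not curve
points contains a whole arc of curve points. -/
theorem exists_arc_subset [CompleteSpace V] {A C : Set V} (hc : {q | q ∈ A ∧ ¬ IsCurvePoint A q}.Countable)
    (hCA : C ⊆ A) (hC : IsPreconnected C) (hnt : C.Nontrivial) :
    ∃ (ℓ : V →L[ℝ] ℝ) (γ : ℝ → V) (a b : ℝ), a < b ∧ ∀ t ∈ Ioo a b, AnalyticAt ℝ γ t ∧
      ℓ (γ t) = t ∧ γ t ∈ C ∧ ∀ᶠ q in 𝓝 (γ t), q ∈ A → γ (ℓ q) = q := by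
  obtain ⟨c, hcC, hcp⟩ : ∃ c ∈ C, IsCurvePoint A c := by
    by_contra! h
    have h1 : C ⊆ {q | q ∈ A ∧ ¬ IsCurvePoint A q} := fun q hq => ⟨hCA hq, h q hq⟩
    exact hnt.not_subsingleton ((hc.mono h1).isTotallyDisconnected C Subset.rfl hC)
  obtain ⟨ℓ, γ, h1, h2, h3, h4⟩ := hcp
  obtain ⟨W, hW, hWo, hcW⟩ := eventually_nhds_iff.1 h4
  have h5 : ∀ᶠ t in 𝓝 (ℓ c), γ t ∈ W := h1.continuousAt (by rw [h2]; exact hWo.mem_nhds hcW)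
  obtain ⟨r, hr, hball⟩ := Metric.eventually_nhds_iff_ball.1
    (h1.eventually_analyticAt.and (h3.and h5))
  rw [Real.ball_eq_Ioo] at hball
  -- it suffices to find an interval that is mapped into `C`
  suffices h : ∃ a b, a < b ∧ Ioo a b ⊆ Ioo (ℓ c - r) (ℓ c + r) ∧ ∀ t ∈ Ioo a b, γ t ∈ C by
    obtain ⟨a, b, hab, hsub, hin⟩ := h
    refine ⟨ℓ, γ, a, b, hab, fun t ht => ?_⟩
    obtain ⟨h6, h7, h8⟩ := hball t (hsub ht)
    refine ⟨h6, h7, hin t ht, ?_⟩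
    filter_upwards [hWo.mem_nhds h8] with q hq using (hW q hq).1
  by_contra! hno
  obtain ⟨a, ha, haC⟩ := hno (ℓ c - r) (ℓ c) (by linarith) fun t ht => ⟨ht.1, by linarith [ht.2]⟩
  obtain ⟨b, hb, hbC⟩ := hno (ℓ c) (ℓ c + r) (by linarith) fun t ht => ⟨by linarith [ht.1], ht.2⟩
  have hsub : Icc a b ⊆ Ioo (ℓ c - r) (ℓ c + r) := fun t ht =>
    ⟨ha.1.trans_le ht.1, ht.2.trans_lt hb.2⟩
  have hcomp : IsClosed (γ '' Icc a b) := (isCompact_Icc.image_of_continuousOn fun t ht =>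
    (hball t (hsub ht)).1.continuousAt.continuousWithinAt).isClosed
  -- the part of `C` on the arc over `[a, b]` is relatively clopen
  have hCsub : C ⊆ γ '' Icc a b := by
    have h6 : ∀ q ∈ C, q ∈ W → ℓ q ∈ Ioo a b → q ∈ γ '' Icc a b := fun q hq hqW hql =>
      ⟨ℓ q, Ioo_subset_Icc_self hql, (hW q hqW).1 (hCA hq)⟩
    have h7 : ∀ q ∈ C, q ∈ γ '' Icc a b → q ∈ W ∧ ℓ q ∈ Ioo a b := by
      rintro _ hq ⟨t, ht, rfl⟩
      refine ⟨(hball t (hsub ht)).2.2, ?_⟩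
      rw [(hball t (hsub ht)).2.1]
      refine ⟨lt_of_le_of_ne ht.1 ?_, lt_of_le_of_ne ht.2 ?_⟩
      · rintro rfl; exact haC hq
      · rintro rfl; exact hbC hq
    by_contra hnot
    obtain ⟨q, hqC, hq⟩ := not_subset.1 hnot
    obtain ⟨x, hx, hx1, hx2⟩ := hC (W ∩ ℓ ⁻¹' Ioo a b) (γ '' Icc a b)ᶜ
      (hWo.inter (isOpen_Ioo.preimage ℓ.continuous)) hcomp.isOpen_compl
      (fun q hq => by
        by_cases h : q ∈ γ '' Icc a b
        · exact Or.inl (h7 q hq h)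
        · exact Or.inr h)
      ⟨c, hcC, hcW, ha.2, hb.1⟩ ⟨q, hqC, hq⟩
    exact hx2 (h6 x hx hx1.1 hx1.2)
  have hCℓ : ∀ q ∈ C, ℓ q ∈ Icc a b ∧ γ (ℓ q) = q := by
    intro q hq
    obtain ⟨t, ht, rfl⟩ := hCsub hq
    rw [(hball t (hsub ht)).2.1]
    exact ⟨ht, rfl⟩
  obtain ⟨x, hx, y, hy, hxy⟩ := hnt
  wlog hlt : ℓ x < ℓ y generalizing x y
  · refine this y hy x hx hxy.symm (lt_of_le_of_ne (not_lt.1 hlt) fun h => hxy ?_)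
    rw [← (hCℓ x hx).2, ← (hCℓ y hy).2, h]
  obtain ⟨t, ht, htC⟩ := hno (ℓ x) (ℓ y) hlt fun t ht =>
    hsub ⟨(hCℓ x hx).1.1.trans ht.1.le, ht.2.le.trans (hCℓ y hy).1.2⟩
  obtain ⟨q, hq, rfl⟩ := (hC.image ℓ ℓ.continuous.continuousOn).ordConnected.out
    (mem_image_of_mem ℓ hx) (mem_image_of_mem ℓ hy) (Ioo_subset_Icc_self ht)
  exact htC (by rw [(hCℓ q hq).2]; exact hq)

end arcs

/-! ### Cochains on a cubical lattice -/

section lattice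

variable {R : Type*} [CommRing R]

/-- A closed 1-cochain on the lattice `ℕ³` is a gradient. -/
theorem exists_primitive_of_closed_one {a₁ a₂ a₃ : ℕ → ℕ → ℕ → R}
    (h12 : ∀ x y z, a₁ x y z + a₂ (x + 1) y z = a₂ x y z + a₁ x (y + 1) z)
    (h13 : ∀ x y z, a₁ x y z + a₃ (x + 1) y z = a₃ x y z + a₁ x y (z + 1))
    (h23 : ∀ x y z, a₂ x y z + a₃ x (y + 1) z = a₃ x y z + a₂ x y (z + 1)) :
    ∃ k : ℕ → ℕ → ℕ → R, ∀ x y z, k (x + 1) y z = k x y z + a₁ x y z ∧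
      k x (y + 1) z = k x y z + a₂ x y z ∧ k x y (z + 1) = k x y z + a₃ x y z := by
  let k : ℕ → ℕ → ℕ → R := fun x y z => ∑ t ∈ Finset.range x, a₁ t 0 0 +
    ∑ t ∈ Finset.range y, a₂ x t 0 + ∑ t ∈ Finset.range z, a₃ x y t
  have k3 : ∀ x y z, k x y (z + 1) = k x y z + a₃ x y z := by
    intro x y z
    simp only [k, Finset.sum_range_succ, add_assoc]
  have k2 : ∀ x y z, k x (y + 1) z = k x y z + a₂ x y z := by
    intro x y z
    induction z with
    | zero => simp only [k, Finset.sum_range_succ, Finset.sum_range_zero]; ring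
    | succ z ih => linear_combination k3 x (y + 1) z - k3 x y z + ih + h23 x y z
  have k1 : ∀ x y z, k (x + 1) y z = k x y z + a₁ x y z := by
    intro x y z
    induction z with
    | zero =>
      induction y with
      | zero => simp only [k, Finset.sum_range_succ, Finset.sum_range_zero]; ring
      | succ y ih => linear_combination k2 (x + 1) y 0 - k2 x y 0 + ih + h12 x y 0
    | succ z ih => linear_combination k3 (x + 1) y z - k3 x y z + ih + h13 x y z
  exact ⟨k, fun x y z => ⟨k1 x y z, k2 x y z, k3 x y z⟩⟩

/-- A closed 2-cochain on the lattice `ℕ³` with support in a box is the coboundary of a 1-cochain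
with support in (almost) the same box. -/
theorem exists_primitive_of_closed_two {c₁₂ c₁₃ c₂₃ : ℕ → ℕ → ℕ → R} {l₁ h₁ l₂ h₂ l₃ h₃ : ℕ}
    (hl₁ : 0 < l₁) (hl₂ : 0 < l₂) (hl₃ : 0 < l₃)
    (hc : ∀ x y z, c₂₃ (x + 1) y z + c₁₃ x y z + c₁₂ x y (z + 1) =
      c₂₃ x y z + c₁₃ x (y + 1) z + c₁₂ x y z)
    (hs : ∀ x y z, (x < l₁ ∨ h₁ < x ∨ y < l₂ ∨ h₂ < y ∨ z < l₃ ∨ h₃ < z) →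
      c₁₂ x y z = 0 ∧ c₁₃ x y z = 0 ∧ c₂₃ x y z = 0) :
    ∃ b₁ b₂ b₃ : ℕ → ℕ → ℕ → R,
      (∀ x y z, b₁ x y z + b₂ (x + 1) y z = b₂ x y z + b₁ x (y + 1) z + c₁₂ x y z) ∧
      (∀ x y z, b₁ x y z + b₃ (x + 1) y z = b₃ x y z + b₁ x y (z + 1) + c₁₃ x y z) ∧
      (∀ x y z, b₂ x y z + b₃ x (y + 1) z = b₃ x y z + b₂ x y (z + 1) + c₂₃ x y z) ∧
      ∀ x y z, (x < l₁ ∨ h₁ + 1 < x ∨ y < l₂ ∨ h₂ + 1 < y ∨ z < l₃ ∨ h₃ + 1 < z) →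
        b₁ x y z = 0 ∧ b₂ x y z = 0 ∧ b₃ x y z = 0 := by
  -- integrate in the third direction
  let p : ℕ → ℕ → ℕ → R := fun x y z => -∑ t ∈ Finset.range z, c₁₃ x y t
  let q : ℕ → ℕ → ℕ → R := fun x y z => -∑ t ∈ Finset.range z, c₂₃ x y t
  have p3 : ∀ x y z, p x y (z + 1) = p x y z - c₁₃ x y z := fun x y z => by
    simp only [p, Finset.sum_range_succ]; ring
  have q3 : ∀ x y z, q x y (z + 1) = q x y z - c₂₃ x y z := fun x y z => by
    simp only [q, Finset.sum_range_succ]; ring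
  have pq : ∀ x y z, p x y z + q (x + 1) y z = q x y z + p x (y + 1) z + c₁₂ x y z := by
    intro x y z
    induction z with
    | zero => simp [p, q, (hs x y 0 (by omega)).1]
    | succ z ih =>
      linear_combination ih + p3 x y z + q3 (x + 1) y z - q3 x y z - p3 x (y + 1) z - hc x y z
  have p0 : ∀ x y z, (x < l₁ ∨ h₁ < x ∨ y < l₂ ∨ h₂ < y ∨ z ≤ l₃) → p x y z = 0 ∧ q x y z = 0 := by
    intro x y z h
    constructor <;>
    · refine neg_eq_zero.2 (Finset.sum_eq_zero fun t ht => ?_)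
      have ht := Finset.mem_range.1 ht
      have := hs x y t (by omega)
      simp [this]
  -- the result has support in a column; above the box it is constant in the third direction
  let B : ℕ → ℕ → R := fun x y => p x y (h₃ + 1)
  let D : ℕ → ℕ → R := fun x y => q x y (h₃ + 1)
  have top : ∀ x y z, h₃ < z → p x y z = B x y ∧ q x y z = D x y := by
    intro x y z hz
    obtain ⟨n, rfl⟩ := Nat.exists_eq_add_of_lt hz
    induction n with
    | zero => exact ⟨rfl, rfl⟩
    | succ n ih =>
      have h1 := ih (by omega)
      have h2 := hs x y (h₃ + n + 1) (by omega)
      exact ⟨by linear_combination p3 x y (h₃ + n + 1) + h1.1 - h2.2.1,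
        by linear_combination q3 x y (h₃ + n + 1) + h1.2 - h2.2.2⟩
  have BD : ∀ x y, B x y + D (x + 1) y = D x y + B x (y + 1) := by
    intro x y
    linear_combination pq x y (h₃ + 1) + (hs x y (h₃ + 1) (by omega)).1
  -- its value there is a gradient with compact support, which can be cut off
  let K : ℕ → ℕ → R := fun x y => ∑ s ∈ Finset.range x, B s y
  have K1 : ∀ x y, K (x + 1) y = K x y + B x y := fun x y => by simp [K, Finset.sum_range_succ]
  have K2 : ∀ x y, K x (y + 1) = K x y + D x y := by
    intro x y
    induction x with
    | zero => simp [K, D, (p0 0 y (h₃ + 1) (by omega)).2]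
    | succ x ih => linear_combination K1 x (y + 1) - K1 x y + ih - BD x y
  have K0 : ∀ x y, (x < l₁ ∨ y < l₂ ∨ h₂ < y ∨ h₃ < l₃) → K x y = 0 := by
    intro x y h
    refine Finset.sum_eq_zero fun t ht => ?_
    have ht := Finset.mem_range.1 ht
    exact (p0 t y (h₃ + 1) (by omega)).1
  have K0' : ∀ x y, h₁ < x → K x y = 0 := by
    intro x y h
    induction y with
    | zero => exact K0 x 0 (by omega)
    | succ y ih => rw [K2, ih, zero_add]; exact (p0 x y (h₃ + 1) (by omega)).2
  let χ : ℕ → R := fun z => if h₃ < z then 1 else 0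
  refine ⟨fun x y z => p x y z - χ z * B x y, fun x y z => q x y z - χ z * D x y,
    fun x y z => -((χ (z + 1) - χ z) * K x y), fun x y z => ?_, fun x y z => ?_, fun x y z => ?_,
    fun x y z h => ?_⟩
  · linear_combination pq x y z - χ z * BD x y
  · linear_combination (-1 : R) * p3 x y z - (χ (z + 1) - χ z) * K1 x y
  · linear_combination (-1 : R) * q3 x y z - (χ (z + 1) - χ z) * K2 x y
  · by_cases hz : h₃ < z
    · have hz' : h₃ < z + 1 := by omega
      simp [χ, hz, hz', top x y z hz]
    · have hp := p0 x y z (by omega)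
      refine ⟨by simp [χ, hz, hp], by simp [χ, hz, hp], ?_⟩
      by_cases hz' : h₃ < z + 1
      · have hK : K x y = 0 := by
          by_cases hx : h₁ < x
          · exact K0' x y hx
          · exact K0 x y (by omega)
        simp [hK]
      · simp [χ, hz, hz']

end lattice

/-! ### Logarithms and winding numbers -/

section logarithms

/-- A totally disconnected compact set falls into finitely many small pieces, labelled by `π`, at
positive distance from each other. -/
theorem exists_labelling {X : Type*} [MetricSpace X] {Y : Set X} (hY : IsCompact Y)
    (htd : IsTotallyDisconnected Y) {d : ℝ} (hd : 0 < d) :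
    ∃ (n : ℕ) (π : X → ℕ) (δ : ℝ), 0 < δ ∧ (∀ x ∈ Y, π x < n) ∧
      (∀ x ∈ Y, ∀ y ∈ Y, dist x y < δ → π x = π y) ∧
      ∀ x ∈ Y, ∀ y ∈ Y, π x = π y → dist x y < d := by
  classical
  have : CompactSpace Y := isCompact_iff_compactSpace.1 hY
  have : TotallyDisconnectedSpace Y := totallyDisconnectedSpace_subtype_iff.2 htd
  obtain ⟨n, g, h, hg, hgh⟩ := (ContinuousMap.id Y).exists_finite_approximation_of_mem_nhds_diagonal
    (S := {p | dist p.1 p.2 < d / 2}) (mem_nhdsSet_iff_forall.2 (by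
      rintro ⟨x, y⟩ (rfl : x = y)
      exact (isOpen_lt (by fun_prop) (by fun_prop)).mem_nhds (by simpa using hd)))
  have hcont : UniformContinuous fun y : Y => ((g y : ℕ) : ℝ) := by
    refine CompactSpace.uniformContinuous_of_continuous ?_
    exact (continuous_of_discreteTopology (f := fun i : Fin n => ((i : ℕ) : ℝ))).comp hg
  obtain ⟨δ, hδ, hδ'⟩ := Metric.uniformContinuous_iff.1 hcont 1 one_pos
  refine ⟨n, fun x => if hx : x ∈ Y then g ⟨x, hx⟩ else 0, δ, hδ, fun x hx => ?_,
    fun x hx y hy hxy => ?_, fun x hx y hy hxy => ?_⟩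
  · simp [hx]
  · have h1 : dist ((g ⟨x, hx⟩ : ℕ) : ℝ) ((g ⟨y, hy⟩ : ℕ) : ℝ) < 1 := hδ' hxy
    rw [Nat.dist_cast_real, Nat.dist_eq] at h1
    simp only [hx, hy, dif_pos]
    have h2 := abs_lt.1 (by exact_mod_cast h1 : |((g ⟨x, hx⟩ : ℕ) : ℤ) - ((g ⟨y, hy⟩ : ℕ) : ℤ)| < 1)
    omega
  · simp only [hx, hy, dif_pos] at hxy
    have h1 := hgh ⟨x, hx⟩
    have h2 := hgh ⟨y, hy⟩
    rw [Fin.ext hxy] at h1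
    simp only [ContinuousMap.id_apply, mem_ofPred_eq] at h1 h2
    have h3 := dist_triangle_right (⟨x, hx⟩ : Y) ⟨y, hy⟩ (h (g ⟨y, hy⟩))
    change dist (⟨x, hx⟩ : Y) ⟨y, hy⟩ < d
    linarith

theorem eq_of_exp_eq_one {X : Type*} [TopologicalSpace X] {S : Set X} (hS : IsPreconnected S)
    {f : X → ℂ} (hf : ContinuousOn f S) (h1 : ∀ x ∈ S, Complex.exp (f x) = 1) {x y : X}
    (hx : x ∈ S) (hy : y ∈ S) : f x = f y :=
  hS.constant_of_mapsTo (T := Complex.exp ⁻¹' {1})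
    (isDiscrete_iff_discreteTopology.2 (Complex.isCoveringMapOn_exp 1 (by simp)).1) hf
    (fun x hx => h1 x hx) hx hy

/-- Two logarithms of a function on a connected set differ by a constant. -/
theorem sub_eq_sub_of_exp_eq {X : Type*} [TopologicalSpace X] {S : Set X} (hS : IsPreconnected S)
    {f g : X → ℂ} (hf : ContinuousOn f S) (hg : ContinuousOn g S)
    (h1 : ∀ x ∈ S, Complex.exp (f x) = Complex.exp (g x)) {x y : X}
    (hx : x ∈ S) (hy : y ∈ S) : f x - g x = f y - g y :=
  eq_of_exp_eq_one hS (f := fun x => f x - g x) (hf.sub hg) (fun x hx => by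
    rw [Complex.exp_sub, h1 x hx, div_self (Complex.exp_ne_zero _)]) hx hy

theorem exists_hasWinding {f θ : ℝ → ℂ} (hθ : ContinuousOn θ (Icc 0 1))
    (hf : ∀ t ∈ Icc (0 : ℝ) 1, Complex.exp (θ t) = f t) (h01 : f 0 = f 1) :
    ∃ n : ℤ, HasWinding f n ∧ θ 1 - θ 0 = 2 * Real.pi * Complex.I * n := by
  have h1 : Complex.exp (θ 1) = Complex.exp (θ 0) := by
    rw [hf 1 (by simp), hf 0 (by simp), h01]
  obtain ⟨n, hn⟩ := Complex.exp_eq_exp_iff_exists_int.1 h1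
  have h2 : θ 1 - θ 0 = 2 * Real.pi * Complex.I * n := by rw [hn]; ring
  exact ⟨n, ⟨θ, hθ, hf, h2⟩, h2⟩

/-- Closed curves that are close to each other have the same winding number. -/
theorem HasWinding.of_norm_sub_lt {f g : ℝ → ℂ} {n : ℤ} (h : HasWinding g n)
    (hf : ContinuousOn f (Icc 0 1)) (hg : ContinuousOn g (Icc 0 1)) (hf01 : f 0 = f 1)
    (hg01 : g 0 = g 1) (hfg : ∀ t ∈ Icc (0 : ℝ) 1, ‖f t - g t‖ < ‖g t‖) : HasWinding f n := by
  obtain ⟨θ, h1, h2, h3⟩ := h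
  have hg0 : ∀ t ∈ Icc (0 : ℝ) 1, g t ≠ 0 := fun t ht h => by
    rw [← h2 t ht] at h; exact Complex.exp_ne_zero _ h
  have hslit : ∀ t ∈ Icc (0 : ℝ) 1, f t / g t ∈ Complex.slitPlane := by
    intro t ht
    refine Complex.ball_one_subset_slitPlane ?_
    rw [mem_ball_iff_norm, div_sub_one (hg0 t ht), norm_div, div_lt_one (norm_pos_iff.2 (hg0 t ht))]
    exact hfg t ht
  refine ⟨fun t => θ t + Complex.log (f t / g t), h1.add ?_, fun t ht => ?_, ?_⟩
  · exact ContinuousOn.clog (hf.div hg hg0) hslit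
  · rw [Complex.exp_add, h2 t ht, Complex.exp_log (Complex.slitPlane_ne_zero (hslit t ht)),
      mul_div_cancel₀ _ (hg0 t ht)]
  · simp only [← hf01, ← hg01]
    linear_combination h3

/-- A function without zeros on a connected open set has a logarithm if all its winding numbers
along closed curves vanish. -/
theorem exists_log_of_forall_winding {V : Type*} [NormedAddCommGroup V] [NormedSpace ℝ V]
    {O : Set V} (hO : IsOpen O) (hc : IsConnected O) {F : V → ℂ} (hF : ContinuousOn F O)
    (h0 : ∀ x ∈ O, F x ≠ 0)
    (hw : ∀ γ : ℝ → V, ContinuousOn γ (Icc 0 1) → γ 0 = γ 1 → MapsTo γ (Icc 0 1) O →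
      ∀ n : ℤ, HasWinding (fun t => F (γ t)) n → n = 0) :
    ∃ h : V → ℂ, ContinuousOn h O ∧ ∀ x ∈ O, Complex.exp (h x) = F x := by
  classical
  have : LocallyPathConnectedSpace O := hO.locallyPathConnectedSpace
  have : PathConnectedSpace O :=
    isPathConnected_iff_pathConnectedSpace.1 (hO.isConnected_iff_isPathConnected.1 hc)
  let f : C(O, {z : ℂ // z ≠ 0}) :=
    ⟨fun x => ⟨F x, h0 x x.2⟩, (continuousOn_iff_continuous_domRestrict.1 hF).subtype_mk _⟩
  obtain ⟨x₀, hx₀⟩ := hc.nonempty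
  obtain ⟨H, ⟨-, hH⟩, -⟩ := Complex.isCoveringMap_exp.isLocalHomeomorph.existsUnique_continuousMap_lifts
    f ⟨x₀, hx₀⟩ (Complex.log (F x₀)) (Subtype.ext (Complex.exp_log (h0 x₀ hx₀)))
    (fun γ hγ => by
      simpa [and_comm] using Complex.isCoveringMap_exp.exists_path_lifts (f.comp γ)
        (Complex.log (F x₀)) (by
          rw [ContinuousMap.comp_apply, hγ]; exact (Subtype.ext (Complex.exp_log (h0 x₀ hx₀)).symm)))
    (fun γ γ' Γ Γ' hγ hγ' hΓ hΓ' hl hl' h1 => by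
      have e1 : ∀ t, Complex.exp (Γ t) = F (γ t) := fun t => congrArg Subtype.val (congrFun hl t)
      have e2 : ∀ t, Complex.exp (Γ' t) = F (γ' t) := fun t => congrArg Subtype.val (congrFun hl' t)
      -- close the two paths up, and their lifts correspondingly
      let p : Path (⟨x₀, hx₀⟩ : O) (γ 1) := ⟨γ, hγ, rfl⟩
      let p' : Path (⟨x₀, hx₀⟩ : O) (γ 1) := ⟨γ', hγ', h1.symm⟩
      let q : Path (Γ 0) (Γ 1) := ⟨Γ, rfl, rfl⟩
      let q' : Path (Γ 1 - Γ' 1 + Γ 0) (Γ 1) :=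
        ⟨⟨fun t => Γ 1 - Γ' 1 + Γ' t, by fun_prop⟩, by simp [hΓ, hΓ'], by simp⟩
      have e3 : Complex.exp (Γ 1 - Γ' 1) = 1 := by
        rw [Complex.exp_sub, e1, e2, h1, div_self (h0 _ (γ' 1).2)]
      have e4 : ∀ t, Complex.exp ((q.trans q'.symm) t) = F ((p.trans p'.symm) t) := by
        intro t
        rw [Path.trans_apply, Path.trans_apply]
        split_ifs
        · exact e1 _
        · change Complex.exp (Γ 1 - Γ' 1 + Γ' _) = F (γ' _)
          rw [Complex.exp_add, e3, one_mul, e2]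
      obtain ⟨n, hn, hn'⟩ := exists_hasWinding (f := fun t => F ((p.trans p'.symm).extend t))
        (θ := (q.trans q'.symm).extend) (Path.continuous_extend _).continuousOn
        (fun t ht => by
          rw [Path.extend_apply _ ht, Path.extend_apply _ ht]
          exact e4 _) (by simp)
      have hn0 := hw (fun t => (p.trans p'.symm).extend t)
        (continuous_subtype_val.comp (Path.continuous_extend _)).continuousOn (by simp)
        (fun t _ => Subtype.coe_prop _) n hn
      rw [hn0] at hn'
      simp only [Path.extend_one, Path.extend_zero] at hn'
      simp at hn'
      linear_combination hn')
  refine ⟨fun x => if hx : x ∈ O then H ⟨x, hx⟩ else 0, ?_, fun x hx => ?_⟩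
  · rw [continuousOn_iff_continuous_domRestrict]
    convert H.continuous using 1
    ext x
    simp
  · simp only [hx, dif_pos]
    exact congrArg Subtype.val (congrFun hH ⟨x, hx⟩)

end logarithms

/-! ### Totally disconnected sets carry no winding -/

section core

/-- The vertices of a cubical lattice with mesh `η` and corner `b`. -/
def latticePoint (b : ℝ × ℝ × ℝ) (η : ℝ) (x y z : ℕ) : ℝ × ℝ × ℝ :=
  (b.1 + η * x, b.2.1 + η * y, b.2.2 + η * z)

theorem dist_latticePoint_lt_iff {b p : ℝ × ℝ × ℝ} {η ρ : ℝ} {x y z : ℕ} :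
    dist (latticePoint b η x y z) p < ρ ↔ |η * x - (p.1 - b.1)| < ρ ∧
      |η * y - (p.2.1 - b.2.1)| < ρ ∧ |η * z - (p.2.2 - b.2.2)| < ρ := by
  simp only [latticePoint, Prod.dist_eq, sup_lt_iff, Real.dist_eq]
  ring_nf

theorem dist_latticePoint_le_iff {b p : ℝ × ℝ × ℝ} {η ρ : ℝ} {x y z : ℕ} :
    dist (latticePoint b η x y z) p ≤ ρ ↔ |η * x - (p.1 - b.1)| ≤ ρ ∧
      |η * y - (p.2.1 - b.2.1)| ≤ ρ ∧ |η * z - (p.2.2 - b.2.2)| ≤ ρ := by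
  simp only [latticePoint, Prod.dist_eq, sup_le_iff, Real.dist_eq]
  ring_nf

theorem dist_latticePoint_le {b : ℝ × ℝ × ℝ} {η : ℝ} (hη : 0 ≤ η) {x y z x' y' z' : ℕ}
    (hx : x' ≤ x + 1 ∧ x ≤ x' + 1) (hy : y' ≤ y + 1 ∧ y ≤ y' + 1) (hz : z' ≤ z + 1 ∧ z ≤ z' + 1) :
    dist (latticePoint b η x y z) (latticePoint b η x' y' z') ≤ η := by
  have key : ∀ {m n : ℕ}, n ≤ m + 1 ∧ m ≤ n + 1 → ∀ c : ℝ, |η * m - (c + η * n - c)| ≤ η := by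
    intro m n h c
    have h1 : (n : ℝ) ≤ m + 1 := by exact_mod_cast h.1
    have h2 : (m : ℝ) ≤ n + 1 := by exact_mod_cast h.2
    rw [abs_le]
    constructor <;> nlinarith
  exact dist_latticePoint_le_iff.2 ⟨key hx _, key hy _, key hz _⟩

theorem exists_index_range {η s ρ : ℝ} (hη : 0 < η) (hρ : 0 < ρ) (hs : ρ < s) :
    ∃ l h : ℕ, 0 < l ∧ (∀ x : ℕ, |η * x - s| < ρ → l ≤ x ∧ x ≤ h) ∧
      ∀ x : ℕ, l ≤ x → x ≤ h + 1 → |η * x - s| ≤ ρ + η := by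
  refine ⟨⌈(s - ρ) / η⌉₊, ⌊(s + ρ) / η⌋₊, ?_, fun x hx => ?_, fun x h1 h2 => ?_⟩
  · rw [Nat.ceil_pos]; exact div_pos (by linarith) hη
  · rw [abs_lt] at hx
    constructor
    · rw [Nat.ceil_le, div_le_iff₀ hη]; nlinarith
    · refine Nat.le_floor ?_
      rw [le_div_iff₀ hη]; nlinarith
  · rw [Nat.ceil_le, div_le_iff₀ hη] at h1
    have h3 : (x : ℝ) ≤ (s + ρ) / η + 1 := by
      have h4 : (x : ℝ) ≤ ⌊(s + ρ) / η⌋₊ + 1 := by exact_mod_cast h2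
      have h5 := Nat.floor_le (show 0 ≤ (s + ρ) / η from div_nonneg (by linarith) hη.le)
      linarith
    have h6 : η * x ≤ s + ρ + η := by
      calc η * x ≤ η * ((s + ρ) / η + 1) := by gcongr
        _ = s + ρ + η := by field_simp
    rw [abs_le]
    constructor <;> nlinarith

/-- A function on the integers is constant on an interval if it is so in unit steps. -/
theorem eq_of_forall_succ_eq {α : Type*} {f : ℕ → α} {η s ρ : ℝ} (hη : 0 ≤ η)
    (hf : ∀ j : ℕ, |η * j - s| < ρ → |η * (j + 1 : ℕ) - s| < ρ → f j = f (j + 1)) {m n : ℕ}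
    (hm : |η * m - s| < ρ) (hn : |η * n - s| < ρ) : f m = f n := by
  wlog hmn : m ≤ n generalizing m n
  · exact (this hn hm (by omega)).symm
  have key : ∀ j, m ≤ j → j ≤ n → |η * j - s| < ρ := by
    intro j h1 h2
    have h1' : η * m ≤ η * j := by gcongr
    have h2' : η * j ≤ η * n := by gcongr
    rw [abs_lt] at *
    constructor <;> linarith [hm.1, hn.2]
  suffices ∀ j, m ≤ j → j ≤ n → f m = f j from this n hmn le_rfl
  intro j hj
  induction j, hj using Nat.le_induction with
  | base => exact fun _ => rfl
  | succ j hj ih =>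
    intro hjn
    rw [ih (by omega)]
    exact hf j (key j hj (by omega)) (key (j + 1) (by omega) hjn)

/-- The part of the topological argument that is about cochains on the lattice. A 1-cochain `A`
that is closed away from a set `Y` with small pieces becomes a gradient when it is changed near
`Y`, as the second cohomology of space with compact supports vanishes. -/
theorem exists_primitive_off {Y : Set (ℝ × ℝ × ℝ)} {n : ℕ} {π : ℝ × ℝ × ℝ → ℕ} {d δ δ₀ η : ℝ}
    {b : ℝ × ℝ × ℝ} (hd : 0 < d) (hδ : 0 < δ) (hη : 0 < η) (hηδ : 4 * η ≤ δ) (hδ₀ : 5 * δ ≤ δ₀)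
    (hπn : ∀ x ∈ Y, π x < n) (hπ₀ : ∀ x ∈ Y, ∀ y ∈ Y, dist x y < δ₀ → π x = π y)
    (hπd : ∀ x ∈ Y, ∀ y ∈ Y, π x = π y → dist x y < d)
    (hb : ∀ y ∈ Y, d + 2 * δ < y.1 - b.1 ∧ d + 2 * δ < y.2.1 - b.2.1 ∧ d + 2 * δ < y.2.2 - b.2.2)
    {A : ℝ × ℝ × ℝ → ℝ × ℝ × ℝ → ℂ}
    (hA : ∀ u v w, (∀ y ∈ Y, δ ≤ dist u y) → (∀ y ∈ Y, δ ≤ dist v y) → (∀ y ∈ Y, δ ≤ dist w y) →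
      dist u v ≤ η → dist v w ≤ η → dist u w ≤ η → A u v + A v w = A u w) :
    ∃ k : ℕ → ℕ → ℕ → ℂ, ∀ x y z,
      (∀ q ∈ Y, d + 2 * δ + η < dist (latticePoint b η x y z) q) →
      k (x + 1) y z = k x y z + A (latticePoint b η x y z) (latticePoint b η (x + 1) y z) ∧
      k x (y + 1) z = k x y z + A (latticePoint b η x y z) (latticePoint b η x (y + 1) z) ∧
      k x y (z + 1) = k x y z + A (latticePoint b η x y z) (latticePoint b η x y (z + 1)) := by
  classical
  set P := latticePoint b η with hP
  let a₁ : ℕ → ℕ → ℕ → ℂ := fun x y z => A (P x y z) (P (x + 1) y z)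
  let a₂ : ℕ → ℕ → ℕ → ℂ := fun x y z => A (P x y z) (P x (y + 1) z)
  let a₃ : ℕ → ℕ → ℕ → ℂ := fun x y z => A (P x y z) (P x y (z + 1))
  let c₁₂ : ℕ → ℕ → ℕ → ℂ := fun x y z => a₁ x y z + a₂ (x + 1) y z - a₂ x y z - a₁ x (y + 1) z
  let c₁₃ : ℕ → ℕ → ℕ → ℂ := fun x y z => a₁ x y z + a₃ (x + 1) y z - a₃ x y z - a₁ x y (z + 1)
  let c₂₃ : ℕ → ℕ → ℕ → ℂ := fun x y z => a₂ x y z + a₃ x (y + 1) z - a₃ x y z - a₂ x y (z + 1)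
  let near : ℕ → ℕ → ℕ → ℕ → Prop := fun i x y z => ∃ q ∈ Y, π q = i ∧ dist (P x y z) q < 2 * δ
  have hstep : ∀ {x y z x' y' z' : ℕ}, x' ≤ x + 1 ∧ x ≤ x' + 1 → y' ≤ y + 1 ∧ y ≤ y' + 1 →
      z' ≤ z + 1 ∧ z ≤ z' + 1 → dist (P x y z) (P x' y' z') ≤ η :=
    fun h1 h2 h3 => dist_latticePoint_le hη.le h1 h2 h3
  -- the coboundary of `A` lives near `Y`
  have hzero : ∀ x y z, (∀ i, ¬ near i x y z) → c₁₂ x y z = 0 ∧ c₁₃ x y z = 0 ∧ c₂₃ x y z = 0 := by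
    intro x y z hn
    have hg : ∀ x' y' z', x' ≤ x + 1 ∧ x ≤ x' + 1 → y' ≤ y + 1 ∧ y ≤ y' + 1 →
        z' ≤ z + 1 ∧ z ≤ z' + 1 → ∀ q ∈ Y, δ ≤ dist (P x' y' z') q := by
      intro x' y' z' h1 h2 h3 q hq
      have h4 : 2 * δ ≤ dist (P x y z) q := not_lt.1 fun h => hn (π q) ⟨q, hq, rfl, h⟩
      have h5 := dist_triangle (P x y z) (P x' y' z') q
      linarith [hstep h1 h2 h3]
    refine ⟨?_, ?_, ?_⟩
    · have e1 := hA (P x y z) (P (x + 1) y z) (P (x + 1) (y + 1) z)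
        (hg _ _ _ (by omega) (by omega) (by omega)) (hg _ _ _ (by omega) (by omega) (by omega))
        (hg _ _ _ (by omega) (by omega) (by omega)) (hstep (by omega) (by omega) (by omega))
        (hstep (by omega) (by omega) (by omega)) (hstep (by omega) (by omega) (by omega))
      have e2 := hA (P x y z) (P x (y + 1) z) (P (x + 1) (y + 1) z)
        (hg _ _ _ (by omega) (by omega) (by omega)) (hg _ _ _ (by omega) (by omega) (by omega))
        (hg _ _ _ (by omega) (by omega) (by omega)) (hstep (by omega) (by omega) (by omega))
        (hstep (by omega) (by omega) (by omega)) (hstep (by omega) (by omega) (by omega))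
      simp only [c₁₂, a₁, a₂]
      linear_combination e1 - e2
    · have e1 := hA (P x y z) (P (x + 1) y z) (P (x + 1) y (z + 1))
        (hg _ _ _ (by omega) (by omega) (by omega)) (hg _ _ _ (by omega) (by omega) (by omega))
        (hg _ _ _ (by omega) (by omega) (by omega)) (hstep (by omega) (by omega) (by omega))
        (hstep (by omega) (by omega) (by omega)) (hstep (by omega) (by omega) (by omega))
      have e2 := hA (P x y z) (P x y (z + 1)) (P (x + 1) y (z + 1))
        (hg _ _ _ (by omega) (by omega) (by omega)) (hg _ _ _ (by omega) (by omega) (by omega))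
        (hg _ _ _ (by omega) (by omega) (by omega)) (hstep (by omega) (by omega) (by omega))
        (hstep (by omega) (by omega) (by omega)) (hstep (by omega) (by omega) (by omega))
      simp only [c₁₃, a₁, a₃]
      linear_combination e1 - e2
    · have e1 := hA (P x y z) (P x (y + 1) z) (P x (y + 1) (z + 1))
        (hg _ _ _ (by omega) (by omega) (by omega)) (hg _ _ _ (by omega) (by omega) (by omega))
        (hg _ _ _ (by omega) (by omega) (by omega)) (hstep (by omega) (by omega) (by omega))
        (hstep (by omega) (by omega) (by omega)) (hstep (by omega) (by omega) (by omega))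
      have e2 := hA (P x y z) (P x y (z + 1)) (P x (y + 1) (z + 1))
        (hg _ _ _ (by omega) (by omega) (by omega)) (hg _ _ _ (by omega) (by omega) (by omega))
        (hg _ _ _ (by omega) (by omega) (by omega)) (hstep (by omega) (by omega) (by omega))
        (hstep (by omega) (by omega) (by omega)) (hstep (by omega) (by omega) (by omega))
      simp only [c₂₃, a₂, a₃]
      linear_combination e1 - e2
  have hunique : ∀ {i j x y z x' y' z'}, near i x y z → near j x' y' z' →
      dist (P x y z) (P x' y' z') ≤ η → i = j := by
    rintro i j x y z x' y' z' ⟨q, hq, rfl, h1⟩ ⟨q', hq', rfl, h2⟩ h3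
    refine hπ₀ q hq q' hq' ?_
    have h4 := dist_triangle_left q q' (P x y z)
    have h5 := dist_triangle (P x y z) (P x' y' z') q'
    linarith
  -- the part near one of the pieces of `Y` is a coboundary
  have hpiece : ∀ i : ℕ, ∃ b₁ b₂ b₃ : ℕ → ℕ → ℕ → ℂ,
      (∀ x y z, b₁ x y z + b₂ (x + 1) y z = b₂ x y z + b₁ x (y + 1) z +
        if near i x y z then c₁₂ x y z else 0) ∧
      (∀ x y z, b₁ x y z + b₃ (x + 1) y z = b₃ x y z + b₁ x y (z + 1) +
        if near i x y z then c₁₃ x y z else 0) ∧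
      (∀ x y z, b₂ x y z + b₃ x (y + 1) z = b₃ x y z + b₂ x y (z + 1) +
        if near i x y z then c₂₃ x y z else 0) ∧
      ∀ x y z, (∀ q ∈ Y, d + 2 * δ + η < dist (P x y z) q) →
        b₁ x y z = 0 ∧ b₂ x y z = 0 ∧ b₃ x y z = 0 := by
    intro i
    by_cases hi : ∃ q ∈ Y, π q = i
    · obtain ⟨q, hq, rfl⟩ := hi
      obtain ⟨l₁, h₁, hl₁, hin₁, hout₁⟩ := exists_index_range hη (by positivity) (hb q hq).1
      obtain ⟨l₂, h₂, hl₂, hin₂, hout₂⟩ := exists_index_range hη (by positivity) (hb q hq).2.1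
      obtain ⟨l₃, h₃, hl₃, hin₃, hout₃⟩ := exists_index_range hη (by positivity) (hb q hq).2.2
      have hnear : ∀ x y z, near (π q) x y z → dist (P x y z) q < d + 2 * δ := by
        rintro x y z ⟨q', hq', h1, h2⟩
        linarith [dist_triangle (P x y z) q' q, hπd q' hq' q hq h1]
      have hbox : ∀ x y z, (x < l₁ ∨ h₁ < x ∨ y < l₂ ∨ h₂ < y ∨ z < l₃ ∨ h₃ < z) →
          ¬ near (π q) x y z := by
        intro x y z h1 h2
        obtain ⟨g1, g2, g3⟩ := dist_latticePoint_lt_iff.1 (hnear x y z h2)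
        have := hin₁ x g1
        have := hin₂ y g2
        have := hin₃ z g3
        omega
      obtain ⟨b₁, b₂, b₃, e1, e2, e3, e4⟩ := exists_primitive_of_closed_two
        (h₁ := h₁) (h₂ := h₂) (h₃ := h₃)
        (c₁₂ := fun x y z => if near (π q) x y z then c₁₂ x y z else 0)
        (c₁₃ := fun x y z => if near (π q) x y z then c₁₃ x y z else 0)
        (c₂₃ := fun x y z => if near (π q) x y z then c₂₃ x y z else 0) hl₁ hl₂ hl₃
        (fun x y z => by
          -- on a cube that touches the support, the cut-off does nothing
          have hcl : c₂₃ (x + 1) y z + c₁₃ x y z + c₁₂ x y (z + 1) =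
              c₂₃ x y z + c₁₃ x (y + 1) z + c₁₂ x y z := by
            simp only [c₁₂, c₁₃, c₂₃]; ring
          by_cases hex : near (π q) x y z ∨ near (π q) (x + 1) y z ∨ near (π q) x (y + 1) z ∨
              near (π q) x y (z + 1)
          · have key : ∀ x' y' z', x ≤ x' ∧ x' ≤ x + 1 → y ≤ y' ∧ y' ≤ y + 1 →
                z ≤ z' ∧ z' ≤ z + 1 → ¬ near (π q) x' y' z' →
                c₁₂ x' y' z' = 0 ∧ c₁₃ x' y' z' = 0 ∧ c₂₃ x' y' z' = 0 := by
              intro x' y' z' k1 k2 k3 hnot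
              refine hzero x' y' z' fun j hj => hnot ?_
              rcases hex with h | h | h | h
              all_goals
                rw [hunique h hj (hstep (by omega) (by omega) (by omega))]
                exact hj
            have r1 : (if near (π q) x y z then c₁₂ x y z else 0) = c₁₂ x y z := by
              split_ifs with h
              · rfl
              · rw [(key x y z (by omega) (by omega) (by omega) h).1]
            have r2 : (if near (π q) x y z then c₁₃ x y z else 0) = c₁₃ x y z := by
              split_ifs with h
              · rfl
              · rw [(key x y z (by omega) (by omega) (by omega) h).2.1]
            have r3 : (if near (π q) x y z then c₂₃ x y z else 0) = c₂₃ x y z := by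
              split_ifs with h
              · rfl
              · rw [(key x y z (by omega) (by omega) (by omega) h).2.2]
            have r4 : (if near (π q) (x + 1) y z then c₂₃ (x + 1) y z else 0) = c₂₃ (x + 1) y z := by
              split_ifs with h
              · rfl
              · rw [(key (x + 1) y z (by omega) (by omega) (by omega) h).2.2]
            have r5 : (if near (π q) x (y + 1) z then c₁₃ x (y + 1) z else 0) = c₁₃ x (y + 1) z := by
              split_ifs with h
              · rfl
              · rw [(key x (y + 1) z (by omega) (by omega) (by omega) h).2.1]
            have r6 : (if near (π q) x y (z + 1) then c₁₂ x y (z + 1) else 0) = c₁₂ x y (z + 1) := by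
              split_ifs with h
              · rfl
              · rw [(key x y (z + 1) (by omega) (by omega) (by omega) h).1]
            rw [r1, r2, r3, r4, r5, r6, hcl]
          · simp only [not_or] at hex
            simp [hex])
        (fun x y z h => by simp [hbox x y z h])
      refine ⟨b₁, b₂, b₃, e1, e2, e3, fun x y z h => e4 x y z ?_⟩
      by_contra hcon
      refine absurd (h q hq) (not_lt.2 (dist_latticePoint_le_iff.2
        ⟨hout₁ x (by omega) (by omega), hout₂ y (by omega) (by omega),
          hout₃ z (by omega) (by omega)⟩))
    · have hno : ∀ x y z, ¬ near i x y z := fun x y z ⟨q, hq, h, _⟩ => hi ⟨q, hq, h⟩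
      exact ⟨0, 0, 0, by simp [hno], by simp [hno], by simp [hno], by simp⟩
  choose b₁ b₂ b₃ hb12 hb13 hb23 hb0 using hpiece
  have hsum : ∀ (c : ℕ → ℕ → ℕ → ℂ) x y z, ((∀ i, ¬ near i x y z) → c x y z = 0) →
      ∑ i ∈ Finset.range n, (if near i x y z then c x y z else 0) = c x y z := by
    intro c x y z hc
    by_cases h : ∃ i, near i x y z
    · obtain ⟨i, hi⟩ := h
      have hin : i < n := by
        obtain ⟨q, hq, rfl, -⟩ := hi
        exact hπn q hq
      rw [Finset.sum_eq_single i]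
      · simp [hi]
      · intro j _ hj
        have : ¬ near j x y z := fun h => hj (hunique h hi (by simpa using hη.le))
        simp [this]
      · exact fun h => absurd (Finset.mem_range.2 hin) h
    · rw [hc (not_exists.1 h)]
      simp
  obtain ⟨k, hk⟩ := exists_primitive_of_closed_one
    (a₁ := fun x y z => a₁ x y z - ∑ i ∈ Finset.range n, b₁ i x y z)
    (a₂ := fun x y z => a₂ x y z - ∑ i ∈ Finset.range n, b₂ i x y z)
    (a₃ := fun x y z => a₃ x y z - ∑ i ∈ Finset.range n, b₃ i x y z)
    (fun x y z => by
      have h1 := Finset.sum_congr (rfl : Finset.range n = _) fun i _ => hb12 i x y z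
      simp only [Finset.sum_add_distrib] at h1
      rw [hsum c₁₂ x y z fun h => (hzero x y z h).1] at h1
      simp only [c₁₂] at h1
      linear_combination -h1)
    (fun x y z => by
      have h1 := Finset.sum_congr (rfl : Finset.range n = _) fun i _ => hb13 i x y z
      simp only [Finset.sum_add_distrib] at h1
      rw [hsum c₁₃ x y z fun h => (hzero x y z h).2.1] at h1
      simp only [c₁₃] at h1
      linear_combination -h1)
    (fun x y z => by
      have h1 := Finset.sum_congr (rfl : Finset.range n = _) fun i _ => hb23 i x y z
      simp only [Finset.sum_add_distrib] at h1
      rw [hsum c₂₃ x y z fun h => (hzero x y z h).2.2] at h1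
      simp only [c₂₃] at h1
      linear_combination -h1)
  refine ⟨k, fun x y z h => ?_⟩
  obtain ⟨k1, k2, k3⟩ := hk x y z
  have h0 := fun i => hb0 i x y z h
  simp only [fun i => (h0 i).1, fun i => (h0 i).2.1, fun i => (h0 i).2.2, Finset.sum_const_zero,
    sub_zero] at k1 k2 k3
  exact ⟨k1, k2, k3⟩

end core

section core

variable {Y Z : Set (ℝ × ℝ × ℝ)} {F : ℝ × ℝ × ℝ → ℂ}

/-- Away from `Y`, logarithms of `F` exist on balls of a fixed radius. -/
theorem exists_uniform_radius
    (hF : ∀ x ∉ Y, ∃ r > 0, ∃ h : ℝ × ℝ × ℝ → ℂ, ContinuousOn h (Metric.ball x r \ Z) ∧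
      ∀ y ∈ Metric.ball x r \ Z, Complex.exp (h y) = F y)
    (hinf : ∃ (R : ℝ) (h : ℝ × ℝ × ℝ → ℂ), ContinuousOn h ({x | R < ‖x‖} \ Z) ∧
      ∀ y ∈ {x | R < ‖x‖} \ Z, Complex.exp (h y) = F y) {δ : ℝ} (hδ : 0 < δ) :
    ∃ r > 0, ∀ x, (∀ y ∈ Y, δ ≤ dist x y) → ∃ h : ℝ × ℝ × ℝ → ℂ,
      ContinuousOn h (Metric.ball x r \ Z) ∧
      ∀ y ∈ Metric.ball x r \ Z, Complex.exp (h y) = F y := by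
  obtain ⟨R, hR, hRc, hRe⟩ := hinf
  let K : Set (ℝ × ℝ × ℝ) := Metric.closedBall 0 (R + 1) ∩ {x | ∀ y ∈ Y, δ ≤ dist x y}
  have hK : IsCompact K := by
    refine (isCompact_closedBall _ _).inter_right ?_
    have h1 : {x | ∀ y ∈ Y, δ ≤ dist x y} = ⋂ y ∈ Y, {x : ℝ × ℝ × ℝ | δ ≤ dist x y} := by
      ext; simp
    rw [h1]
    exact isClosed_biInter fun y _ => isClosed_le (by fun_prop) (by fun_prop)
  choose r hr h hh using fun x : {x // x ∉ Y} => hF x x.2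
  obtain ⟨r₀, hr₀, hleb⟩ := lebesgue_number_lemma_of_metric hK
    (c := fun x : {x // x ∉ Y} => Metric.ball (x : ℝ × ℝ × ℝ) (r x)) (fun _ => Metric.isOpen_ball)
    (fun x hx => mem_iUnion.2 ⟨⟨x, fun hxY => by
      have := hx.2 x hxY
      rw [dist_self] at this
      linarith⟩, Metric.mem_ball_self (hr _)⟩)
  refine ⟨min r₀ 1, lt_min hr₀ one_pos, fun x hx => ?_⟩
  by_cases hxR : ‖x‖ ≤ R + 1
  · obtain ⟨y, hy⟩ := hleb x ⟨by simpa using hxR, hx⟩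
    have hsub : Metric.ball x (min r₀ 1) \ Z ⊆ Metric.ball (y : ℝ × ℝ × ℝ) (r y) \ Z :=
      sdiff_subset_sdiff_left ((Metric.ball_subset_ball (min_le_left _ _)).trans hy)
    exact ⟨h y, (hh y).1.mono hsub, fun z hz => (hh y).2 z (hsub hz)⟩
  · have hsub : Metric.ball x (min r₀ 1) \ Z ⊆ {x | R < ‖x‖} \ Z := by
      refine sdiff_subset_sdiff_left fun z hz => ?_
      have h1 : dist z x < 1 := (Metric.mem_ball.1 hz).trans_le (min_le_right _ _)
      have h2 : ‖x‖ ≤ ‖z‖ + dist z x := by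
        rw [dist_comm, dist_eq_norm]
        linarith [norm_sub_norm_le x z]
      change R < ‖z‖
      linarith [not_le.1 hxR]
    exact ⟨hR, hRc.mono hsub, fun z hz => hRe z (hsub hz)⟩

/-- Normalized logarithms `val c` on balls with centre `c` away from `Y`, together with the
constants by which they differ on neighbouring balls. -/
theorem exists_local_logs
    (hN : ∀ O : Set (ℝ × ℝ × ℝ), IsOpen O → Convex ℝ O → O.Nonempty → Disjoint O Y →
      IsConnected (O \ Z)) {δ η : ℝ} (hη : 0 < η) (hηδ : 4 * η ≤ δ)
    (hlog : ∀ x, (∀ y ∈ Y, δ ≤ dist x y) → ∃ h : ℝ × ℝ × ℝ → ℂ,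
      ContinuousOn h (Metric.ball x (4 * η) \ Z) ∧
      ∀ y ∈ Metric.ball x (4 * η) \ Z, Complex.exp (h y) = F y) :
    ∃ (A : ℝ × ℝ × ℝ → ℝ × ℝ × ℝ → ℂ) (val : ℝ × ℝ × ℝ → ℝ × ℝ × ℝ → ℂ)
      (κ : ℝ × ℝ × ℝ → ℂ),
      (∀ u v w, (∀ y ∈ Y, δ ≤ dist u y) → (∀ y ∈ Y, δ ≤ dist v y) → (∀ y ∈ Y, δ ≤ dist w y) →
        dist u v ≤ η → dist v w ≤ η → dist u w ≤ η → A u v + A v w = A u w) ∧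
      (∀ u v x, (∀ y ∈ Y, δ ≤ dist u y) → (∀ y ∈ Y, δ ≤ dist v y) → dist u v ≤ η →
        dist u x < 2 * η → dist v x < 2 * η → x ∉ Z → val u x = A u v + val v x) ∧
      ∀ u, (∀ y ∈ Y, δ ≤ dist u y) → ContinuousOn (val u) (Metric.ball u (4 * η) \ Z) ∧
        ∀ x ∈ Metric.ball u (4 * η) \ Z, Complex.exp (val u x) = κ u * F x := by
  classical
  have hdisj : ∀ u, (∀ y ∈ Y, δ ≤ dist u y) → ∀ r, r ≤ δ → Disjoint (Metric.ball u r) Y := by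
    intro u hu r hr
    refine disjoint_left.2 fun x hx hxY => ?_
    have := hu x hxY
    rw [Metric.mem_ball, dist_comm] at hx
    linarith
  have hpt : ∀ u, ∃ p, (∀ y ∈ Y, δ ≤ dist u y) → p ∈ Metric.ball u η \ Z := by
    intro u
    by_cases hu : ∀ y ∈ Y, δ ≤ dist u y
    · obtain ⟨p, hp⟩ := (hN _ Metric.isOpen_ball (convex_ball u η) ⟨u, Metric.mem_ball_self hη⟩
        (hdisj u hu _ (by linarith))).nonempty
      exact ⟨p, fun _ => hp⟩
    · exact ⟨u, fun h => absurd h hu⟩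
  choose p hp using hpt
  have hlog' : ∀ x, ∃ h : ℝ × ℝ × ℝ → ℂ, (∀ y ∈ Y, δ ≤ dist x y) →
      ContinuousOn h (Metric.ball x (4 * η) \ Z) ∧
      ∀ y ∈ Metric.ball x (4 * η) \ Z, Complex.exp (h y) = F y := by
    intro x
    by_cases hx : ∀ y ∈ Y, δ ≤ dist x y
    · obtain ⟨h, hh⟩ := hlog x hx
      exact ⟨h, fun _ => hh⟩
    · exact ⟨0, fun h => absurd h hx⟩
  choose h hh using hlog'
  have hcompat : ∀ u v, (∀ y ∈ Y, δ ≤ dist u y) → (∀ y ∈ Y, δ ≤ dist v y) → ∀ x x',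
      dist u x < 4 * η → dist v x < 4 * η → dist u x' < 4 * η → dist v x' < 4 * η →
      x ∉ Z → x' ∉ Z → h u x - h v x = h u x' - h v x' := by
    intro u v hu hv x x' h1 h2 h3 h4 h5 h6
    have hconn := hN (Metric.ball u (4 * η) ∩ Metric.ball v (4 * η))
      (Metric.isOpen_ball.inter Metric.isOpen_ball) ((convex_ball _ _).inter (convex_ball _ _))
      ⟨x, by rwa [Metric.mem_ball'], by rwa [Metric.mem_ball']⟩
      ((hdisj u hu _ hηδ).mono_left inter_subset_left)
    refine sub_eq_sub_of_exp_eq hconn.isPreconnected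
      ((hh u hu).1.mono (sdiff_subset_sdiff_left inter_subset_left))
      ((hh v hv).1.mono (sdiff_subset_sdiff_left inter_subset_right)) (fun y hy => ?_) ?_ ?_
    · rw [(hh u hu).2 y ⟨hy.1.1, hy.2⟩, (hh v hv).2 y ⟨hy.1.2, hy.2⟩]
    · exact ⟨⟨by rwa [Metric.mem_ball'], by rwa [Metric.mem_ball']⟩, h5⟩
    · exact ⟨⟨by rwa [Metric.mem_ball'], by rwa [Metric.mem_ball']⟩, h6⟩
  have hpd : ∀ u v, (∀ y ∈ Y, δ ≤ dist v y) → dist u v ≤ η → dist u (p v) < 4 * η := by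
    intro u v hv huv
    have h1 := Metric.mem_ball'.1 (hp v hv).1
    linarith [dist_triangle u v (p v)]
  refine ⟨fun u v => h u (p v) - h u (p u), fun u x => h u x - h u (p u),
    fun u => Complex.exp (-h u (p u)), fun u v w hu hv hw huv hvw huw => ?_,
    fun u v x hu hv huv hux hvx hx => ?_, fun u hu => ⟨(hh u hu).1.sub continuousOn_const, ?_⟩⟩
  · have := hcompat u v hu hv (p v) (p w) (hpd u v hv huv) (hpd v v hv (by simpa using hη.le))
      (hpd u w hw huw) (hpd v w hw hvw) (hp v hv).2 (hp w hw).2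
    linear_combination this
  · have := hcompat u v hu hv (p v) x (hpd u v hv huv) (hpd v v hv (by simpa using hη.le))
      (by linarith) (by linarith) (hp v hv).2 hx
    linear_combination -this
  · intro x hx
    change Complex.exp (h u x - h u (p u)) = Complex.exp (-h u (p u)) * F x
    rw [sub_eq_neg_add, Complex.exp_add, (hh u hu).2 x hx]

/-- The topological core of the argument. Let `Y` be compact and totally disconnected, and let `F`
have no zeros off the set `Z ⊇ Y`, which separates no convex open set disjoint from `Y`. If
`F` has a logarithm off `Z` locally at all points off `Y`, and at infinity, then its winding number
along every closed curve off `Z` is zero. -/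
theorem log_periodic_of_isTotallyDisconnected (hY : IsCompact Y) (htd : IsTotallyDisconnected Y)
    (hYZ : Y ⊆ Z)
    (hN : ∀ O : Set (ℝ × ℝ × ℝ), IsOpen O → Convex ℝ O → O.Nonempty → Disjoint O Y →
      IsConnected (O \ Z))
    (hF : ∀ x ∉ Y, ∃ r > 0, ∃ h : ℝ × ℝ × ℝ → ℂ, ContinuousOn h (Metric.ball x r \ Z) ∧
      ∀ y ∈ Metric.ball x r \ Z, Complex.exp (h y) = F y)
    (hinf : ∃ (R : ℝ) (h : ℝ × ℝ × ℝ → ℂ), ContinuousOn h ({x | R < ‖x‖} \ Z) ∧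
      ∀ y ∈ {x | R < ‖x‖} \ Z, Complex.exp (h y) = F y)
    {γ : ℝ → ℝ × ℝ × ℝ} (hγ : ContinuousOn γ (Icc 0 1)) (hγ01 : γ 0 = γ 1)
    (hγZ : ∀ t ∈ Icc (0 : ℝ) 1, γ t ∉ Z) {θ : ℝ → ℂ} (hθ : ContinuousOn θ (Icc 0 1))
    (hexp : ∀ t ∈ Icc (0 : ℝ) 1, Complex.exp (θ t) = F (γ t)) : θ 1 = θ 0 := by
  have hγc : IsCompact (γ '' Icc 0 1) := isCompact_Icc.image_of_continuousOn hγ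
  -- the distance of the curve from `Y`
  obtain ⟨D₀, hD₀, hD⟩ : ∃ D₀ > 0, ∀ t ∈ Icc (0 : ℝ) 1, ∀ y ∈ Y, D₀ ≤ dist (γ t) y := by
    have hdj : Disjoint (γ '' Icc 0 1) Y := by
      refine disjoint_left.2 ?_
      rintro _ ⟨t, ht, rfl⟩ hy
      exact hγZ t ht (hYZ hy)
    obtain ⟨r, hr, h⟩ := Metric.exists_pos_forall_lt_edist hγc hY.isClosed hdj
    refine ⟨r, hr, fun t ht y hy => ?_⟩
    have := h (γ t) (mem_image_of_mem γ ht) y hy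
    rw [edist_nndist] at this
    exact_mod_cast (ENNReal.coe_lt_coe.1 this).le
  -- The pieces of `Y` are small compared with `D₀`, so that the changes made in a box around each
  -- of them do not reach the curve; `δ` is small compared with `D₀` and the gaps between pieces.
  obtain ⟨n, π, δ₀, hδ₀, hπn, hπ₀, hπd⟩ := exists_labelling hY htd (d := D₀ / 4) (by positivity)
  set δ := min (D₀ / 16) (δ₀ / 5) with hδ
  have hδpos : 0 < δ := lt_min (by positivity) (by positivity)
  have hδ1 : δ ≤ D₀ / 16 := min_le_left _ _
  have hδ2 : δ ≤ δ₀ / 5 := min_le_right _ _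
  obtain ⟨r, hr, hlog⟩ := exists_uniform_radius hF hinf hδpos
  set η := min (r / 4) (δ / 4) with hη
  have hηpos : 0 < η := lt_min (by positivity) (by positivity)
  have hη1 : η ≤ r / 4 := min_le_left _ _
  have hη2 : η ≤ δ / 4 := min_le_right _ _
  obtain ⟨A, val, κ, hA, hval, hvalF⟩ := exists_local_logs (δ := δ) (η := η) hN hηpos (by linarith) fun x hx => by
    obtain ⟨h, h1, h2⟩ := hlog x hx
    have hsub : Metric.ball x (4 * η) \ Z ⊆ Metric.ball x r \ Z :=
      sdiff_subset_sdiff_left (Metric.ball_subset_ball (by linarith))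
    exact ⟨h, h1.mono hsub, fun y hy => h2 y (hsub hy)⟩
  -- a corner for the lattice
  obtain ⟨b, hbY, hbγ⟩ : ∃ b : ℝ × ℝ × ℝ, (∀ y ∈ Y, D₀ / 4 + 2 * δ < y.1 - b.1 ∧
      D₀ / 4 + 2 * δ < y.2.1 - b.2.1 ∧ D₀ / 4 + 2 * δ < y.2.2 - b.2.2) ∧
      ∀ t ∈ Icc (0 : ℝ) 1, 0 ≤ (γ t).1 - b.1 ∧ 0 ≤ (γ t).2.1 - b.2.1 ∧ 0 ≤ (γ t).2.2 - b.2.2 := by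
    obtain ⟨M, hM⟩ := (hY.union hγc).isBounded.exists_norm_le
    have hM' : ∀ y ∈ Y ∪ γ '' Icc 0 1, -M ≤ y.1 ∧ -M ≤ y.2.1 ∧ -M ≤ y.2.2 := by
      intro y hy
      have h1 := hM y hy
      simp only [Prod.norm_def, sup_le_iff, Real.norm_eq_abs, abs_le] at h1
      exact ⟨h1.1.1, h1.2.1.1, h1.2.2.1⟩
    set m := -M - (D₀ / 4 + 2 * δ) - 1 with hm
    refine ⟨(m, m, m), fun y hy => ?_, fun t ht => ?_⟩
    · obtain ⟨h1, h2, h3⟩ := hM' y (Or.inl hy)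
      refine ⟨?_, ?_, ?_⟩ <;> simp only [hm] <;> linarith
    · obtain ⟨h1, h2, h3⟩ := hM' _ (Or.inr (mem_image_of_mem γ ht))
      refine ⟨?_, ?_, ?_⟩ <;> simp only [hm] <;> linarith
  obtain ⟨k, hk⟩ := exists_primitive_off (by positivity) hδpos hηpos (by linarith) (by linarith)
    hπn hπ₀ hπd hbY hA
  set P := latticePoint b η with hP
  -- along the curve, the logarithms at nearby vertices fit together
  have hfar : ∀ t ∈ Icc (0 : ℝ) 1, ∀ x y z, dist (P x y z) (γ t) < 2 * η →
      (∀ q ∈ Y, δ ≤ dist (P x y z) q) ∧ ∀ q ∈ Y, D₀ / 4 + 2 * δ + η < dist (P x y z) q := by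
    intro t ht x y z h
    have h1 : ∀ q ∈ Y, D₀ - 2 * η < dist (P x y z) q := by
      intro q hq
      have := hD t ht q hq
      linarith [dist_triangle_left (γ t) q (P x y z)]
    exact ⟨fun q hq => by linarith [h1 q hq], fun q hq => by linarith [h1 q hq]⟩
  let G : ℕ → ℕ → ℕ → ℝ → ℂ := fun x y z t => val (P x y z) (γ t) + k x y z
  have hG1 : ∀ t ∈ Icc (0 : ℝ) 1, ∀ x y z, dist (P x y z) (γ t) < 2 * η →
      (dist (P (x + 1) y z) (γ t) < 2 * η → G x y z t = G (x + 1) y z t) ∧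
      (dist (P x (y + 1) z) (γ t) < 2 * η → G x y z t = G x (y + 1) z t) ∧
      (dist (P x y (z + 1)) (γ t) < 2 * η → G x y z t = G x y (z + 1) t) := by
    intro t ht x y z h
    obtain ⟨k1, k2, k3⟩ := hk x y z (hfar t ht x y z h).2
    refine ⟨fun h' => ?_, fun h' => ?_, fun h' => ?_⟩
    · have := hval _ _ (γ t) (hfar t ht x y z h).1 (hfar t ht _ y z h').1
        (dist_latticePoint_le hηpos.le (by omega) (by omega) (by omega)) h h' (hγZ t ht)
      simp only [G]
      linear_combination this - k1
    · have := hval _ _ (γ t) (hfar t ht x y z h).1 (hfar t ht x _ z h').1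
        (dist_latticePoint_le hηpos.le (by omega) (by omega) (by omega)) h h' (hγZ t ht)
      simp only [G]
      linear_combination this - k2
    · have := hval _ _ (γ t) (hfar t ht x y z h).1 (hfar t ht x y _ h').1
        (dist_latticePoint_le hηpos.le (by omega) (by omega) (by omega)) h h' (hγZ t ht)
      simp only [G]
      linear_combination this - k3
  have hG : ∀ t ∈ Icc (0 : ℝ) 1, ∀ x y z x' y' z', dist (P x y z) (γ t) < 2 * η →
      dist (P x' y' z') (γ t) < 2 * η → G x y z t = G x' y' z' t := by
    intro t ht x y z x' y' z' h h'
    obtain ⟨a1, a2, a3⟩ := dist_latticePoint_lt_iff.1 h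
    obtain ⟨b1, b2, b3⟩ := dist_latticePoint_lt_iff.1 h'
    have e1 : G x y z t = G x' y z t :=
      eq_of_forall_succ_eq (f := fun j => G j y z t) hηpos.le (fun j h1 h2 =>
        (hG1 t ht j y z (dist_latticePoint_lt_iff.2 ⟨h1, a2, a3⟩)).1
          (dist_latticePoint_lt_iff.2 ⟨h2, a2, a3⟩)) a1 b1
    have e2 : G x' y z t = G x' y' z t :=
      eq_of_forall_succ_eq (f := fun j => G x' j z t) hηpos.le (fun j h1 h2 =>
        (hG1 t ht x' j z (dist_latticePoint_lt_iff.2 ⟨b1, h1, a3⟩)).2.1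
          (dist_latticePoint_lt_iff.2 ⟨b1, h2, a3⟩)) a2 b2
    have e3 : G x' y' z t = G x' y' z' t :=
      eq_of_forall_succ_eq (f := fun j => G x' y' j t) hηpos.le (fun j h1 h2 =>
        (hG1 t ht x' y' j (dist_latticePoint_lt_iff.2 ⟨b1, b2, h1⟩)).2.2
          (dist_latticePoint_lt_iff.2 ⟨b1, b2, h2⟩)) a3 b3
    rw [e1, e2, e3]
  have hvert : ∀ t ∈ Icc (0 : ℝ) 1, ∃ x y z, dist (P x y z) (γ t) ≤ η := by
    have h1d : ∀ s : ℝ, 0 ≤ s → ∃ m : ℕ, |η * m - s| ≤ η := by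
      intro s hs
      refine ⟨⌊s / η⌋₊, ?_⟩
      have h1 := Nat.floor_le (div_nonneg hs hηpos.le)
      have h2 := Nat.lt_floor_add_one (s / η)
      rw [le_div_iff₀ hηpos] at h1
      rw [div_lt_iff₀ hηpos] at h2
      rw [abs_le]
      constructor <;> nlinarith
    intro t ht
    obtain ⟨h1, h2, h3⟩ := hbγ t ht
    obtain ⟨x, hx⟩ := h1d _ h1
    obtain ⟨y, hy⟩ := h1d _ h2
    obtain ⟨z, hz⟩ := h1d _ h3
    exact ⟨x, y, z, dist_latticePoint_le_iff.2 ⟨hx, hy, hz⟩⟩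
  have hvert' : ∀ t : ℝ, ∃ v : ℕ × ℕ × ℕ, t ∈ Icc (0 : ℝ) 1 → dist (P v.1 v.2.1 v.2.2) (γ t) ≤ η := by
    intro t
    by_cases ht : t ∈ Icc (0 : ℝ) 1
    · obtain ⟨x, y, z, h⟩ := hvert t ht
      exact ⟨(x, y, z), fun _ => h⟩
    · exact ⟨0, fun h => absurd h ht⟩
  choose v hv using hvert'
  let H : ℝ → ℂ := fun t => G (v t).1 (v t).2.1 (v t).2.2 t
  have hH : ∀ t ∈ Icc (0 : ℝ) 1, ∀ x y z, dist (P x y z) (γ t) < 2 * η → H t = G x y z t :=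
    fun t ht x y z h => hG t ht _ _ _ _ _ _ (by linarith [hv t ht]) h
  -- the difference of the two logarithms is locally constant
  have hloc : ∀ t₀ ∈ Icc (0 : ℝ) 1, ∀ᶠ t in 𝓝[Icc 0 1] t₀, H t - θ t = H t₀ - θ t₀ := by
    intro t₀ ht₀
    obtain ⟨ε, hε, hball⟩ := Metric.continuousWithinAt_iff.1 (hγ t₀ ht₀) η hηpos
    obtain ⟨x, y, z, hvt⟩ : ∃ x y z, v t₀ = (x, y, z) := ⟨_, _, _, rfl⟩
    have hd0 := hv t₀ ht₀
    rw [hvt] at hd0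
    have hnear : ∀ t ∈ Icc (0 : ℝ) 1 ∩ Metric.ball t₀ ε, dist (P x y z) (γ t) < 2 * η := by
      intro t ht
      have h1 := hball ht.1 ht.2
      rw [dist_comm] at h1
      linarith [dist_triangle (P x y z) (γ t₀) (γ t)]
    have ht₀' : t₀ ∈ Icc (0 : ℝ) 1 ∩ Metric.ball t₀ ε := ⟨ht₀, Metric.mem_ball_self hε⟩
    obtain ⟨hvc, hve⟩ := hvalF (P x y z) (hfar t₀ ht₀ x y z (hnear t₀ ht₀')).1
    have hmaps : ∀ t ∈ Icc (0 : ℝ) 1 ∩ Metric.ball t₀ ε, γ t ∈ Metric.ball (P x y z) (4 * η) \ Z :=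
      fun t ht => ⟨by rw [Metric.mem_ball']; linarith [hnear t ht], hγZ t ht.1⟩
    have hpre : IsPreconnected (Icc (0 : ℝ) 1 ∩ Metric.ball t₀ ε) := by
      rw [Real.ball_eq_Ioo]
      exact (ordConnected_Icc.inter ordConnected_Ioo).isPreconnected
    have hcont : ContinuousOn (fun t => G x y z t - θ t) (Icc (0 : ℝ) 1 ∩ Metric.ball t₀ ε) :=
      ((hvc.comp (hγ.mono inter_subset_left) hmaps).add continuousOn_const).sub
        (hθ.mono inter_subset_left)
    have hE : ∀ t ∈ Icc (0 : ℝ) 1 ∩ Metric.ball t₀ ε,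
        Complex.exp (G x y z t - θ t) = κ (P x y z) * Complex.exp (k x y z) := by
      intro t ht
      have hne : F (γ t) ≠ 0 := by rw [← hexp t ht.1]; exact Complex.exp_ne_zero _
      rw [Complex.exp_sub, Complex.exp_add, hve _ (hmaps t ht), hexp t ht.1]
      field_simp
    have hconst : ∀ t ∈ Icc (0 : ℝ) 1 ∩ Metric.ball t₀ ε,
        G x y z t - θ t = G x y z t₀ - θ t₀ := by
      intro t ht
      have := sub_eq_sub_of_exp_eq hpre hcont (continuousOn_const (c := G x y z t₀ - θ t₀))
        (fun s hs => by rw [hE s hs, hE t₀ ht₀']) ht ht₀'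
      simpa [sub_eq_zero] using this
    filter_upwards [inter_mem_nhdsWithin _ (Metric.ball_mem_nhds t₀ hε)] with t ht
    rw [hH t ht.1 x y z (hnear t ht), hH t₀ ht₀ x y z (hnear t₀ ht₀'), hconst t ht]
  have h01 : H 0 - θ 0 = H 1 - θ 1 := by
    refine isPreconnected_Icc.induction₂' (fun s t => H s - θ s = H t - θ t) (fun t ht => ?_)
      (fun _ _ _ _ _ _ => Eq.trans) (left_mem_Icc.2 (zero_le_one' ℝ))
      (right_mem_Icc.2 (zero_le_one' ℝ))
    filter_upwards [hloc t ht] with s hs using ⟨hs.symm, hs⟩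
  have hHe : H 0 = H 1 := by
    obtain ⟨x, y, z, h⟩ := hvert 0 (by simp)
    rw [hH 0 (by simp) x y z (by linarith), hH 1 (by simp) x y z (by rw [← hγ01]; linarith)]
    simp only [G, hγ01]
  linear_combination h01 - hHe

end core

end

/-! ### Convergence with all derivatives -/

section convergence

variable {Ω : Set (ℂ × ℂ)}

/-- `f ε → f₀` as `ε → 0⁺`, together with all derivatives of order at most `n`, locally uniformly
in the sense of continuous convergence. -/
def ConvTo (Ω : Set (ℂ × ℂ)) : ℕ → (ℝ → ℂ × ℂ → ℂ) → (ℂ × ℂ → ℂ) → Prop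
  | 0, f, f₀ => ∀ u ∈ Ω,
      Tendsto (fun q : ℝ × (ℂ × ℂ) => f q.1 q.2) (𝓝[>] 0 ×ˢ 𝓝 u) (𝓝 (f₀ u))
  | n + 1, f, f₀ => (∀ u ∈ Ω,
      Tendsto (fun q : ℝ × (ℂ × ℂ) => f q.1 q.2) (𝓝[>] 0 ×ˢ 𝓝 u) (𝓝 (f₀ u))) ∧
      ∀ v, ConvTo Ω n (fun ε p => fderiv ℝ (f ε) p v) (fun p => fderiv ℝ f₀ p v)

theorem ConvTo.tendsto {n : ℕ} {f : ℝ → ℂ × ℂ → ℂ} {f₀ : ℂ × ℂ → ℂ} (h : ConvTo Ω n f f₀)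
    {u : ℂ × ℂ} (hu : u ∈ Ω) :
    Tendsto (fun q : ℝ × (ℂ × ℂ) => f q.1 q.2) (𝓝[>] 0 ×ˢ 𝓝 u) (𝓝 (f₀ u)) := by
  cases n with
  | zero => exact h u hu
  | succ n => exact h.1 u hu

theorem ConvTo.congr (hΩ : IsOpen Ω) {n : ℕ} {f g : ℝ → ℂ × ℂ → ℂ} {f₀ g₀ : ℂ × ℂ → ℂ}
    (h : ConvTo Ω n f f₀) (hfg : ∀ᶠ ε in 𝓝[>] 0, EqOn (f ε) (g ε) Ω) (h₀ : EqOn f₀ g₀ Ω) :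
    ConvTo Ω n g g₀ := by
  induction n generalizing f g f₀ g₀ with
  | zero =>
    intro u hu
    rw [← h₀ hu]
    refine (h u hu).congr' ?_
    filter_upwards [hfg.prod_mk (hΩ.mem_nhds hu)] with q hq using hq.1 hq.2
  | succ n ih =>
    refine ⟨fun u hu => ?_, fun v => ih (h.2 v) ?_ ?_⟩
    · rw [← h₀ hu]
      refine (h.1 u hu).congr' ?_
      filter_upwards [hfg.prod_mk (hΩ.mem_nhds hu)] with q hq using hq.1 hq.2
    · filter_upwards [hfg] with ε hε p hp
      change fderiv ℝ (f ε) p v = fderiv ℝ (g ε) p v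
      rw [(hε.eventuallyEq_of_mem (hΩ.mem_nhds hp)).fderiv_eq]
    · intro p hp
      change fderiv ℝ f₀ p v = fderiv ℝ g₀ p v
      rw [(h₀.eventuallyEq_of_mem (hΩ.mem_nhds hp)).fderiv_eq]

/-- Convergence of smooth functions on `Ω` together with all derivatives. -/
structure SmoothConv (Ω : Set (ℂ × ℂ)) (f : ℝ → ℂ × ℂ → ℂ) (f₀ : ℂ × ℂ → ℂ) : Prop where
  smooth : ∀ᶠ ε in 𝓝[>] (0 : ℝ), ContDiffOn ℝ ∞ (f ε) Ω
  smooth₀ : ContDiffOn ℝ ∞ f₀ Ω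
  conv : ∀ n, ConvTo Ω n f f₀

theorem SmoothConv.tendsto {f : ℝ → ℂ × ℂ → ℂ} {f₀ : ℂ × ℂ → ℂ} (h : SmoothConv Ω f f₀)
    {u : ℂ × ℂ} (hu : u ∈ Ω) :
    Tendsto (fun q : ℝ × (ℂ × ℂ) => f q.1 q.2) (𝓝[>] 0 ×ˢ 𝓝 u) (𝓝 (f₀ u)) :=
  h.conv 0 u hu

theorem SmoothConv.congr (hΩ : IsOpen Ω) {f g : ℝ → ℂ × ℂ → ℂ} {f₀ g₀ : ℂ × ℂ → ℂ}
    (h : SmoothConv Ω f f₀) (hfg : ∀ᶠ ε in 𝓝[>] 0, EqOn (f ε) (g ε) Ω) (h₀ : EqOn f₀ g₀ Ω) :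
    SmoothConv Ω g g₀ := by
  refine ⟨?_, h.smooth₀.congr h₀.symm, fun n => (h.conv n).congr hΩ hfg h₀⟩
  filter_upwards [h.smooth, hfg] with ε h1 h2 using h1.congr h2.symm

theorem contDiffOn_fderiv_apply (hΩ : IsOpen Ω) {m : WithTop ℕ∞} (hm : m + 1 ≤ m) {f : ℂ × ℂ → ℂ}
    (hf : ContDiffOn ℝ m f Ω) (v : ℂ × ℂ) : ContDiffOn ℝ m (fun p => fderiv ℝ f p v) Ω :=
  (hf.fderiv_of_isOpen hΩ hm).clm_apply contDiffOn_const

theorem infty_add_one_le : (∞ : WithTop ℕ∞) + 1 ≤ ∞ := le_of_eq (by rfl)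

theorem SmoothConv.fderiv (hΩ : IsOpen Ω) {f : ℝ → ℂ × ℂ → ℂ} {f₀ : ℂ × ℂ → ℂ}
    (h : SmoothConv Ω f f₀) (v : ℂ × ℂ) :
    SmoothConv Ω (fun ε p => fderiv ℝ (f ε) p v) (fun p => fderiv ℝ f₀ p v) := by
  refine ⟨?_, contDiffOn_fderiv_apply hΩ infty_add_one_le h.smooth₀ v, fun n => (h.conv (n + 1)).2 v⟩
  filter_upwards [h.smooth] with ε hε using contDiffOn_fderiv_apply hΩ infty_add_one_le hε v

theorem _root_.ContDiffOn.differentiableAt_of_isOpen (hΩ : IsOpen Ω) {f : ℂ × ℂ → ℂ}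
    (hf : ContDiffOn ℝ ∞ f Ω) {p : ℂ × ℂ} (hp : p ∈ Ω) : DifferentiableAt ℝ f p :=
  (hf.contDiffAt (hΩ.mem_nhds hp)).differentiableAt (by simp)

theorem ConvTo.add (hΩ : IsOpen Ω) {n : ℕ} {f g : ℝ → ℂ × ℂ → ℂ} {f₀ g₀ : ℂ × ℂ → ℂ}
    (hf : ConvTo Ω n f f₀) (hg : ConvTo Ω n g g₀)
    (hfs : ∀ᶠ ε in 𝓝[>] (0 : ℝ), ContDiffOn ℝ ∞ (f ε) Ω) (hfs₀ : ContDiffOn ℝ ∞ f₀ Ω)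
    (hgs : ∀ᶠ ε in 𝓝[>] (0 : ℝ), ContDiffOn ℝ ∞ (g ε) Ω) (hgs₀ : ContDiffOn ℝ ∞ g₀ Ω) :
    ConvTo Ω n (fun ε p => f ε p + g ε p) (fun p => f₀ p + g₀ p) := by
  induction n generalizing f g f₀ g₀ with
  | zero => exact fun u hu => (hf.tendsto hu).add (hg.tendsto hu)
  | succ n ih =>
    refine ⟨fun u hu => (hf.tendsto hu).add (hg.tendsto hu), fun v => ?_⟩
    refine (ih (hf.2 v) (hg.2 v) ?_ (contDiffOn_fderiv_apply hΩ infty_add_one_le hfs₀ v) ?_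
      (contDiffOn_fderiv_apply hΩ infty_add_one_le hgs₀ v)).congr hΩ ?_ ?_
    · filter_upwards [hfs] with ε hε using contDiffOn_fderiv_apply hΩ infty_add_one_le hε v
    · filter_upwards [hgs] with ε hε using contDiffOn_fderiv_apply hΩ infty_add_one_le hε v
    · filter_upwards [hfs, hgs] with ε h1 h2 p hp
      beta_reduce
      rw [fderiv_fun_add (h1.differentiableAt_of_isOpen hΩ hp)
        (h2.differentiableAt_of_isOpen hΩ hp), add_apply]
    · intro p hp
      beta_reduce
      rw [fderiv_fun_add (hfs₀.differentiableAt_of_isOpen hΩ hp)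
        (hgs₀.differentiableAt_of_isOpen hΩ hp), add_apply]

theorem SmoothConv.add (hΩ : IsOpen Ω) {f g : ℝ → ℂ × ℂ → ℂ} {f₀ g₀ : ℂ × ℂ → ℂ}
    (hf : SmoothConv Ω f f₀) (hg : SmoothConv Ω g g₀) :
    SmoothConv Ω (fun ε p => f ε p + g ε p) (fun p => f₀ p + g₀ p) := by
  refine ⟨?_, hf.smooth₀.add hg.smooth₀, fun n =>
    (hf.conv n).add hΩ (hg.conv n) hf.smooth hf.smooth₀ hg.smooth hg.smooth₀⟩
  filter_upwards [hf.smooth, hg.smooth] with ε h1 h2 using h1.add h2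

theorem SmoothConv.mul (hΩ : IsOpen Ω) {f g : ℝ → ℂ × ℂ → ℂ} {f₀ g₀ : ℂ × ℂ → ℂ}
    (hf : SmoothConv Ω f f₀) (hg : SmoothConv Ω g g₀) :
    SmoothConv Ω (fun ε p => f ε p * g ε p) (fun p => f₀ p * g₀ p) := by
  refine ⟨?_, hf.smooth₀.mul hg.smooth₀, fun n => ?_⟩
  · filter_upwards [hf.smooth, hg.smooth] with ε h1 h2 using h1.mul h2
  induction n generalizing f g f₀ g₀ with
  | zero => exact fun u hu => (hf.tendsto hu).mul (hg.tendsto hu)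
  | succ n ih =>
    refine ⟨fun u hu => (hf.tendsto hu).mul (hg.tendsto hu), fun v => ?_⟩
    have hf' := hf.fderiv hΩ v
    have hg' := hg.fderiv hΩ v
    refine ((ih hf hg').add hΩ (ih hg hf') ?_ (hf.smooth₀.mul hg'.smooth₀) ?_
      (hg.smooth₀.mul hf'.smooth₀)).congr hΩ ?_ ?_
    · filter_upwards [hf.smooth, hg'.smooth] with ε h1 h2 using h1.mul h2
    · filter_upwards [hg.smooth, hf'.smooth] with ε h1 h2 using h1.mul h2
    · filter_upwards [hf.smooth, hg.smooth] with ε h1 h2 p hp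
      beta_reduce
      rw [fderiv_fun_mul (h1.differentiableAt_of_isOpen hΩ hp)
        (h2.differentiableAt_of_isOpen hΩ hp)]
      simp
    · intro p hp
      beta_reduce
      rw [fderiv_fun_mul (hf.smooth₀.differentiableAt_of_isOpen hΩ hp)
        (hg.smooth₀.differentiableAt_of_isOpen hΩ hp)]
      simp

theorem SmoothConv.const {f₀ : ℂ × ℂ → ℂ} (hΩ : IsOpen Ω) (h : ContDiffOn ℝ ∞ f₀ Ω) :
    SmoothConv Ω (fun _ => f₀) f₀ := by
  refine ⟨Eventually.of_forall fun _ => h, h, fun n => ?_⟩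
  have h1 : ∀ {g : ℂ × ℂ → ℂ}, ContDiffOn ℝ ∞ g Ω → ∀ u ∈ Ω,
      Tendsto (fun q : ℝ × (ℂ × ℂ) => g q.2) (𝓝[>] 0 ×ˢ 𝓝 u) (𝓝 (g u)) := fun hg u hu =>
    ((hg.differentiableAt_of_isOpen hΩ hu).continuousAt.tendsto).comp tendsto_snd
  induction n generalizing f₀ with
  | zero => exact h1 h
  | succ n ih => exact ⟨h1 h, fun v => ih (contDiffOn_fderiv_apply hΩ infty_add_one_le h v)⟩

theorem SmoothConv.eps : SmoothConv Ω (fun ε _ => (ε : ℂ)) (fun _ => 0) := by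
  refine ⟨Eventually.of_forall fun _ => contDiffOn_const, contDiffOn_const, fun n => ?_⟩
  have h1 : ∀ u ∈ Ω, Tendsto (fun q : ℝ × (ℂ × ℂ) => (q.1 : ℂ)) (𝓝[>] 0 ×ˢ 𝓝 u) (𝓝 0) := by
    intro u hu
    have h2 : Tendsto (fun ε : ℝ => (ε : ℂ)) (𝓝[>] 0) (𝓝 0) := by
      have := (Complex.continuous_ofReal.tendsto 0).mono_left (nhdsWithin_le_nhds (s := Ioi 0))
      simpa using this
    exact h2.comp tendsto_fst
  have h0 : ∀ n, ConvTo Ω n (fun _ _ => 0) (fun _ => 0) := by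
    intro n
    induction n with
    | zero => exact fun u _ => tendsto_const_nhds
    | succ n ih => exact ⟨fun u _ => tendsto_const_nhds, fun v => by simpa using ih⟩
  cases n with
  | zero => exact h1
  | succ n => exact ⟨h1, fun v => by simpa using h0 n⟩

theorem SmoothConv.const_mul (hΩ : IsOpen Ω) {f : ℝ → ℂ × ℂ → ℂ} {f₀ : ℂ × ℂ → ℂ} (c : ℂ)
    (hf : SmoothConv Ω f f₀) : SmoothConv Ω (fun ε p => c * f ε p) (fun p => c * f₀ p) :=
  (SmoothConv.const hΩ contDiffOn_const).mul hΩ hf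

theorem SmoothConv.pow (hΩ : IsOpen Ω) {f : ℝ → ℂ × ℂ → ℂ} {f₀ : ℂ × ℂ → ℂ}
    (hf : SmoothConv Ω f f₀) (n : ℕ) : SmoothConv Ω (fun ε p => f ε p ^ n) (fun p => f₀ p ^ n) := by
  induction n with
  | zero => simpa using SmoothConv.const hΩ (f₀ := fun _ => 1) contDiffOn_const
  | succ n ih => simpa only [pow_succ] using ih.mul hΩ hf

theorem SmoothConv.sub (hΩ : IsOpen Ω) {f g : ℝ → ℂ × ℂ → ℂ} {f₀ g₀ : ℂ × ℂ → ℂ}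
    (hf : SmoothConv Ω f f₀) (hg : SmoothConv Ω g g₀) :
    SmoothConv Ω (fun ε p => f ε p - g ε p) (fun p => f₀ p - g₀ p) := by
  simpa [sub_eq_add_neg] using hf.add hΩ (hg.const_mul hΩ (-1))

theorem SmoothConv.dz (hΩ : IsOpen Ω) {f : ℝ → ℂ × ℂ → ℂ} {f₀ : ℂ × ℂ → ℂ}
    (hf : SmoothConv Ω f f₀) : SmoothConv Ω (fun ε => dz (f ε)) (dz f₀) :=
  ((hf.fderiv hΩ _).sub hΩ ((hf.fderiv hΩ _).const_mul hΩ _)).const_mul hΩ _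

theorem SmoothConv.dw (hΩ : IsOpen Ω) {f : ℝ → ℂ × ℂ → ℂ} {f₀ : ℂ × ℂ → ℂ}
    (hf : SmoothConv Ω f f₀) : SmoothConv Ω (fun ε => dw (f ε)) (dw f₀) :=
  ((hf.fderiv hΩ _).sub hΩ ((hf.fderiv hΩ _).const_mul hΩ _)).const_mul hΩ _

theorem SmoothConv.dzbar (hΩ : IsOpen Ω) {f : ℝ → ℂ × ℂ → ℂ} {f₀ : ℂ × ℂ → ℂ}
    (hf : SmoothConv Ω f f₀) : SmoothConv Ω (fun ε => dzbar (f ε)) (dzbar f₀) :=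
  ((hf.fderiv hΩ _).add hΩ ((hf.fderiv hΩ _).const_mul hΩ _)).const_mul hΩ _

theorem SmoothConv.dwbar (hΩ : IsOpen Ω) {f : ℝ → ℂ × ℂ → ℂ} {f₀ : ℂ × ℂ → ℂ}
    (hf : SmoothConv Ω f f₀) : SmoothConv Ω (fun ε => dwbar (f ε)) (dwbar f₀) :=
  ((hf.fderiv hΩ _).add hΩ ((hf.fderiv hΩ _).const_mul hΩ _)).const_mul hΩ _

section tensor

variable {r : ℝ → ℂ × ℂ → ℝ} {r₀ : ℂ × ℂ → ℝ}

theorem SmoothConv.Lbar (hΩ : IsOpen Ω) (hr : SmoothConv Ω (fun ε => toC (r ε)) (toC r₀))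
    {f : ℝ → ℂ × ℂ → ℂ} {f₀ : ℂ × ℂ → ℂ} (hf : SmoothConv Ω f f₀) :
    SmoothConv Ω (fun ε => Lbar (r ε) (f ε)) (Lbar r₀ f₀) := by
  have h := (((hr.dwbar hΩ).const_mul hΩ (-1)).mul hΩ (hf.dzbar hΩ)).add hΩ
    ((hr.dzbar hΩ).mul hΩ (hf.dwbar hΩ))
  refine h.congr hΩ (Eventually.of_forall fun ε p _ => ?_) fun p _ => ?_ <;>
  simp [CRUmbilic.Lbar]

theorem SmoothConv.iterate_Lbar (hΩ : IsOpen Ω)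
    (hr : SmoothConv Ω (fun ε => toC (r ε)) (toC r₀))
    {f : ℝ → ℂ × ℂ → ℂ} {f₀ : ℂ × ℂ → ℂ} (hf : SmoothConv Ω f f₀) (n : ℕ) :
    SmoothConv Ω (fun ε => (CRUmbilic.Lbar (r ε))^[n] (f ε)) ((CRUmbilic.Lbar r₀)^[n] f₀) := by
  induction n generalizing f f₀ with
  | zero => exact hf
  | succ n ih => exact ih (SmoothConv.Lbar hΩ hr hf)

theorem SmoothConv.holHessLL {s : ℝ → ℂ × ℂ → ℝ} {s₀ : ℂ × ℂ → ℝ} (hΩ : IsOpen Ω)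
    (hr : SmoothConv Ω (fun ε => toC (r ε)) (toC r₀))
    (hs : SmoothConv Ω (fun ε => toC (s ε)) (toC s₀)) :
    SmoothConv Ω (fun ε => holHessLL (s ε) (r ε)) (holHessLL s₀ r₀) :=
  ((((hs.dz hΩ).dz hΩ).mul hΩ ((hr.dw hΩ).pow hΩ 2)).sub hΩ
    ((((hs.dz hΩ).dw hΩ).const_mul hΩ 2).mul hΩ ((hr.dz hΩ).mul hΩ (hr.dw hΩ)))).add hΩ
    (((hs.dw hΩ).dw hΩ).mul hΩ ((hr.dz hΩ).pow hΩ 2))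

end tensor

end convergence

section perturbation

variable {Ω : Set (ℂ × ℂ)}

theorem fderiv_ofReal_const_mul {f : ℂ × ℂ → ℝ} {p : ℂ × ℂ} (h : DifferentiableAt ℝ f p) (c : ℝ)
    (v : ℂ × ℂ) :
    fderiv ℝ (fun p => ((c * f p : ℝ) : ℂ)) p v = ((c * fderiv ℝ f p v : ℝ) : ℂ) := by
  have h1 : HasFDerivAt (fun p => ((c * f p : ℝ) : ℂ)) _ p :=
    Complex.ofRealCLM.hasFDerivAt.comp p (h.hasFDerivAt.const_mul c)
  rw [h1.fderiv]
  simp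

/-- A remainder that is `O(ε²)` with all derivatives, uniformly on compact sets, is `o(ε)` in the
sense of `SmoothConv`. -/
theorem smoothConv_of_iteratedFDeriv_le (hΩ : IsOpen Ω) {r : ℝ → ℂ × ℂ → ℝ}
    (hr : ∀ᶠ ε in 𝓝[>] (0 : ℝ), ContDiffOn ℝ ∞ (r ε) Ω)
    (hb : ∀ (k : ℕ) (K : Set (ℂ × ℂ)), IsCompact K → K ⊆ Ω →
      ∃ C : ℝ, ∀ᶠ ε in 𝓝[>] (0 : ℝ), ∀ p ∈ K, ‖iteratedFDeriv ℝ k (r ε) p‖ ≤ C * ε ^ 2) :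
    SmoothConv Ω (fun ε p => ((ε⁻¹ * r ε p : ℝ) : ℂ)) (fun _ => 0) := by
  refine ⟨?_, contDiffOn_const, fun n => ?_⟩
  · filter_upwards [hr] with ε hε
    exact Complex.ofRealCLM.contDiff.comp_contDiffOn (contDiffOn_const.mul hε)
  have hlim : ∀ {r : ℝ → ℂ × ℂ → ℝ}, (∀ (k : ℕ) (K : Set (ℂ × ℂ)), IsCompact K → K ⊆ Ω →
      ∃ C : ℝ, ∀ᶠ ε in 𝓝[>] (0 : ℝ), ∀ p ∈ K, ‖iteratedFDeriv ℝ k (r ε) p‖ ≤ C * ε ^ 2) →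
      ∀ u ∈ Ω, Tendsto (fun q : ℝ × (ℂ × ℂ) => ((q.1⁻¹ * r q.1 q.2 : ℝ) : ℂ))
        (𝓝[>] 0 ×ˢ 𝓝 u) (𝓝 0) := by
    intro r hb u hu
    obtain ⟨K, hKu, hKΩ, hK⟩ := local_compact_nhds (hΩ.mem_nhds hu)
    obtain ⟨C, hC⟩ := hb 0 K hK hKΩ
    have h1 : Tendsto (fun q : ℝ × (ℂ × ℂ) => C * q.1) (𝓝[>] 0 ×ˢ 𝓝 u) (𝓝 0) := by
      have h2 : Tendsto (fun ε : ℝ => C * ε) (𝓝[>] 0) (𝓝 (C * 0)) :=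
        ((continuous_const.mul continuous_id).tendsto 0).mono_left nhdsWithin_le_nhds
      rw [mul_zero] at h2
      exact h2.comp tendsto_fst
    refine squeeze_zero_norm' ?_ h1
    filter_upwards [(hC.and self_mem_nhdsWithin).prod_mk hKu] with q hq
    have hq0 : 0 < q.1 := hq.1.2
    have h3 := hq.1.1 q.2 hq.2
    rw [norm_iteratedFDeriv_zero, Real.norm_eq_abs] at h3
    rw [Complex.norm_real, Real.norm_eq_abs, abs_mul, abs_of_pos (inv_pos.2 hq0)]
    calc q.1⁻¹ * |r q.1 q.2| ≤ q.1⁻¹ * (C * q.1 ^ 2) := by gcongr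
      _ = C * q.1 := by field_simp
  induction n generalizing r with
  | zero => exact hlim hb
  | succ n ih =>
    refine ⟨hlim hb, fun v => ?_⟩
    refine (ih (r := fun ε p => fderiv ℝ (r ε) p v) ?_ ?_).congr hΩ ?_ ?_
    · filter_upwards [hr] with ε hε
      exact (hε.fderiv_of_isOpen hΩ infty_add_one_le).clm_apply contDiffOn_const
    · intro k K hK hKΩ
      obtain ⟨C, hC⟩ := hb (k + 1) K hK hKΩ
      refine ⟨‖v‖ * C, ?_⟩
      filter_upwards [hC, hr] with ε h1 h2 p hp
      have h3 : ContDiffAt ℝ ∞ (fderiv ℝ (r ε)) p :=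
        (h2.fderiv_of_isOpen hΩ infty_add_one_le).contDiffAt (hΩ.mem_nhds (hKΩ hp))
      calc _ ≤ ‖v‖ * ‖iteratedFDeriv ℝ k (fderiv ℝ (r ε)) p‖ :=
            norm_iteratedFDeriv_clm_apply_const h3 (by exact_mod_cast le_top)
        _ ≤ ‖v‖ * (C * ε ^ 2) := by
            rw [norm_iteratedFDeriv_fderiv]
            gcongr
            exact h1 p hp
        _ = ‖v‖ * C * ε ^ 2 := by ring
    · filter_upwards [hr] with ε hε p hp
      have h4 : DifferentiableAt ℝ (r ε) p :=
        (hε.contDiffAt (hΩ.mem_nhds hp)).differentiableAt (by simp)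
      exact (fderiv_ofReal_const_mul h4 _ v).symm
    · intro p _
      simp

theorem contDiff_rho0 {n : WithTop ℕ∞} : ContDiff ℝ n rho0 := by
  unfold rho0
  exact ((contDiff_fst.norm_sq ℝ).add (contDiff_snd.norm_sq ℝ)).sub contDiff_const

theorem contDiffOn_toC {n : WithTop ℕ∞} {f : ℂ × ℂ → ℝ} (h : ContDiffOn ℝ n f Ω) :
    ContDiffOn ℝ n (toC f) Ω :=
  Complex.ofRealCLM.contDiff.comp_contDiffOn h

/-- The difference quotients `(ρ^ε - ρ⁰) / ε` converge to `ρ'` with all derivatives. -/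
theorem IsSpherePerturbation.smoothConv_quotient (hΩ : IsOpen Ω) {ρ : ℝ → ℂ × ℂ → ℝ}
    {ρ' : ℂ × ℂ → ℝ} (h : IsSpherePerturbation Ω ρ ρ') :
    SmoothConv Ω (fun ε => toC fun p => ε⁻¹ * (ρ ε p - rho0 p)) (toC ρ') := by
  obtain ⟨h1, h2, h3⟩ := h
  have h4 := smoothConv_of_iteratedFDeriv_le hΩ (r := fun ε q => ρ ε q - rho0 q - ε * ρ' q) (by
    filter_upwards [h2] with ε hε
    exact (hε.sub contDiff_rho0.contDiffOn).sub (contDiffOn_const.mul h1)) h3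
  refine ((SmoothConv.const hΩ (contDiffOn_toC h1)).add hΩ h4).congr hΩ ?_ fun p _ => by simp
  filter_upwards [self_mem_nhdsWithin] with ε hε p _
  have hε0 : (ε : ℂ) ≠ 0 := Complex.ofReal_ne_zero.2 (ne_of_gt hε)
  simp only [toC]
  push_cast
  field_simp
  ring

theorem IsSpherePerturbation.smoothConv (hΩ : IsOpen Ω) {ρ : ℝ → ℂ × ℂ → ℝ}
    {ρ' : ℂ × ℂ → ℝ} (h : IsSpherePerturbation Ω ρ ρ') :
    SmoothConv Ω (fun ε => toC (ρ ε)) (toC rho0) := by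
  refine ((SmoothConv.const hΩ (contDiffOn_toC contDiff_rho0.contDiffOn)).add hΩ
    (SmoothConv.eps.mul hΩ (h.smoothConv_quotient hΩ))).congr hΩ ?_ fun p _ => by simp
  filter_upwards [self_mem_nhdsWithin] with ε hε p _
  have hε0 : (ε : ℂ) ≠ 0 := Complex.ofReal_ne_zero.2 (ne_of_gt hε)
  simp only [toC]
  push_cast
  field_simp
  ring

end perturbation

section wirtinger

variable {f g : ℂ × ℂ → ℂ} {p : ℂ × ℂ}

theorem wirtinger_mul (hf : DifferentiableAt ℝ f p) (hg : DifferentiableAt ℝ g p) :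
    dz (fun p => f p * g p) p = dz f p * g p + f p * dz g p ∧
    dw (fun p => f p * g p) p = dw f p * g p + f p * dw g p ∧
    dzbar (fun p => f p * g p) p = dzbar f p * g p + f p * dzbar g p ∧
    dwbar (fun p => f p * g p) p = dwbar f p * g p + f p * dwbar g p := by
  simp only [dz, dw, dzbar, dwbar, fderiv_fun_mul hf hg, add_apply, smul_apply, smul_eq_mul]
  refine ⟨?_, ?_, ?_, ?_⟩ <;> ring

theorem wirtinger_add (hf : DifferentiableAt ℝ f p) (hg : DifferentiableAt ℝ g p) :
    dz (fun p => f p + g p) p = dz f p + dz g p ∧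
    dw (fun p => f p + g p) p = dw f p + dw g p ∧
    dzbar (fun p => f p + g p) p = dzbar f p + dzbar g p ∧
    dwbar (fun p => f p + g p) p = dwbar f p + dwbar g p := by
  simp only [dz, dw, dzbar, dwbar, fderiv_fun_add hf hg, add_apply]
  refine ⟨?_, ?_, ?_, ?_⟩ <;> ring

theorem wirtinger_const (c : ℂ) (p : ℂ × ℂ) :
    dz (fun _ => c) p = 0 ∧ dw (fun _ => c) p = 0 ∧ dzbar (fun _ => c) p = 0 ∧
    dwbar (fun _ => c) p = 0 := by
  simp [dz, dw, dzbar, dwbar]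

theorem wirtinger_const_mul (hf : DifferentiableAt ℝ f p) (c : ℂ) :
    dz (fun p => c * f p) p = c * dz f p ∧ dw (fun p => c * f p) p = c * dw f p ∧
    dzbar (fun p => c * f p) p = c * dzbar f p ∧ dwbar (fun p => c * f p) p = c * dwbar f p := by
  have h := wirtinger_mul (differentiableAt_const c) hf
  simpa [wirtinger_const c p] using h

theorem wirtinger_congr (h : f =ᶠ[𝓝 p] g) :
    dz f p = dz g p ∧ dw f p = dw g p ∧ dzbar f p = dzbar g p ∧ dwbar f p = dwbar g p := by
  simp [dz, dw, dzbar, dwbar, h.fderiv_eq]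

theorem wirtinger_of_clm (L : ℂ × ℂ →L[ℝ] ℂ) (p : ℂ × ℂ) :
    dz L p = (1 / 2) * (L (1, 0) - Complex.I * L (Complex.I, 0)) ∧
    dw L p = (1 / 2) * (L (0, 1) - Complex.I * L (0, Complex.I)) ∧
    dzbar L p = (1 / 2) * (L (1, 0) + Complex.I * L (Complex.I, 0)) ∧
    dwbar L p = (1 / 2) * (L (0, 1) + Complex.I * L (0, Complex.I)) := by
  simp [dz, dw, dzbar, dwbar]

theorem wirtinger_fst (p : ℂ × ℂ) : dz (fun p => p.1) p = 1 ∧ dw (fun p => p.1) p = 0 ∧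
    dzbar (fun p => p.1) p = 0 ∧ dwbar (fun p => p.1) p = 0 := by
  have h := wirtinger_of_clm (ContinuousLinearMap.fst ℝ ℂ ℂ) p
  simp only [ContinuousLinearMap.coe_fst', Complex.I_mul_I] at h
  norm_num at h
  exact h

theorem wirtinger_snd (p : ℂ × ℂ) : dz (fun p => p.2) p = 0 ∧ dw (fun p => p.2) p = 1 ∧
    dzbar (fun p => p.2) p = 0 ∧ dwbar (fun p => p.2) p = 0 := by
  have h := wirtinger_of_clm (ContinuousLinearMap.snd ℝ ℂ ℂ) p
  simp only [ContinuousLinearMap.coe_snd', Complex.I_mul_I] at h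
  norm_num at h
  exact h

theorem wirtinger_conj_fst (p : ℂ × ℂ) : dz (fun p => starRingEnd ℂ p.1) p = 0 ∧
    dw (fun p => starRingEnd ℂ p.1) p = 0 ∧ dzbar (fun p => starRingEnd ℂ p.1) p = 1 ∧
    dwbar (fun p => starRingEnd ℂ p.1) p = 0 := by
  have h := wirtinger_of_clm ((Complex.conjCLE : ℂ →L[ℝ] ℂ).comp (ContinuousLinearMap.fst ℝ ℂ ℂ)) p
  have e : ⇑((Complex.conjCLE : ℂ →L[ℝ] ℂ).comp (ContinuousLinearMap.fst ℝ ℂ ℂ)) =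
    fun p => starRingEnd ℂ p.1 := by ext; simp
  simp only [e, Complex.conj_I, mul_neg, Complex.I_mul_I] at h
  norm_num at h
  exact h

theorem wirtinger_conj_snd (p : ℂ × ℂ) : dz (fun p => starRingEnd ℂ p.2) p = 0 ∧
    dw (fun p => starRingEnd ℂ p.2) p = 0 ∧ dzbar (fun p => starRingEnd ℂ p.2) p = 0 ∧
    dwbar (fun p => starRingEnd ℂ p.2) p = 1 := by
  have h := wirtinger_of_clm ((Complex.conjCLE : ℂ →L[ℝ] ℂ).comp (ContinuousLinearMap.snd ℝ ℂ ℂ)) p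
  have e : ⇑((Complex.conjCLE : ℂ →L[ℝ] ℂ).comp (ContinuousLinearMap.snd ℝ ℂ ℂ)) =
    fun p => starRingEnd ℂ p.2 := by ext; simp
  simp only [e, Complex.conj_I, mul_neg, Complex.I_mul_I] at h
  norm_num at h
  exact h

theorem differentiable_conj_fst : Differentiable ℝ fun p : ℂ × ℂ => starRingEnd ℂ p.1 :=
  ((Complex.conjCLE : ℂ →L[ℝ] ℂ).comp (ContinuousLinearMap.fst ℝ ℂ ℂ)).differentiable

theorem differentiable_conj_snd : Differentiable ℝ fun p : ℂ × ℂ => starRingEnd ℂ p.2 :=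
  ((Complex.conjCLE : ℂ →L[ℝ] ℂ).comp (ContinuousLinearMap.snd ℝ ℂ ℂ)).differentiable

theorem toC_rho0 : toC rho0 = fun p => p.1 * starRingEnd ℂ p.1 +
    (p.2 * starRingEnd ℂ p.2 + (-1 : ℂ)) := by
  ext p
  simp only [toC, rho0, Complex.mul_conj, Complex.normSq_eq_norm_sq]
  push_cast
  ring

theorem wirtinger_rho0 : dz (toC rho0) = (fun p => starRingEnd ℂ p.1) ∧
    dw (toC rho0) = (fun p => starRingEnd ℂ p.2) ∧ dzbar (toC rho0) = (fun p => p.1) ∧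
    dwbar (toC rho0) = fun p => p.2 := by
  have key : ∀ p, dz (toC rho0) p = starRingEnd ℂ p.1 ∧ dw (toC rho0) p = starRingEnd ℂ p.2 ∧
      dzbar (toC rho0) p = p.1 ∧ dwbar (toC rho0) p = p.2 := by
    intro p
    have h1 : DifferentiableAt ℝ (fun p : ℂ × ℂ => starRingEnd ℂ p.1) p := differentiable_conj_fst p
    have h2 : DifferentiableAt ℝ (fun p : ℂ × ℂ => starRingEnd ℂ p.2) p := differentiable_conj_snd p
    have m1 := wirtinger_mul differentiableAt_fst h1
    have m2 := wirtinger_mul differentiableAt_snd h2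
    have a2 := wirtinger_add (differentiableAt_snd.fun_mul h2) (differentiableAt_const (-1 : ℂ))
    have a1 := wirtinger_add (differentiableAt_fst.fun_mul h1)
      ((differentiableAt_snd.fun_mul h2).fun_add (differentiableAt_const (-1 : ℂ)))
    rw [toC_rho0]
    simp [a1, a2, m1, m2, wirtinger_fst, wirtinger_snd, wirtinger_conj_fst, wirtinger_conj_snd,
      wirtinger_const]
  exact ⟨funext fun p => (key p).1, funext fun p => (key p).2.1, funext fun p => (key p).2.2.1,
    funext fun p => (key p).2.2.2⟩

end wirtinger

/-! ### The umbilical tensor to first order at the sphere -/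

section sphere

/-- `f` is differentiable, and the tangential field `L̄₀` of the sphere maps it to `g`. -/
def HasLbarSphere (f g : ℂ × ℂ → ℂ) : Prop :=
  Differentiable ℝ f ∧ ∀ p, Lbar rho0 f p = g p

theorem Lbar_rho0 (f : ℂ × ℂ → ℂ) (p : ℂ × ℂ) :
    Lbar rho0 f p = -p.2 * dzbar f p + p.1 * dwbar f p := by
  rw [Lbar, wirtinger_rho0.2.2.1, wirtinger_rho0.2.2.2]

namespace HasLbarSphere

variable {f g f' g' : ℂ × ℂ → ℂ}

theorem eq (h : HasLbarSphere f g) : Lbar rho0 f = g := funext h.2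

theorem mul (hf : HasLbarSphere f f') (hg : HasLbarSphere g g') :
    HasLbarSphere (fun p => f p * g p) (fun p => f' p * g p + f p * g' p) := by
  refine ⟨hf.1.mul hg.1, fun p => ?_⟩
  beta_reduce
  rw [← hf.2, ← hg.2, Lbar_rho0, Lbar_rho0, Lbar_rho0, (wirtinger_mul (hf.1 p) (hg.1 p)).2.2.1,
    (wirtinger_mul (hf.1 p) (hg.1 p)).2.2.2]
  ring

theorem add (hf : HasLbarSphere f f') (hg : HasLbarSphere g g') :
    HasLbarSphere (fun p => f p + g p) (fun p => f' p + g' p) := by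
  refine ⟨hf.1.add hg.1, fun p => ?_⟩
  beta_reduce
  rw [← hf.2, ← hg.2, Lbar_rho0, Lbar_rho0, Lbar_rho0, (wirtinger_add (hf.1 p) (hg.1 p)).2.2.1,
    (wirtinger_add (hf.1 p) (hg.1 p)).2.2.2]
  ring

theorem const (c : ℂ) : HasLbarSphere (fun _ => c) (fun _ => 0) :=
  ⟨differentiable_const c, fun p => by simp [Lbar_rho0, wirtinger_const]⟩

theorem fst : HasLbarSphere (fun p => p.1) (fun _ => 0) :=
  ⟨differentiable_fst, fun p => by simp [Lbar_rho0, wirtinger_fst]⟩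

theorem snd : HasLbarSphere (fun p => p.2) (fun _ => 0) :=
  ⟨differentiable_snd, fun p => by simp [Lbar_rho0, wirtinger_snd]⟩

theorem conj_fst : HasLbarSphere (fun p => starRingEnd ℂ p.1) (fun p => -p.2) :=
  ⟨differentiable_conj_fst, fun p => by simp [Lbar_rho0, wirtinger_conj_fst]⟩

theorem conj_snd : HasLbarSphere (fun p => starRingEnd ℂ p.2) (fun p => p.1) :=
  ⟨differentiable_conj_snd, fun p => by simp [Lbar_rho0, wirtinger_conj_snd]⟩

theorem congr (h : HasLbarSphere f g) (hf : ∀ p, f' p = f p) (hg : ∀ p, g' p = g p) :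
    HasLbarSphere f' g' := by
  rwa [funext hf, funext hg]

end HasLbarSphere

open HasLbarSphere in
/-- `L̄₀^j (a b c)` for functions with `L̄₀² a = L̄₀² b = L̄₀² c = 0`. -/
theorem iterate_Lbar_rho0_mul_mul {a b c a' b' c' : ℂ × ℂ → ℂ} (ha : HasLbarSphere a a')
    (ha' : HasLbarSphere a' fun _ => 0) (hb : HasLbarSphere b b')
    (hb' : HasLbarSphere b' fun _ => 0) (hc : HasLbarSphere c c')
    (hc' : HasLbarSphere c' fun _ => 0) :
    let f : ℂ × ℂ → ℂ := fun p => a p * b p * c p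
    (Lbar rho0)^[1] f = (fun p => a' p * b p * c p + a p * b' p * c p + a p * b p * c' p) ∧
    (Lbar rho0)^[2] f = (fun p => 2 * (a' p * b' p * c p + a' p * b p * c' p + a p * b' p * c' p)) ∧
    (Lbar rho0)^[3] f = (fun p => 6 * (a' p * b' p * c' p)) ∧ (Lbar rho0)^[4] f = fun _ => 0 := by
  intro f
  have h1 : HasLbarSphere f _ := (ha.mul hb).mul hc
  have h2 := (((ha'.mul hb).mul hc).add ((ha.mul hb').mul hc)).add ((ha.mul hb).mul hc')
  have h3 := (const 2).mul ((((ha'.mul hb').mul hc).add ((ha'.mul hb).mul hc')).add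
    ((ha.mul hb').mul hc'))
  have h4 := (const 6).mul ((ha'.mul hb').mul hc')
  have e1 : (Lbar rho0)^[1] f =
      (fun p => a' p * b p * c p + a p * b' p * c p + a p * b p * c' p) := by
    rw [Function.iterate_one, h1.eq]
    ext p
    ring
  have e2 : (Lbar rho0)^[2] f =
      (fun p => 2 * (a' p * b' p * c p + a' p * b p * c' p + a p * b' p * c' p)) := by
    rw [Function.iterate_succ_apply', e1, h2.eq]
    ext p
    ring
  have e3 : (Lbar rho0)^[3] f = (fun p => 6 * (a' p * b' p * c' p)) := by
    rw [Function.iterate_succ_apply', e2, h3.eq]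
    ext p
    ring
  refine ⟨e1, e2, e3, ?_⟩
  rw [Function.iterate_succ_apply', e3, h4.eq]
  ext p
  ring

end sphere

section determinant

variable {Ω : Set (ℂ × ℂ)}

/-- The matrix `A₃(ρ)` with its last row computed from `σ` instead of `ρ`. -/
noncomputable def A3' (σ ρ : ℂ × ℂ → ℝ) (p : ℂ × ℂ) : Matrix (Fin 5) (Fin 5) ℂ :=
  Matrix.of fun i j => ((Lbar ρ)^[(j : ℕ)] ((![fun p => (dw (toC ρ) p) ^ 3,
    fun p => dz (toC ρ) p * (dw (toC ρ) p) ^ 2,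
    fun p => (dz (toC ρ) p) ^ 2 * dw (toC ρ) p,
    fun p => (dz (toC ρ) p) ^ 3,
    holHessLL σ ρ] : Fin 5 → ℂ × ℂ → ℂ) i)) p

theorem Lbar_congr (hΩ : IsOpen Ω) (ρ : ℂ × ℂ → ℝ) {f g : ℂ × ℂ → ℂ} (h : EqOn f g Ω) :
    EqOn (Lbar ρ f) (Lbar ρ g) Ω := by
  intro p hp
  have := wirtinger_congr (h.eventuallyEq_of_mem (hΩ.mem_nhds hp))
  rw [Lbar, Lbar, this.2.2.1, this.2.2.2]

theorem contDiffOn_wirtinger (hΩ : IsOpen Ω) {m : WithTop ℕ∞} (hm : m + 1 ≤ m) {f : ℂ × ℂ → ℂ}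
    (hf : ContDiffOn ℝ m f Ω) : ContDiffOn ℝ m (dz f) Ω ∧ ContDiffOn ℝ m (dw f) Ω ∧
      ContDiffOn ℝ m (dzbar f) Ω ∧ ContDiffOn ℝ m (dwbar f) Ω := by
  have h := fun v => contDiffOn_fderiv_apply hΩ hm hf v
  exact ⟨contDiffOn_const.mul ((h _).sub (contDiffOn_const.mul (h _))),
    contDiffOn_const.mul ((h _).sub (contDiffOn_const.mul (h _))),
    contDiffOn_const.mul ((h _).add (contDiffOn_const.mul (h _))),
    contDiffOn_const.mul ((h _).add (contDiffOn_const.mul (h _)))⟩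

theorem contDiffOn_Lbar (hΩ : IsOpen Ω) {m : WithTop ℕ∞} (hm : m + 1 ≤ m) {ρ : ℂ × ℂ → ℝ}
    (hρ : ContDiffOn ℝ m ρ Ω) {f : ℂ × ℂ → ℂ} (hf : ContDiffOn ℝ m f Ω) :
    ContDiffOn ℝ m (Lbar ρ f) Ω := by
  have h1 := contDiffOn_wirtinger hΩ hm (contDiffOn_toC hρ)
  have h2 := contDiffOn_wirtinger hΩ hm hf
  exact (h1.2.2.2.neg.mul h2.2.2.1).add (h1.2.2.1.mul h2.2.2.2)

theorem contDiffOn_iterate_Lbar (hΩ : IsOpen Ω) {m : WithTop ℕ∞} (hm : m + 1 ≤ m) {ρ : ℂ × ℂ → ℝ}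
    (hρ : ContDiffOn ℝ m ρ Ω) {f : ℂ × ℂ → ℂ} (hf : ContDiffOn ℝ m f Ω) (n : ℕ) :
    ContDiffOn ℝ m ((Lbar ρ)^[n] f) Ω := by
  induction n generalizing f with
  | zero => exact hf
  | succ n ih => exact ih (contDiffOn_Lbar hΩ hm hρ hf)

theorem contDiffOn_holHessLL (hΩ : IsOpen Ω) {m : WithTop ℕ∞} (hm : m + 1 ≤ m) {σ ρ : ℂ × ℂ → ℝ}
    (hσ : ContDiffOn ℝ m σ Ω) (hρ : ContDiffOn ℝ m ρ Ω) : ContDiffOn ℝ m (holHessLL σ ρ) Ω := by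
  have h1 := contDiffOn_wirtinger hΩ hm (contDiffOn_toC hρ)
  have h2 := contDiffOn_wirtinger hΩ hm (contDiffOn_toC hσ)
  have h3 := contDiffOn_wirtinger hΩ hm h2.1
  have h4 := contDiffOn_wirtinger hΩ hm h2.2.1
  exact ((h3.1.mul (h1.2.1.pow 2)).sub ((contDiffOn_const.mul h3.2.1).mul (h1.1.mul h1.2.1))).add
    (h4.2.1.mul (h1.1.pow 2))

theorem contDiffOn_det_A3 (hΩ : IsOpen Ω) {m : WithTop ℕ∞} (hm : m + 1 ≤ m) {ρ : ℂ × ℂ → ℝ}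
    (hρ : ContDiffOn ℝ m ρ Ω) : ContDiffOn ℝ m (fun p => (A3 ρ p).det) Ω := by
  have h1 := contDiffOn_wirtinger hΩ hm (contDiffOn_toC hρ)
  have hrow : ∀ i, ContDiffOn ℝ m (rowFn ρ i) Ω := by
    intro i
    fin_cases i
    · exact h1.2.1.pow 3
    · exact h1.1.mul (h1.2.1.pow 2)
    · exact (h1.1.pow 2).mul h1.2.1
    · exact h1.1.pow 3
    · exact contDiffOn_holHessLL hΩ hm hρ hρ
  simp only [Matrix.det_apply']
  refine ContDiffOn.sum fun s _ => contDiffOn_const.mul (contDiffOn_prod fun i _ => ?_)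
  exact contDiffOn_iterate_Lbar hΩ hm hρ (hrow _) _

theorem contDiffOn_Jtilde (hΩ : IsOpen Ω) {m : WithTop ℕ∞} (hm : m + 1 ≤ m) {ρ : ℂ × ℂ → ℝ}
    (hρ : ContDiffOn ℝ m ρ Ω) : ContDiffOn ℝ m (Jtilde ρ) Ω := by
  have h1 := contDiffOn_wirtinger hΩ hm (contDiffOn_toC hρ)
  have : Jtilde ρ = fun p => dz (toC ρ) p * Lbar ρ (dw (toC ρ)) p -
      Lbar ρ (dz (toC ρ)) p * dw (toC ρ) p := by
    ext p; rw [Jtilde, Matrix.det_fin_two_of]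
  rw [this]
  exact (h1.1.mul (contDiffOn_Lbar hΩ hm hρ h1.2.1)).sub
    ((contDiffOn_Lbar hΩ hm hρ h1.1).mul h1.2.1)

/-- For a perturbation of the sphere the last row of `A₃` is small of first order: the holomorphic
Hessian of the sphere vanishes. -/
theorem holHessLL_perturbation (hΩ : IsOpen Ω) {σ ρ : ℂ × ℂ → ℝ} {ε : ℝ} (hσ : ContDiffOn ℝ ∞ σ Ω)
    (hρ : ∀ p ∈ Ω, ρ p = rho0 p + ε * σ p) {p : ℂ × ℂ} (hp : p ∈ Ω) :
    holHessLL ρ ρ p = ε * holHessLL σ ρ p := by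
  have hσ' := contDiffOn_toC hσ
  have h0 : ContDiffOn ℝ ∞ (toC rho0) Ω := contDiffOn_toC contDiff_rho0.contDiffOn
  have key : ∀ {f g h : ℂ × ℂ → ℂ}, ContDiffOn ℝ ∞ g Ω → ContDiffOn ℝ ∞ h Ω →
      (∀ p ∈ Ω, f p = g p + ε * h p) → ∀ p ∈ Ω, dz f p = dz g p + ε * dz h p ∧
        dw f p = dw g p + ε * dw h p := by
    intro f g h hg hh hf p hp
    have d1 := hg.differentiableAt_of_isOpen hΩ hp
    have d2 := hh.differentiableAt_of_isOpen hΩ hp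
    have c := wirtinger_congr (f := f) (g := fun p => g p + ε * h p)
      (EqOn.eventuallyEq_of_mem hf (hΩ.mem_nhds hp))
    have a := wirtinger_add d1 (d2.const_mul (ε : ℂ))
    have m := wirtinger_const_mul d2 (ε : ℂ)
    rw [c.1, c.2.1, a.1, a.2.1, m.1, m.2.1]
    exact ⟨rfl, rfl⟩
  have k1 := key h0 hσ' (f := toC ρ) fun p hp => by simp [toC, hρ p hp]
  have w0 := contDiffOn_wirtinger hΩ infty_add_one_le h0
  have w1 := contDiffOn_wirtinger hΩ infty_add_one_le hσ'
  have k2 := key w0.1 w1.1 fun p hp => (k1 p hp).1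
  have k3 := key w0.2.1 w1.2.1 fun p hp => (k1 p hp).2
  rw [holHessLL, holHessLL, (k2 p hp).1, (k2 p hp).2, (k3 p hp).2]
  have z1 := wirtinger_conj_fst p
  have z2 := wirtinger_conj_snd p
  rw [wirtinger_rho0.1, wirtinger_rho0.2.1, z1.1, z1.2.1, z2.2.1]
  ring

/-- With `ρ = ρ⁰ + ε σ`, the factor `ε` of the last row comes out of `det A₃`. -/
theorem det_A3_perturbation (hΩ : IsOpen Ω) {σ ρ : ℂ × ℂ → ℝ} {ε : ℝ} (hσ : ContDiffOn ℝ ∞ σ Ω)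
    (hρs : ContDiffOn ℝ ∞ ρ Ω) (hρ : ∀ p ∈ Ω, ρ p = rho0 p + ε * σ p) {p : ℂ × ℂ} (hp : p ∈ Ω) :
    (A3 ρ p).det = ε * (A3' σ ρ p).det := by
  have hlast : ∀ n : ℕ, EqOn ((Lbar ρ)^[n] (holHessLL ρ ρ))
      (fun p => ε * (Lbar ρ)^[n] (holHessLL σ ρ) p) Ω := by
    intro n
    induction n with
    | zero => exact fun p hp => holHessLL_perturbation hΩ hσ hρ hp
    | succ n ih =>
      intro p hp
      have h1 := Lbar_congr hΩ ρ ih hp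
      have h2 := contDiffOn_iterate_Lbar hΩ infty_add_one_le hρs
        (contDiffOn_holHessLL hΩ infty_add_one_le hσ hρs) n
      have h3 := wirtinger_const_mul (h2.differentiableAt_of_isOpen hΩ hp) (ε : ℂ)
      rw [Function.iterate_succ_apply', h1, Function.iterate_succ_apply']
      simp only [Lbar, h3.2.2.1, h3.2.2.2]
      ring
  have hmat : A3 ρ p = Matrix.of fun i j => (![1, 1, 1, 1, (ε : ℂ)] : Fin 5 → ℂ) i *
      A3' σ ρ p i j := by
    ext i j
    fin_cases i
    · simp [A3, A3', rowFn]
    · simp [A3, A3', rowFn]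
    · simp [A3, A3', rowFn]
    · simp [A3, A3', rowFn]
    · simpa [A3, A3', rowFn] using hlast j hp
  rw [hmat, Matrix.det_mul_column]
  simp [Fin.prod_univ_succ]

/-- The determinant of `A₃` at the unit sphere, with `a`, `b` in place of `z̄`, `w̄` and `h_j` in
place of `L̄₀^j` of the last function. The first four functions are cubics in `z̄`, `w̄`, which
`L̄₀^4` annihilates, so the determinant splits off the entry `h₄`. -/
theorem det_cubics (z w a b h₀ h₁ h₂ h₃ h₄ : ℂ) :
    Matrix.det !![b ^ 3, 3 * b ^ 2 * z, 6 * b * z ^ 2, 6 * z ^ 3, 0;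
      a * b ^ 2, -w * b ^ 2 + 2 * a * b * z, -4 * w * b * z + 2 * a * z ^ 2, -6 * w * z ^ 2, 0;
      a ^ 2 * b, -2 * w * a * b + a ^ 2 * z, 2 * w ^ 2 * b - 4 * w * z * a, 6 * w ^ 2 * z, 0;
      a ^ 3, -3 * w * a ^ 2, 6 * w ^ 2 * a, -6 * w ^ 3, 0;
      h₀, h₁, h₂, h₃, h₄] = 12 * (z * a + w * b) ^ 6 * h₄ := by
  rw [Matrix.det_succ_column _ (Fin.last 4)]
  simp only [Fin.sum_univ_succ, Matrix.det_succ_row_zero, Matrix.submatrix_apply, Matrix.det_unique]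
  simp [Fin.succAbove, Fin.succ, Fin.lt_def]
  ring

theorem det_A3'_sphere (σ : ℂ × ℂ → ℝ) {p : ℂ × ℂ} (hp : p ∈ S3) :
    (A3' σ rho0 p).det = 12 * Qprime σ p := by
  have hz := HasLbarSphere.conj_fst
  have hw := HasLbarSphere.conj_snd
  have hz' : HasLbarSphere (fun p => -p.2) fun _ => 0 :=
    ((HasLbarSphere.const (-1)).mul HasLbarSphere.snd).congr (fun p => by ring) (fun p => by ring)
  have hw' := HasLbarSphere.fst
  obtain ⟨a1, a2, a3, a4⟩ := iterate_Lbar_rho0_mul_mul hw hw' hw hw' hw hw'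
  obtain ⟨b1, b2, b3, b4⟩ := iterate_Lbar_rho0_mul_mul hz hz' hw hw' hw hw'
  obtain ⟨c1, c2, c3, c4⟩ := iterate_Lbar_rho0_mul_mul hz hz' hz hz' hw hw'
  obtain ⟨d1, d2, d3, d4⟩ := iterate_Lbar_rho0_mul_mul hz hz' hz hz' hz hz'
  have ea : (fun p : ℂ × ℂ => starRingEnd ℂ p.2 ^ 3) =
    fun p => starRingEnd ℂ p.2 * starRingEnd ℂ p.2 * starRingEnd ℂ p.2 := by ext; ring
  have eb : (fun p : ℂ × ℂ => starRingEnd ℂ p.1 * starRingEnd ℂ p.2 ^ 2) =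
    fun p => starRingEnd ℂ p.1 * starRingEnd ℂ p.2 * starRingEnd ℂ p.2 := by ext; ring
  have ec : (fun p : ℂ × ℂ => starRingEnd ℂ p.1 ^ 2 * starRingEnd ℂ p.2) =
    fun p => starRingEnd ℂ p.1 * starRingEnd ℂ p.1 * starRingEnd ℂ p.2 := by ext; ring
  have ed : (fun p : ℂ × ℂ => starRingEnd ℂ p.1 ^ 3) =
    fun p => starRingEnd ℂ p.1 * starRingEnd ℂ p.1 * starRingEnd ℂ p.1 := by ext; ring
  have hnorm : p.1 * starRingEnd ℂ p.1 + p.2 * starRingEnd ℂ p.2 = 1 := by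
    have h1 : toC rho0 p = 0 := by simp [toC, show rho0 p = 0 from hp]
    rw [toC_rho0] at h1
    linear_combination h1
  set z := p.1
  set w := p.2
  set zb := starRingEnd ℂ p.1
  set wb := starRingEnd ℂ p.2
  set h : ℕ → ℂ := fun j => (Lbar rho0)^[j] (holHessLL σ rho0) p with hh
  have hmat : A3' σ rho0 p = !![wb ^ 3, 3 * wb ^ 2 * z, 6 * wb * z ^ 2, 6 * z ^ 3, 0;
      zb * wb ^ 2, -w * wb ^ 2 + 2 * zb * wb * z, -4 * w * wb * z + 2 * zb * z ^ 2, -6 * w * z ^ 2, 0;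
      zb ^ 2 * wb, -2 * w * zb * wb + zb ^ 2 * z, 2 * w ^ 2 * wb - 4 * w * z * zb, 6 * w ^ 2 * z, 0;
      zb ^ 3, -3 * w * zb ^ 2, 6 * w ^ 2 * zb, -6 * w ^ 3, 0;
      h 0, h 1, h 2, h 3, h 4] := by
    ext i j
    simp only [A3', Matrix.of_apply, wirtinger_rho0.1, wirtinger_rho0.2.1, ea, eb, ec, ed]
    fin_cases i <;> fin_cases j <;>
    simp only [Fin.zero_eta, Fin.mk_one, Fin.reduceFinMk, Fin.isValue, Matrix.cons_val,
      Matrix.cons_val', a1, a2, a3, a4, b1, b2, b3, b4, c1, c2, c3, c4, d1, d2, d3, d4,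
      Function.iterate_zero, id_eq, hh] <;> ring
  have hQ : Qprime σ p = h 4 := rfl
  rw [hmat, hQ, det_cubics, hnorm]
  ring

end determinant

section limits

variable {Ω : Set (ℂ × ℂ)} {ρ : ℝ → ℂ × ℂ → ℝ} {ρ' : ℂ × ℂ → ℝ}

theorem tendsto_matrix_det {α : Type*} {l : Filter α} {n : ℕ} {M : α → Matrix (Fin n) (Fin n) ℂ}
    {M₀ : Matrix (Fin n) (Fin n) ℂ} (h : ∀ i j, Tendsto (fun a => M a i j) l (𝓝 (M₀ i j))) :
    Tendsto (fun a => (M a).det) l (𝓝 M₀.det) :=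
  ((continuous_id.matrix_det).tendsto M₀).comp
    (tendsto_pi_nhds.2 fun i => tendsto_pi_nhds.2 fun j => h i j)

/-- To first order in `ε`, `det A₃` of the perturbed sphere is `12 ε Q'`. -/
theorem IsSpherePerturbation.tendsto_det_A3 (h : IsSpherePerturbation Ω ρ ρ') (hΩ : IsOpen Ω)
    {u : ℂ × ℂ} (hu : u ∈ S3) (huΩ : u ∈ Ω) :
    Tendsto (fun q : ℝ × (ℂ × ℂ) => (A3 (ρ q.1) q.2).det / q.1) (𝓝[>] 0 ×ˢ 𝓝 u)
      (𝓝 (12 * Qprime ρ' u)) := by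
  have hσ := h.smoothConv_quotient hΩ
  have hρ := h.smoothConv hΩ
  have hentry : ∀ i j : Fin 5, Tendsto (fun q : ℝ × (ℂ × ℂ) =>
      A3' (fun p => q.1⁻¹ * (ρ q.1 p - rho0 p)) (ρ q.1) q.2 i j) (𝓝[>] 0 ×ˢ 𝓝 u)
      (𝓝 (A3' ρ' rho0 u i j)) := by
    intro i j
    have hz := hρ.dz hΩ
    have hw := hρ.dw hΩ
    fin_cases i
    · exact (SmoothConv.iterate_Lbar hΩ hρ (hw.pow hΩ 3) j).tendsto huΩ
    · exact (SmoothConv.iterate_Lbar hΩ hρ (hz.mul hΩ (hw.pow hΩ 2)) j).tendsto huΩ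
    · exact (SmoothConv.iterate_Lbar hΩ hρ ((hz.pow hΩ 2).mul hΩ hw) j).tendsto huΩ
    · exact (SmoothConv.iterate_Lbar hΩ hρ (hz.pow hΩ 3) j).tendsto huΩ
    · exact (SmoothConv.iterate_Lbar hΩ hρ (SmoothConv.holHessLL hΩ hρ hσ) j).tendsto huΩ
  have hdet := tendsto_matrix_det hentry
  rw [det_A3'_sphere ρ' hu] at hdet
  refine hdet.congr' ?_
  have h2 := h.2.1
  filter_upwards [(h2.and self_mem_nhdsWithin).prod_mk (hΩ.mem_nhds huΩ)] with q hq
  have hq0 : q.1 ≠ 0 := ne_of_gt hq.1.2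
  rw [det_A3_perturbation hΩ (σ := fun p => q.1⁻¹ * (ρ q.1 p - rho0 p))
    (contDiffOn_const.mul (hq.1.1.sub contDiff_rho0.contDiffOn)) hq.1.1
    (fun p _ => by field_simp; ring) hq.2, mul_div_cancel_left₀ _ (by exact_mod_cast hq0)]

theorem Jtilde_rho0 {u : ℂ × ℂ} (hu : u ∈ S3) : Jtilde rho0 u = 1 := by
  have h1 : toC rho0 u = 0 := by simp [toC, show rho0 u = 0 from hu]
  rw [toC_rho0] at h1
  rw [Jtilde, Matrix.det_fin_two_of, wirtinger_rho0.1, wirtinger_rho0.2.1,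
    HasLbarSphere.conj_fst.2, HasLbarSphere.conj_snd.2]
  linear_combination h1

theorem IsSpherePerturbation.tendsto_Jtilde (h : IsSpherePerturbation Ω ρ ρ') (hΩ : IsOpen Ω)
    {u : ℂ × ℂ} (hu : u ∈ S3) (huΩ : u ∈ Ω) :
    Tendsto (fun q : ℝ × (ℂ × ℂ) => Jtilde (ρ q.1) q.2) (𝓝[>] 0 ×ˢ 𝓝 u) (𝓝 1) := by
  have hρ := h.smoothConv hΩ
  have h1 := ((hρ.dz hΩ).tendsto huΩ).mul ((SmoothConv.Lbar hΩ hρ (hρ.dw hΩ)).tendsto huΩ)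
  have h2 := ((SmoothConv.Lbar hΩ hρ (hρ.dz hΩ)).tendsto huΩ).mul ((hρ.dw hΩ).tendsto huΩ)
  have h3 := h1.sub h2
  rw [← Jtilde_rho0 hu]
  simp only [Jtilde, Matrix.det_fin_two_of]
  exact h3

theorem IsSpherePerturbation.tendsto_apply (h : IsSpherePerturbation Ω ρ ρ') (hΩ : IsOpen Ω)
    {u : ℂ × ℂ} (huΩ : u ∈ Ω) :
    Tendsto (fun q : ℝ × (ℂ × ℂ) => ρ q.1 q.2) (𝓝[>] 0 ×ˢ 𝓝 u) (𝓝 (rho0 u)) := by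
  have h1 := (Complex.continuous_re.tendsto _).comp ((h.smoothConv hΩ).tendsto huΩ)
  exact h1

theorem IsSpherePerturbation.tendsto_fderiv (h : IsSpherePerturbation Ω ρ ρ') (hΩ : IsOpen Ω)
    {u : ℂ × ℂ} (huΩ : u ∈ Ω) (v : ℂ × ℂ) :
    Tendsto (fun q : ℝ × (ℂ × ℂ) => fderiv ℝ (ρ q.1) q.2 v) (𝓝[>] 0 ×ˢ 𝓝 u)
      (𝓝 (fderiv ℝ rho0 u v)) := by
  have key : ∀ {f : ℂ × ℂ → ℝ} {p : ℂ × ℂ}, DifferentiableAt ℝ f p →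
      (fderiv ℝ (toC f) p v).re = fderiv ℝ f p v := by
    intro f p hf
    have h1 : HasFDerivAt (toC f) _ p := Complex.ofRealCLM.hasFDerivAt.comp p hf.hasFDerivAt
    rw [h1.fderiv]
    simp
  have h1 := (Complex.continuous_re.tendsto _).comp (((h.smoothConv hΩ).fderiv hΩ v).tendsto huΩ)
  rw [key ((contDiff_rho0 (n := 1)).differentiable (by simp) u)] at h1
  refine h1.congr' ?_
  filter_upwards [h.2.1.prod_mk (hΩ.mem_nhds huΩ)] with q hq
  exact key ((hq.1.contDiffAt (hΩ.mem_nhds hq.2)).differentiableAt (by simp))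

end limits

noncomputable section

/-! ### The unit sphere and its stereographic charts -/

section spheregeometry

/-- The Euclidean norm on `ℂ²`. -/
def euclNorm (p : ℂ × ℂ) : ℝ := √(‖p.1‖ ^ 2 + ‖p.2‖ ^ 2)

/-- The radial projection to the unit sphere. -/
def radialProj (p : ℂ × ℂ) : ℂ × ℂ := (euclNorm p)⁻¹ • p

theorem mem_S3_iff {p : ℂ × ℂ} : p ∈ S3 ↔ ‖p.1‖ ^ 2 + ‖p.2‖ ^ 2 = 1 := sub_eq_zero

theorem euclNorm_eq_one {p : ℂ × ℂ} (hp : p ∈ S3) : euclNorm p = 1 := by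
  rw [euclNorm, mem_S3_iff.1 hp, Real.sqrt_one]

theorem euclNorm_smul {r : ℝ} (hr : 0 ≤ r) (p : ℂ × ℂ) : euclNorm (r • p) = r * euclNorm p := by
  simp only [euclNorm, Prod.smul_fst, Prod.smul_snd, norm_smul, Real.norm_eq_abs, mul_pow, sq_abs]
  rw [← mul_add, Real.sqrt_mul (sq_nonneg r), Real.sqrt_sq hr]

theorem sq_add_sq_pos {p : ℂ × ℂ} (hp : p ≠ 0) : 0 < ‖p.1‖ ^ 2 + ‖p.2‖ ^ 2 := by
  by_contra h
  have h1 : ‖p.1‖ ^ 2 = 0 := by nlinarith [sq_nonneg ‖p.1‖, sq_nonneg ‖p.2‖]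
  have h2 : ‖p.2‖ ^ 2 = 0 := by nlinarith [sq_nonneg ‖p.1‖, sq_nonneg ‖p.2‖]
  exact hp (Prod.ext (by simpa using h1) (by simpa using h2))

theorem euclNorm_pos {p : ℂ × ℂ} (hp : p ≠ 0) : 0 < euclNorm p :=
  Real.sqrt_pos.2 (sq_add_sq_pos hp)

theorem continuous_euclNorm : Continuous euclNorm := by
  unfold euclNorm
  fun_prop

theorem radialProj_mem {p : ℂ × ℂ} (hp : p ≠ 0) : radialProj p ∈ S3 := by
  have h1 := euclNorm_smul (inv_nonneg.2 (euclNorm_pos hp).le) p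
  rw [inv_mul_cancel₀ (euclNorm_pos hp).ne', euclNorm, Real.sqrt_eq_one] at h1
  exact mem_S3_iff.2 h1

theorem radialProj_of_mem {p : ℂ × ℂ} (hp : p ∈ S3) : radialProj p = p := by
  rw [radialProj, euclNorm_eq_one hp, inv_one, one_smul]

theorem ne_zero_of_mem_S3 {p : ℂ × ℂ} (hp : p ∈ S3) : p ≠ 0 := by
  rintro rfl
  simp [mem_S3_iff] at hp

theorem radialProj_smul {r : ℝ} (hr : 0 < r) {p : ℂ × ℂ} (hp : p ∈ S3) :
    radialProj (r • p) = p := by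
  rw [radialProj, euclNorm_smul hr.le, euclNorm_eq_one hp, mul_one, smul_smul,
    inv_mul_cancel₀ hr.ne', one_smul]

theorem euclNorm_smul_radialProj {p : ℂ × ℂ} (hp : p ≠ 0) : euclNorm p • radialProj p = p := by
  rw [radialProj, smul_smul, mul_inv_cancel₀ (euclNorm_pos hp).ne', one_smul]

theorem contDiffAt_radialProj {n : WithTop ℕ∞} {p : ℂ × ℂ} (hp : p ≠ 0) :
    ContDiffAt ℝ n radialProj p := by
  have h1 : ContDiffAt ℝ n euclNorm p := by
    refine ContDiffAt.sqrt ?_ (sq_add_sq_pos hp).ne'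
    exact ((contDiff_fst.norm_sq ℝ).add (contDiff_snd.norm_sq ℝ)).contDiffAt
  exact (h1.inv (euclNorm_pos hp).ne').smul contDiffAt_id

theorem isCompact_S3 : IsCompact S3 := by
  refine Metric.isCompact_of_isClosed_isBounded ?_ ?_
  · exact isClosed_eq (contDiff_rho0 (n := 0)).continuous continuous_const
  · refine (Metric.isBounded_closedBall (x := (0 : ℂ × ℂ)) (r := 1)).subset fun p hp => ?_
    have h := mem_S3_iff.1 hp
    rw [mem_closedBall_zero_iff, Prod.norm_def, sup_le_iff]
    constructor <;> nlinarith [sq_nonneg ‖p.1‖, sq_nonneg ‖p.2‖, norm_nonneg p.1, norm_nonneg p.2]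

/-- Inverse stereographic projection of the unit sphere, with centre `(1, 0)`. -/
def invStereo (x : ℝ × ℝ × ℝ) : ℂ × ℂ :=
  let s := x.1 ^ 2 + x.2.1 ^ 2 + x.2.2 ^ 2
  (((s - 1) / (s + 1) : ℝ) + ((2 * x.1 / (s + 1) : ℝ) : ℂ) * Complex.I,
    ((2 * x.2.1 / (s + 1) : ℝ) : ℂ) + ((2 * x.2.2 / (s + 1) : ℝ) : ℂ) * Complex.I)

/-- Stereographic projection with centre `(1, 0)`. -/
def stereo (p : ℂ × ℂ) : ℝ × ℝ × ℝ :=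
  (p.1.im / (1 - p.1.re), p.2.re / (1 - p.1.re), p.2.im / (1 - p.1.re))

theorem norm_sq_eq (z : ℂ) : ‖z‖ ^ 2 = z.re ^ 2 + z.im ^ 2 := by
  rw [← Complex.normSq_eq_norm_sq, Complex.normSq_apply]; ring

/-- The real coordinates of the inverse stereographic projection. -/
theorem invStereo_re (x : ℝ × ℝ × ℝ) : (invStereo x).1.re =
    (x.1 ^ 2 + x.2.1 ^ 2 + x.2.2 ^ 2 - 1) / (x.1 ^ 2 + x.2.1 ^ 2 + x.2.2 ^ 2 + 1) ∧
    (invStereo x).1.im = 2 * x.1 / (x.1 ^ 2 + x.2.1 ^ 2 + x.2.2 ^ 2 + 1) ∧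
    (invStereo x).2.re = 2 * x.2.1 / (x.1 ^ 2 + x.2.1 ^ 2 + x.2.2 ^ 2 + 1) ∧
    (invStereo x).2.im = 2 * x.2.2 / (x.1 ^ 2 + x.2.1 ^ 2 + x.2.2 ^ 2 + 1) := by
  simp only [invStereo, Complex.add_re, Complex.add_im, Complex.ofReal_re, Complex.ofReal_im,
    Complex.re_ofReal_mul, Complex.im_ofReal_mul, Complex.I_re, Complex.I_im]
  simp

theorem invStereo_mem (x : ℝ × ℝ × ℝ) : invStereo x ∈ S3 := by
  obtain ⟨h1, h2, h3, h4⟩ := invStereo_re x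
  rw [mem_S3_iff, norm_sq_eq, norm_sq_eq, h1, h2, h3, h4]
  have : x.1 ^ 2 + x.2.1 ^ 2 + x.2.2 ^ 2 + 1 ≠ 0 := by positivity
  field_simp
  ring

theorem invStereo_re_lt (x : ℝ × ℝ × ℝ) : (invStereo x).1.re < 1 := by
  rw [(invStereo_re x).1, div_lt_one (by positivity)]
  linarith

theorem stereo_invStereo (x : ℝ × ℝ × ℝ) : stereo (invStereo x) = x := by
  obtain ⟨h1, h2, h3, h4⟩ := invStereo_re x
  have h0 : x.1 ^ 2 + x.2.1 ^ 2 + x.2.2 ^ 2 + 1 ≠ 0 := by positivity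
  have h5 : 1 - (invStereo x).1.re = 2 / (x.1 ^ 2 + x.2.1 ^ 2 + x.2.2 ^ 2 + 1) := by
    rw [h1]; field_simp; ring
  refine Prod.ext ?_ (Prod.ext ?_ ?_)
  · simp only [stereo, h5, h2]; field_simp
  · simp only [stereo, h5, h3]; field_simp
  · simp only [stereo, h5, h4]; field_simp

theorem invStereo_stereo {p : ℂ × ℂ} (hp : p ∈ S3) (hre : p.1.re < 1) :
    invStereo (stereo p) = p := by
  have h0 : 1 - p.1.re ≠ 0 := by linarith
  rw [mem_S3_iff, norm_sq_eq, norm_sq_eq] at hp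
  have hs : (stereo p).1 ^ 2 + (stereo p).2.1 ^ 2 + (stereo p).2.2 ^ 2 + 1 = 2 / (1 - p.1.re) := by
    simp only [stereo]
    field_simp
    linear_combination hp
  have hs' : (stereo p).1 ^ 2 + (stereo p).2.1 ^ 2 + (stereo p).2.2 ^ 2 - 1 =
      2 / (1 - p.1.re) - 2 := by linarith
  obtain ⟨h1, h2, h3, h4⟩ := invStereo_re (stereo p)
  rw [hs] at h1 h2 h3 h4
  rw [hs'] at h1
  refine Prod.ext (Complex.ext ?_ ?_) (Complex.ext ?_ ?_)
  · rw [h1]; field_simp; ring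
  · rw [h2]; simp only [stereo]; field_simp
  · rw [h3]; simp only [stereo]; field_simp
  · rw [h4]; simp only [stereo]; field_simp

theorem contDiff_invStereo {n : WithTop ℕ∞} : ContDiff ℝ n invStereo := by
  have hs : ContDiff ℝ n fun x : ℝ × ℝ × ℝ => x.1 ^ 2 + x.2.1 ^ 2 + x.2.2 ^ 2 := by fun_prop
  have hne : ∀ x : ℝ × ℝ × ℝ, x.1 ^ 2 + x.2.1 ^ 2 + x.2.2 ^ 2 + 1 ≠ 0 := fun x => by positivity
  have key : ∀ {f : ℝ × ℝ × ℝ → ℝ}, ContDiff ℝ n f → ContDiff ℝ n fun x : ℝ × ℝ × ℝ =>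
      ((f x / (x.1 ^ 2 + x.2.1 ^ 2 + x.2.2 ^ 2 + 1) : ℝ) : ℂ) := fun hf =>
    Complex.ofRealCLM.contDiff.comp (hf.div (hs.add contDiff_const) hne)
  refine ContDiff.prodMk ?_ ?_
  · exact (key (hs.sub contDiff_const)).add ((key (by fun_prop)).mul contDiff_const)
  · exact (key (by fun_prop)).add ((key (by fun_prop)).mul contDiff_const)

theorem contDiffAt_stereo {n : WithTop ℕ∞} {p : ℂ × ℂ} (hp : p.1.re < 1) :
    ContDiffAt ℝ n stereo p := by
  have h0 : 1 - p.1.re ≠ 0 := by linarith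
  have r1 : ContDiffAt ℝ n (fun p : ℂ × ℂ => p.1.re) p :=
    (Complex.reCLM.contDiff.comp contDiff_fst).contDiffAt
  have i1 : ContDiffAt ℝ n (fun p : ℂ × ℂ => p.1.im) p :=
    (Complex.imCLM.contDiff.comp contDiff_fst).contDiffAt
  have r2 : ContDiffAt ℝ n (fun p : ℂ × ℂ => p.2.re) p :=
    (Complex.reCLM.contDiff.comp contDiff_snd).contDiffAt
  have i2 : ContDiffAt ℝ n (fun p : ℂ × ℂ => p.2.im) p :=
    (Complex.imCLM.contDiff.comp contDiff_snd).contDiffAt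
  have hd := contDiffAt_const (c := (1 : ℝ)).sub r1
  exact (i1.div hd h0).prodMk ((r2.div hd h0).prodMk (i2.div hd h0))

/-- The unitary map that takes `(1, 0)` to the point `a` of the sphere. -/
def rotation (a : ℂ × ℂ) : ℂ × ℂ →L[ℝ] ℂ × ℂ :=
  (((ContinuousLinearMap.fst ℂ ℂ ℂ).smulRight a.1 -
      (ContinuousLinearMap.snd ℂ ℂ ℂ).smulRight (starRingEnd ℂ a.2)).prod
    ((ContinuousLinearMap.fst ℂ ℂ ℂ).smulRight a.2 +
      (ContinuousLinearMap.snd ℂ ℂ ℂ).smulRight (starRingEnd ℂ a.1))).restrictScalars ℝ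

theorem rotation_apply (a p : ℂ × ℂ) : rotation a p =
    (p.1 * a.1 - p.2 * starRingEnd ℂ a.2, p.1 * a.2 + p.2 * starRingEnd ℂ a.1) := by
  simp [rotation]

theorem mul_conj_of_mem_S3 {a : ℂ × ℂ} (ha : a ∈ S3) :
    a.1 * starRingEnd ℂ a.1 + a.2 * starRingEnd ℂ a.2 = 1 := by
  have h1 := mem_S3_iff.1 ha
  rw [Complex.mul_conj, Complex.mul_conj, Complex.normSq_eq_norm_sq, Complex.normSq_eq_norm_sq]
  exact_mod_cast h1

theorem rotation_mem {a p : ℂ × ℂ} (ha : a ∈ S3) (hp : p ∈ S3) : rotation a p ∈ S3 := by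
  have h1 := mul_conj_of_mem_S3 ha
  have h2 := mul_conj_of_mem_S3 hp
  have h3 : (rotation a p).1 * starRingEnd ℂ (rotation a p).1 +
      (rotation a p).2 * starRingEnd ℂ (rotation a p).2 = 1 := by
    rw [rotation_apply]
    simp only [map_sub, map_add, map_mul, Complex.conj_conj]
    linear_combination h1 * (p.1 * starRingEnd ℂ p.1 + p.2 * starRingEnd ℂ p.2) + h2
  rw [Complex.mul_conj, Complex.mul_conj, Complex.normSq_eq_norm_sq,
    Complex.normSq_eq_norm_sq] at h3
  exact mem_S3_iff.2 (by exact_mod_cast h3)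

/-- The inverse of `rotation a` is again a rotation. -/
theorem exists_rotation_inverse {a : ℂ × ℂ} (ha : a ∈ S3) :
    ∃ b ∈ S3, (∀ p, rotation b (rotation a p) = p) ∧ ∀ p, rotation a (rotation b p) = p := by
  have h1 := mul_conj_of_mem_S3 ha
  refine ⟨(starRingEnd ℂ a.1, -a.2), ?_, fun p => ?_, fun p => ?_⟩
  · rw [mem_S3_iff] at ha ⊢
    simpa using ha
  · simp only [rotation_apply, map_neg, Complex.conj_conj]
    refine Prod.ext ?_ ?_
    · linear_combination p.1 * h1
    · linear_combination p.2 * h1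
  · simp only [rotation_apply, map_neg, Complex.conj_conj]
    refine Prod.ext ?_ ?_
    · linear_combination p.1 * h1
    · linear_combination p.2 * h1

theorem eq_of_mem_S3_of_re {p : ℂ × ℂ} (hp : p ∈ S3) (h : ¬ p.1.re < 1) : p = (1, 0) := by
  rw [mem_S3_iff, norm_sq_eq, norm_sq_eq] at hp
  have h1 : 1 ≤ p.1.re := not_lt.1 h
  have h2 : p.1.re = 1 := by
    nlinarith [sq_nonneg p.1.im, sq_nonneg p.2.re, sq_nonneg p.2.im]
  rw [h2] at hp
  have h3 : p.1.im = 0 := by nlinarith [sq_nonneg p.1.im, sq_nonneg p.2.re, sq_nonneg p.2.im]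
  have h4 : p.2.re = 0 := by nlinarith [sq_nonneg p.1.im, sq_nonneg p.2.re, sq_nonneg p.2.im]
  have h5 : p.2.im = 0 := by nlinarith [sq_nonneg p.1.im, sq_nonneg p.2.re, sq_nonneg p.2.im]
  exact Prod.ext (Complex.ext h2 h3) (Complex.ext h4 h5)

/-- Stereographic coordinates on the unit sphere without a given point. -/
theorem exists_sphere_chart {a : ℂ × ℂ} (ha : a ∈ S3) :
    ∃ (σ : ℝ × ℝ × ℝ → ℂ × ℂ) (τ : ℂ × ℂ → ℝ × ℝ × ℝ) (D : Set (ℂ × ℂ)),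
      (∀ n : WithTop ℕ∞, ContDiff ℝ n σ) ∧ IsOpen D ∧
      (∀ n : WithTop ℕ∞, ∀ p ∈ D, ContDiffAt ℝ n τ p) ∧ (∀ x, σ x ∈ S3 ∧ σ x ∈ D) ∧
      (∀ x, τ (σ x) = x) ∧ (∀ p ∈ S3, p ∈ D → σ (τ p) = p) ∧ ∀ p ∈ S3, p ≠ a → p ∈ D := by
  obtain ⟨b, hb, h1, h2⟩ := exists_rotation_inverse ha
  have h3 : rotation a (1, 0) = a := by simp [rotation_apply]
  refine ⟨fun x => rotation a (invStereo x), fun p => stereo (rotation b p),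
    {p | (rotation b p).1.re < 1}, fun n => (rotation a).contDiff.comp contDiff_invStereo, ?_,
    fun n p hp => ?_, fun x => ⟨rotation_mem ha (invStereo_mem x), ?_⟩, fun x => ?_,
    fun p hp hpD => ?_, fun p hp hpa => ?_⟩
  · exact isOpen_lt (by fun_prop) continuous_const
  · exact (contDiffAt_stereo hp).comp p (rotation b).contDiff.contDiffAt
  · change (rotation b (rotation a (invStereo x))).1.re < 1
    rw [h1]
    exact invStereo_re_lt x
  · beta_reduce
    rw [h1, stereo_invStereo]
  · beta_reduce
    rw [invStereo_stereo (rotation_mem hb hp) hpD, h2]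
  · by_contra h
    apply hpa
    rw [← h2 p, eq_of_mem_S3_of_re (rotation_mem hb hp) h, h3]

end spheregeometry

/-! ### The perturbed hypersurface as a radial graph -/

section

/-- A family of increasing functions that change sign has a continuous family of roots. -/
theorem exists_continuous_root {X : Type*} [TopologicalSpace X] {f : X → ℝ → ℝ} {a b : ℝ}
    (hab : a < b) (hmono : ∀ x, StrictMonoOn (f x) (Icc a b))
    (hs : ∀ x, ContinuousOn (f x) (Icc a b)) (hx : ∀ s ∈ Icc a b, Continuous fun x => f x s)
    (ha : ∀ x, f x a < 0) (hb : ∀ x, 0 < f x b) :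
    ∃ r : X → ℝ, Continuous r ∧ ∀ x, r x ∈ Ioo a b ∧ f x (r x) = 0 ∧
      ∀ s ∈ Icc a b, f x s = 0 → s = r x := by
  have h1 : ∀ x, ∃ s ∈ Ioo a b, f x s = 0 := fun x =>
    intermediate_value_Ioo hab.le (hs x) ⟨ha x, hb x⟩
  choose r hr hr0 using h1
  refine ⟨r, ?_, fun x => ⟨hr x, hr0 x, fun s hsm h0 =>
    (hmono x).injOn hsm (Ioo_subset_Icc_self (hr x)) (h0.trans (hr0 x).symm)⟩⟩
  refine continuous_iff_continuousAt.2 fun x => tendsto_order.2 ⟨fun c hc => ?_, fun c hc => ?_⟩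
  · obtain ⟨d, hd1, hd2⟩ := exists_between (max_lt hc (hr x).1)
    have hdI : d ∈ Icc a b :=
      ⟨((le_max_right _ _).trans_lt hd1).le, (hd2.trans (hr x).2).le⟩
    have h2 : f x d < 0 := hr0 x ▸ hmono x hdI (Ioo_subset_Icc_self (hr x)) hd2
    filter_upwards [((hx d hdI).tendsto x).eventually_lt_const h2] with y hy
    refine ((le_max_left _ _).trans_lt hd1).trans ?_
    rw [← hr0 y] at hy
    exact ((hmono y).lt_iff_lt hdI (Ioo_subset_Icc_self (hr y))).1 hy
  · obtain ⟨d, hd1, hd2⟩ := exists_between (lt_min hc (hr x).2)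
    have hdI : d ∈ Icc a b :=
      ⟨((hr x).1.trans hd1).le, (hd2.trans_le (min_le_right _ _)).le⟩
    have h2 : 0 < f x d := hr0 x ▸ hmono x (Ioo_subset_Icc_self (hr x)) hdI hd1
    filter_upwards [((hx d hdI).tendsto x).eventually_const_lt h2] with y hy
    refine lt_trans ?_ (hd2.trans_le (min_le_left _ _))
    rw [← hr0 y] at hy
    exact ((hmono y).lt_iff_lt (Ioo_subset_Icc_self (hr y)) hdI).1 hy

theorem norm_le_one_of_mem_S3 {u : ℂ × ℂ} (hu : u ∈ S3) : ‖u‖ ≤ 1 := by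
  have h := mem_S3_iff.1 hu
  rw [Prod.norm_def, sup_le_iff]
  constructor <;> nlinarith [sq_nonneg ‖u.1‖, sq_nonneg ‖u.2‖, norm_nonneg u.1, norm_nonneg u.2]

/-- A property that holds near each point of the sphere for small parameters holds for small
parameters on a fixed spherical shell. -/
theorem exists_shell {P : ℝ → ℂ × ℂ → Prop}
    (h : ∀ u ∈ S3, ∀ᶠ q : ℝ × (ℂ × ℂ) in 𝓝[>] 0 ×ˢ 𝓝 u, P q.1 q.2) :
    ∃ δ > 0, ∀ᶠ ε in 𝓝[>] (0 : ℝ), ∀ u ∈ S3, ∀ r : ℝ, |r - 1| < δ → P ε (r • u) := by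
  have h1 : {q : ℝ × (ℂ × ℂ) | P q.1 q.2} ∈ 𝓝[>] (0 : ℝ) ×ˢ 𝓝ˢ S3 :=
    isCompact_S3.mem_prod_nhdsSet_of_forall h
  obtain ⟨A, hA, N, hN, hAN⟩ := mem_prod_iff.1 h1
  obtain ⟨δ, hδ, hδN⟩ := isCompact_S3.exists_thickening_subset_open isOpen_interior
    (subset_interior_iff_mem_nhdsSet.2 hN)
  refine ⟨δ, hδ, ?_⟩
  filter_upwards [hA] with ε hε u hu r hr
  refine hAN (mk_mem_prod hε (interior_subset (hδN (Metric.mem_thickening_iff.2 ⟨u, hu, ?_⟩))))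
  rw [dist_eq_norm, show r • u - u = (r - 1) • u by module, norm_smul]
  calc ‖r - 1‖ * ‖u‖ ≤ ‖r - 1‖ * 1 := by gcongr; exact norm_le_one_of_mem_S3 hu
    _ < δ := by rwa [mul_one]

theorem rho0_smul {u : ℂ × ℂ} (hu : u ∈ S3) (r : ℝ) : rho0 (r • u) = r ^ 2 - 1 := by
  have h := mem_S3_iff.1 hu
  simp only [rho0, Prod.smul_fst, Prod.smul_snd, norm_smul, Real.norm_eq_abs, mul_pow, sq_abs]
  rw [← mul_add, h, mul_one]

theorem fderiv_rho0_self {u : ℂ × ℂ} (hu : u ∈ S3) : fderiv ℝ rho0 u u = 2 := by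
  have h1 : HasDerivAt (fun r : ℝ => r • u) u 1 := by
    simpa using (hasDerivAt_id (1 : ℝ)).smul_const u
  have h2 : HasFDerivAt rho0 (fderiv ℝ rho0 u) ((1 : ℝ) • u) := by
    rw [one_smul]
    exact ((contDiff_rho0 (n := 1)).differentiable (by simp) u).hasFDerivAt
  have h3 := h2.comp_hasDerivAt 1 h1
  have h4 : HasDerivAt (fun r : ℝ => r ^ 2 - 1) (2 : ℝ) 1 := by
    simpa using (hasDerivAt_pow 2 (1 : ℝ)).sub_const 1
  have h5 : (rho0 ∘ fun r : ℝ => r • u) = fun r => r ^ 2 - 1 := funext fun r => rho0_smul hu r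
  rw [h5] at h3
  exact h3.unique h4

variable {Ω : Set (ℂ × ℂ)} {ρ : ℝ → ℂ × ℂ → ℝ} {ρ' : ℂ × ℂ → ℝ}

theorem fderiv_apply_eq_sum (T : ℂ × ℂ →L[ℝ] ℝ) (p : ℂ × ℂ) :
    T p = p.1.re * T (1, 0) + p.1.im * T (Complex.I, 0) + p.2.re * T (0, 1) +
      p.2.im * T (0, Complex.I) := by
  have h : p = p.1.re • ((1 : ℂ), (0 : ℂ)) + p.1.im • (Complex.I, (0 : ℂ)) +
      p.2.re • ((0 : ℂ), (1 : ℂ)) + p.2.im • ((0 : ℂ), Complex.I) := by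
    refine Prod.ext ?_ ?_ <;> simp
  conv_lhs => rw [h]
  simp only [map_add, map_smul, smul_eq_mul]

theorem IsSpherePerturbation.tendsto_fderiv_self (h : IsSpherePerturbation Ω ρ ρ')
    (hΩ : IsOpen Ω) {u : ℂ × ℂ} (huΩ : u ∈ Ω) :
    Tendsto (fun q : ℝ × (ℂ × ℂ) => fderiv ℝ (ρ q.1) q.2 q.2) (𝓝[>] 0 ×ˢ 𝓝 u)
      (𝓝 (fderiv ℝ rho0 u u)) := by
  have hsnd : Tendsto (fun q : ℝ × (ℂ × ℂ) => q.2) (𝓝[>] 0 ×ˢ 𝓝 u) (𝓝 u) := tendsto_snd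
  have hc : ∀ {g : ℂ × ℂ → ℝ}, Continuous g →
      Tendsto (fun q : ℝ × (ℂ × ℂ) => g q.2) (𝓝[>] 0 ×ˢ 𝓝 u) (𝓝 (g u)) := fun hg =>
    (hg.tendsto u).comp hsnd
  simp_rw [fun (q : ℝ × (ℂ × ℂ)) => fderiv_apply_eq_sum (fderiv ℝ (ρ q.1) q.2) q.2]
  rw [fderiv_apply_eq_sum (fderiv ℝ rho0 u) u]
  have t := h.tendsto_fderiv hΩ huΩ
  refine ((((hc (g := fun p => p.1.re) ?_).mul (t _)).add
    ((hc (g := fun p => p.1.im) ?_).mul (t _))).add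
    ((hc (g := fun p => p.2.re) ?_).mul (t _))).add
    ((hc (g := fun p => p.2.im) ?_).mul (t _)) <;> fun_prop

/-- The properties of the perturbed defining function on a spherical shell about the sphere that
make its zero set there a radial graph over the sphere, on which `det A₃` is close to `12 ε Q'`. -/
structure IsRadialShell (Ω : Set (ℂ × ℂ)) (ρ : ℂ × ℂ → ℝ) (q : ℂ × ℂ → ℂ) (ε m δ : ℝ) : Prop where
  pos : 0 < ε
  lt_one : δ < 1
  delta_pos : 0 < δ
  smooth : ContDiffOn ℝ ∞ ρ Ω
  mem : ∀ u ∈ S3, ∀ r ∈ Icc (1 - δ) (1 + δ), r • u ∈ Ω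
  fderiv_pos : ∀ u ∈ S3, ∀ r ∈ Icc (1 - δ) (1 + δ), 0 < fderiv ℝ ρ (r • u) u
  jtilde : ∀ u ∈ S3, ∀ r ∈ Icc (1 - δ) (1 + δ), ‖Jtilde ρ (r • u) - 1‖ < 1 / 2
  det : ∀ u ∈ S3, ∀ r ∈ Icc (1 - δ) (1 + δ), ‖(A3 ρ (r • u)).det / ε - 12 * q u‖ < m
  neg_left : ∀ u ∈ S3, ρ ((1 - δ) • u) < 0
  pos_right : ∀ u ∈ S3, 0 < ρ ((1 + δ) • u)

theorem IsSpherePerturbation.continuousOn_Qprime (h : IsSpherePerturbation Ω ρ ρ')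
    (hΩ : IsOpen Ω) : ContinuousOn (Qprime ρ') Ω := by
  have h1 : ContDiffOn ℝ ∞ (holHessLL ρ' rho0) Ω :=
    contDiffOn_holHessLL hΩ infty_add_one_le h.1 contDiff_rho0.contDiffOn
  exact (contDiffOn_iterate_Lbar hΩ infty_add_one_le contDiff_rho0.contDiffOn h1 4).continuousOn

/-- The limits at the sphere hold uniformly on a thin shell, by compactness of the sphere. -/
theorem IsSpherePerturbation.exists_isRadialShell (h : IsSpherePerturbation Ω ρ ρ')
    (hΩ : IsOpen Ω) (hS : S3 ⊆ Ω) {m : ℝ} (hm : 0 < m) :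
    ∃ δ, ∀ᶠ ε in 𝓝[>] (0 : ℝ), IsRadialShell Ω (ρ ε) (Qprime ρ') ε m δ := by
  have hP : ∀ u ∈ S3, ∀ᶠ q : ℝ × (ℂ × ℂ) in 𝓝[>] 0 ×ˢ 𝓝 u, q.2 ∈ Ω ∧
      0 < fderiv ℝ (ρ q.1) q.2 q.2 ∧ ‖Jtilde (ρ q.1) q.2 - 1‖ < 1 / 2 ∧
      ‖(A3 (ρ q.1) q.2).det / q.1 - 12 * Qprime ρ' (radialProj q.2)‖ < m := by
    intro u hu
    have huΩ := hS hu
    have hsnd : Tendsto (fun q : ℝ × (ℂ × ℂ) => q.2) (𝓝[>] 0 ×ˢ 𝓝 u) (𝓝 u) := tendsto_snd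
    have h1 := hsnd.eventually (hΩ.mem_nhds huΩ)
    have h2 := (h.tendsto_fderiv_self hΩ huΩ).eventually_const_lt
      (by rw [fderiv_rho0_self hu]; norm_num : (0 : ℝ) < _)
    have h3 := ((h.tendsto_Jtilde hΩ hu huΩ).sub_const 1).norm.eventually_lt_const
      (by simp : _ < (1 / 2 : ℝ))
    have hcont : Tendsto (fun p => Qprime ρ' (radialProj p)) (𝓝 u) (𝓝 (Qprime ρ' u)) := by
      have h5 := (contDiffAt_radialProj (n := 0) (ne_zero_of_mem_S3 hu)).continuousAt
      rw [ContinuousAt, radialProj_of_mem hu] at h5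
      exact ((h.continuousOn_Qprime hΩ).continuousAt (hΩ.mem_nhds huΩ)).tendsto.comp h5
    have h4 := ((h.tendsto_det_A3 hΩ hu huΩ).sub
      ((hcont.comp hsnd).const_mul 12)).norm.eventually_lt_const (by simpa using hm : _ < m)
    filter_upwards [h1, h2, h3, h4] with q a b c d using ⟨a, b, c, d⟩
  obtain ⟨δ₀, hδ₀, hE⟩ := exists_shell
    (P := fun ε p => p ∈ Ω ∧ 0 < fderiv ℝ (ρ ε) p p ∧ ‖Jtilde (ρ ε) p - 1‖ < 1 / 2 ∧
      ‖(A3 (ρ ε) p).det / ε - 12 * Qprime ρ' (radialProj p)‖ < m) hP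
  obtain ⟨δ, hδ, hδ2⟩ := exists_between (lt_min hδ₀ one_pos)
  have hδ0 : δ < δ₀ := hδ2.trans_le (min_le_left _ _)
  have hδ1 : δ < 1 := hδ2.trans_le (min_le_right _ _)
  have hshell : ∀ r ∈ Icc (1 - δ) (1 + δ), |r - 1| < δ₀ ∧ 0 < r := fun r hr =>
    ⟨abs_sub_lt_iff.2 ⟨by linarith [hr.2], by linarith [hr.1]⟩, by linarith [hr.1]⟩
  have hΩr : ∀ u ∈ S3, ∀ r ∈ Icc (1 - δ) (1 + δ), r • u ∈ Ω := fun u hu r hr =>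
    (hE.exists.choose_spec u hu r (hshell r hr).1).1
  have hsign : ∀ r ∈ Icc (1 - δ) (1 + δ), ∀ u ∈ S3,
      Tendsto (fun q : ℝ × (ℂ × ℂ) => ρ q.1 (r • q.2)) (𝓝[>] 0 ×ˢ 𝓝 u) (𝓝 (r ^ 2 - 1)) := by
    intro r hr u hu
    have h1 := h.tendsto_apply hΩ (hΩr u hu r hr)
    rw [rho0_smul hu] at h1
    have hsm : Tendsto (fun p : ℂ × ℂ => r • p) (𝓝 u) (𝓝 (r • u)) :=
      (continuous_const_smul r).tendsto u
    exact h1.comp (tendsto_id.prodMap hsm)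
  obtain ⟨δ₁, hδ₁, hL⟩ := exists_shell (P := fun ε p => ρ ε ((1 - δ) • p) < 0) fun u hu =>
    (hsign (1 - δ) ⟨le_rfl, by linarith⟩ u hu).eventually_lt_const (by nlinarith)
  obtain ⟨δ₂, hδ₂, hR⟩ := exists_shell (P := fun ε p => 0 < ρ ε ((1 + δ) • p)) fun u hu =>
    (hsign (1 + δ) ⟨by linarith, le_rfl⟩ u hu).eventually_const_lt (by nlinarith)
  refine ⟨δ, ?_⟩
  filter_upwards [hE, hL, hR, h.2.1, self_mem_nhdsWithin] with ε hε hl hr hsm hpos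
  refine ⟨hpos, hδ1, hδ, hsm, hΩr, fun u hu r hr => ?_,
    fun u hu r hr => (hε u hu r (hshell r hr).1).2.2.1, fun u hu r hr => ?_, fun u hu => ?_,
    fun u hu => ?_⟩
  · have := (hε u hu r (hshell r hr).1).2.1
    rw [map_smul, smul_eq_mul] at this
    exact pos_of_mul_pos_right this (hshell r hr).2.le
  · have := (hε u hu r (hshell r hr).1).2.2.2
    rwa [radialProj_smul (hshell r hr).2 hu] at this
  · simpa using hl u hu 1 (by simpa using hδ₁)
  · simpa using hr u hu 1 (by simpa using hδ₂)

end

/-- `Φ` parametrizes by `ℝ³` the part of `M` in the open set `W`, with an inverse that extends to a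
smooth map on `W`. -/
structure IsGlobalChart (M W : Set (ℂ × ℂ)) (Φ : ℝ × ℝ × ℝ → ℂ × ℂ) (Ψ : ℂ × ℂ → ℝ × ℝ × ℝ) :
    Prop where
  isOpen : IsOpen W
  continuous : Continuous Φ
  mem : ∀ x, Φ x ∈ W ∧ Φ x ∈ M
  left_inv : ∀ x, Ψ (Φ x) = x
  right_inv : ∀ p ∈ W, p ∈ M → Φ (Ψ p) = p
  smooth : ∀ n : WithTop ℕ∞, ∀ p ∈ W, ContDiffAt ℝ n Ψ p

theorem IsRadialShell.hasFDerivAt {Ω : Set (ℂ × ℂ)} {ρ : ℂ × ℂ → ℝ} {q : ℂ × ℂ → ℂ} {ε m δ : ℝ}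
    (h : IsRadialShell Ω ρ q ε m δ) (hΩ : IsOpen Ω) {u : ℂ × ℂ} (hu : u ∈ S3) {r : ℝ}
    (hr : r ∈ Icc (1 - δ) (1 + δ)) : HasFDerivAt ρ (fderiv ℝ ρ (r • u)) (r • u) :=
  ((h.smooth.contDiffAt (hΩ.mem_nhds (h.mem u hu r hr))).differentiableAt (by simp)).hasFDerivAt

/-- The zero set of `ρ` in a radial shell is a radial graph; stereographic coordinates on the sphere
without a point give coordinates on it. -/
theorem IsRadialShell.exists_isGlobalChart {Ω : Set (ℂ × ℂ)} {ρ : ℂ × ℂ → ℝ} {q : ℂ × ℂ → ℂ}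
    {ε m δ : ℝ} (h : IsRadialShell Ω ρ q ε m δ) (hΩ : IsOpen Ω)
    {σ : ℝ × ℝ × ℝ → ℂ × ℂ} {τ : ℂ × ℂ → ℝ × ℝ × ℝ} {D : Set (ℂ × ℂ)}
    (hσ : ∀ n : WithTop ℕ∞, ContDiff ℝ n σ) (hD : IsOpen D)
    (hτ : ∀ n : WithTop ℕ∞, ∀ p ∈ D, ContDiffAt ℝ n τ p) (hσD : ∀ x, σ x ∈ S3 ∧ σ x ∈ D)
    (hτσ : ∀ x, τ (σ x) = x) (hστ : ∀ p ∈ S3, p ∈ D → σ (τ p) = p) :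
    ∃ (r : ℝ × ℝ × ℝ → ℝ) (W : Set (ℂ × ℂ)), (∀ x, r x ∈ Icc (1 - δ) (1 + δ)) ∧
      IsGlobalChart (hypersurface Ω ρ) W (fun x => r x • σ x) (fun p => τ (radialProj p)) ∧
      (AnalyticOnNhd ℝ ρ Ω → ∀ x, AnalyticAt ℝ (fun x => r x • σ x) x) := by
  have hσc : Continuous σ := (hσ 0).continuous
  have hδ := h.delta_pos
  have hδ1 := h.lt_one
  have hfs : ∀ x, ∀ s ∈ Icc (1 - δ) (1 + δ),
      HasDerivAt (fun s : ℝ => ρ (s • σ x)) (fderiv ℝ ρ (s • σ x) (σ x)) s := by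
    intro x s hs
    have h1 : HasDerivAt (fun s : ℝ => s • σ x) (σ x) s := by
      simpa using (hasDerivAt_id s).smul_const (σ x)
    exact (h.hasFDerivAt hΩ (hσD x).1 hs).comp_hasDerivAt s h1
  have hcs : ∀ x, ContinuousOn (fun s : ℝ => ρ (s • σ x)) (Icc (1 - δ) (1 + δ)) := fun x s hs =>
    (hfs x s hs).continuousAt.continuousWithinAt
  have hmono : ∀ x, StrictMonoOn (fun s : ℝ => ρ (s • σ x)) (Icc (1 - δ) (1 + δ)) := by
    intro x
    refine strictMonoOn_of_deriv_pos (convex_Icc _ _) (hcs x) fun s hs => ?_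
    have hs' := interior_subset hs
    rw [(hfs x s hs').deriv]
    exact h.fderiv_pos _ (hσD x).1 s hs'
  have hcx : ∀ s ∈ Icc (1 - δ) (1 + δ), Continuous fun x => ρ (s • σ x) := fun s hs =>
    continuous_iff_continuousAt.2 fun x =>
      (h.hasFDerivAt hΩ (hσD x).1 hs).continuousAt.comp
        (f := fun x => s • σ x) (hσc.const_smul s).continuousAt
  obtain ⟨r, hrc, hr⟩ := exists_continuous_root (f := fun x s => ρ (s • σ x))
    (by linarith : 1 - δ < 1 + δ) hmono hcs hcx (fun x => h.neg_left _ (hσD x).1)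
    (fun x => h.pos_right _ (hσD x).1)
  have hrI : ∀ x, r x ∈ Icc (1 - δ) (1 + δ) := fun x => Ioo_subset_Icc_self (hr x).1
  have hr0 : ∀ x, 0 < r x := fun x => by linarith [(hrI x).1]
  have hproj : ∀ x, radialProj (r x • σ x) = σ x := fun x => radialProj_smul (hr0 x) (hσD x).1
  have hnorm : ∀ x, euclNorm (r x • σ x) = r x := fun x => by
    rw [euclNorm_smul (hr0 x).le, euclNorm_eq_one (hσD x).1, mul_one]
  have hcp : ContinuousOn radialProj ({0}ᶜ : Set (ℂ × ℂ)) := fun p hp =>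
    (contDiffAt_radialProj (n := 0) hp).continuousAt.continuousWithinAt
  refine ⟨r, ({0}ᶜ ∩ radialProj ⁻¹' D) ∩ euclNorm ⁻¹' Ioo (1 - δ) (1 + δ), hrI, ⟨?_, ?_, ?_, ?_,
    ?_, ?_⟩, ?_⟩
  · exact (hcp.isOpen_inter_preimage isOpen_compl_singleton hD).inter
      (isOpen_Ioo.preimage continuous_euclNorm)
  · exact hrc.smul hσc
  · refine fun x => ⟨⟨⟨?_, ?_⟩, ?_⟩, h.mem _ (hσD x).1 _ (hrI x), (hr x).2.1⟩
    · exact smul_ne_zero (hr0 x).ne' (ne_zero_of_mem_S3 (hσD x).1)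
    · change radialProj (r x • σ x) ∈ D
      rw [hproj]; exact (hσD x).2
    · change euclNorm (r x • σ x) ∈ Ioo (1 - δ) (1 + δ)
      rw [hnorm]; exact (hr x).1
  · intro x
    rw [hproj, hτσ]
  · rintro p ⟨⟨hp0, hpD⟩, hpI⟩ hpM
    have h1 := hστ _ (radialProj_mem hp0) hpD
    have h2 := euclNorm_smul_radialProj hp0
    rw [h1, ← (hr _).2.2 (euclNorm p) (Ioo_subset_Icc_self hpI) (by rw [h1, h2]; exact hpM.2), h2]
  · rintro n p ⟨⟨hp0, hpD⟩, -⟩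
    exact (hτ n _ hpD).comp p (contDiffAt_radialProj hp0)
  · intro han x
    have hσa : AnalyticAt ℝ σ x := (hσ ω).contDiffAt.analyticAt
    have hG : AnalyticAt ℝ (fun y : (ℝ × ℝ × ℝ) × ℝ => y.2 • σ y.1) (x, r x) :=
      analyticAt_snd.smul (AnalyticAt.fun_comp_of_eq hσa analyticAt_fst rfl)
    have hF : AnalyticAt ℝ (fun y : (ℝ × ℝ × ℝ) × ℝ => ρ (y.2 • σ y.1)) (x, r x) :=
      AnalyticAt.fun_comp_of_eq (han _ (h.mem _ (hσD x).1 _ (hrI x))) hG rfl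
    have hd : fderiv ℝ (fun y : (ℝ × ℝ × ℝ) × ℝ => ρ (y.2 • σ y.1)) (x, r x) (0, 1) =
        fderiv ℝ ρ (r x • σ x) (σ x) := by
      have h1 : HasDerivAt (fun s : ℝ => ((x, s) : (ℝ × ℝ × ℝ) × ℝ)) (0, 1) (r x) :=
        (hasDerivAt_const _ _).prodMk (hasDerivAt_id _)
      exact (hF.differentiableAt.hasFDerivAt.comp_hasDerivAt (r x) h1).unique (hfs x _ (hrI x))
    obtain ⟨φ, hφ, hφx, hφe⟩ := exists_analytic_implicit hF (hr x).2.1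
      (by rw [hd]; exact (h.fderiv_pos _ (hσD x).1 _ (hrI x)).ne')
    have hφr : φ =ᶠ[𝓝 x] r := by
      have h1 : Tendsto φ (𝓝 x) (𝓝 (r x)) := hφx ▸ hφ.continuousAt.tendsto
      have h2 : Tendsto (fun y => (y, φ y)) (𝓝 x) (𝓝 (x, r x)) := tendsto_id.prodMk_nhds h1
      filter_upwards [h2.eventually hφe, h1.eventually (isOpen_Ioo.mem_nhds (hr x).1)] with y h3 h4
      exact (hr y).2.2 _ (Ioo_subset_Icc_self h4) (h3.2 rfl)
    exact (hφ.congr hφr).smul hσa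

/-! ### Winding of the umbilical tensor in the chart -/

/-- A closed curve is approximated by a polynomial, corrected by a linear term to close up. -/
theorem exists_smooth_loop_near_real {f : ℝ → ℝ} (hf : ContinuousOn f (Icc 0 1)) (h01 : f 0 = f 1)
    {η : ℝ} (hη : 0 < η) :
    ∃ g : ℝ → ℝ, ContDiff ℝ 1 g ∧ g 0 = g 1 ∧ ∀ t ∈ Icc (0 : ℝ) 1, |g t - f t| < η := by
  obtain ⟨p, hp⟩ := exists_polynomial_near_of_continuousOn 0 1 f hf (η / 3) (by positivity)
  refine ⟨fun t => p.eval t - t * (p.eval 1 - p.eval 0), ?_, by ring, fun t ht => ?_⟩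
  · have hp : ContDiff ℝ 1 fun t : ℝ => p.eval t := by simpa using p.contDiff_aeval (𝕜 := ℝ) 1
    exact hp.sub (contDiff_id.mul contDiff_const)
  · have h0 := abs_lt.1 (hp 0 (by simp))
    have h1 := abs_lt.1 (hp 1 (by simp))
    have h2 := abs_lt.1 (hp t ht)
    have h3 : |t * (p.eval 1 - p.eval 0)| ≤ 1 * (2 * (η / 3)) := by
      rw [abs_mul, abs_of_nonneg ht.1]
      refine mul_le_mul ht.2 (abs_le.2 ⟨?_, ?_⟩) (abs_nonneg _) zero_le_one <;> linarith
    have h4 := abs_le.1 h3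
    rw [abs_lt]
    constructor <;> linarith

theorem exists_smooth_loop_near_complex {f : ℝ → ℂ} (hf : ContinuousOn f (Icc 0 1))
    (h01 : f 0 = f 1) {η : ℝ} (hη : 0 < η) :
    ∃ g : ℝ → ℂ, ContDiff ℝ 1 g ∧ g 0 = g 1 ∧ ∀ t ∈ Icc (0 : ℝ) 1, ‖g t - f t‖ < η := by
  obtain ⟨a, ha, ha01, haf⟩ := exists_smooth_loop_near_real (f := fun t => (f t).re)
    (Complex.continuous_re.comp_continuousOn hf) (by rw [h01]) (half_pos hη)
  obtain ⟨b, hb, hb01, hbf⟩ := exists_smooth_loop_near_real (f := fun t => (f t).im)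
    (Complex.continuous_im.comp_continuousOn hf) (by rw [h01]) (half_pos hη)
  refine ⟨fun t => (a t : ℂ) + (b t : ℂ) * Complex.I, ?_, by simp only [ha01, hb01], fun t ht => ?_⟩
  · exact (Complex.ofRealCLM.contDiff.comp ha).add
      ((Complex.ofRealCLM.contDiff.comp hb).mul contDiff_const)
  · refine (Complex.norm_le_abs_re_add_abs_im _).trans_lt ?_
    have h1 := haf t ht
    have h2 := hbf t ht
    simp only [Complex.sub_re, Complex.sub_im, Complex.add_re, Complex.add_im, Complex.ofReal_re,
      Complex.ofReal_im, Complex.re_ofReal_mul, Complex.im_ofReal_mul, Complex.I_re, Complex.I_im,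
      mul_zero, mul_one, add_zero, zero_add]
    linarith

/-- A closed curve on the sphere may be replaced by the radial projection of a smooth one without
changing the winding number of `q`. Such a curve misses points where `q ≠ 0`, since the cone over
a smooth curve has dimension at most `2`. -/
theorem exists_sphere_loop {q : ℂ × ℂ → ℂ} (hq : ContinuousOn q S3) {Γ : ℝ → ℂ × ℂ}
    (hΓ : IsClosedCurveIn Γ S3) (h0 : ∀ t ∈ Icc (0 : ℝ) 1, q (Γ t) ≠ 0) {n : ℤ}
    (hn : HasWinding (fun t => q (Γ t)) n) :
    ∃ (Γ' : ℝ → ℂ × ℂ) (a : ℂ × ℂ), IsClosedCurveIn Γ' S3 ∧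
      (∀ t ∈ Icc (0 : ℝ) 1, q (Γ' t) ≠ 0) ∧ HasWinding (fun t => q (Γ' t)) n ∧ a ∈ S3 ∧
      q a ≠ 0 ∧ ∀ t ∈ Icc (0 : ℝ) 1, Γ' t ≠ a := by
  obtain ⟨hΓc, hΓ01, hΓm⟩ := hΓ
  have hqr : ContinuousOn (fun p => q (radialProj p)) ({0}ᶜ : Set (ℂ × ℂ)) :=
    hq.comp (fun p hp => (contDiffAt_radialProj (n := 0) hp).continuousAt.continuousWithinAt)
      fun p hp => radialProj_mem hp
  have hqc : ContinuousOn (fun t => q (Γ t)) (Icc 0 1) := hq.comp hΓc hΓm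
  have hK : IsCompact (Γ '' Icc 0 1) := isCompact_Icc.image_of_continuousOn hΓc
  obtain ⟨t₀, ht₀, hmin⟩ := isCompact_Icc.exists_isMinOn (nonempty_Icc.2 zero_le_one) hqc.norm
  have hc : 0 < ‖q (Γ t₀)‖ := norm_pos_iff.2 (h0 t₀ ht₀)
  have hu := hK.uniformContinuousAt_of_continuousAt (fun p => q (radialProj p))
    (by
      rintro _ ⟨t, ht, rfl⟩
      exact hqr.continuousAt (isOpen_compl_singleton.mem_nhds (ne_zero_of_mem_S3 (hΓm ht))))
    (Metric.dist_mem_uniformity hc)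
  obtain ⟨η₁, hη₁, hηu⟩ := Metric.mem_uniformity_dist.1 hu
  have hz : ∃ η₂ > 0, ∀ t ∈ Icc (0 : ℝ) 1, η₂ ≤ ‖Γ t‖ := by
    obtain ⟨t₁, ht₁, hmin₁⟩ := isCompact_Icc.exists_isMinOn (nonempty_Icc.2 zero_le_one) hΓc.norm
    exact ⟨‖Γ t₁‖, norm_pos_iff.2 (ne_zero_of_mem_S3 (hΓm ht₁)), fun t ht => hmin₁ ht⟩
  obtain ⟨η₂, hη₂, hηz⟩ := hz
  have hη := lt_min hη₁ hη₂
  obtain ⟨g₁, hg₁, hg₁01, hg₁f⟩ := exists_smooth_loop_near_complex (f := fun t => (Γ t).1)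
    (continuous_fst.comp_continuousOn hΓc) (by rw [hΓ01]) hη
  obtain ⟨g₂, hg₂, hg₂01, hg₂f⟩ := exists_smooth_loop_near_complex (f := fun t => (Γ t).2)
    (continuous_snd.comp_continuousOn hΓc) (by rw [hΓ01]) hη
  obtain ⟨P, hP, hP01, hPf⟩ : ∃ P : ℝ → ℂ × ℂ, ContDiff ℝ 1 P ∧ P 0 = P 1 ∧
      ∀ t ∈ Icc (0 : ℝ) 1, ‖P t - Γ t‖ < min η₁ η₂ :=
    ⟨fun t => (g₁ t, g₂ t), hg₁.prodMk hg₂, by simp only [hg₁01, hg₂01], fun t ht => by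
      rw [Prod.norm_def]
      exact max_lt (hg₁f t ht) (hg₂f t ht)⟩
  have hP0 : ∀ t ∈ Icc (0 : ℝ) 1, P t ≠ 0 := by
    intro t ht h
    have h1 := (hPf t ht).trans_le (min_le_right _ _)
    rw [h, zero_sub, norm_neg] at h1
    exact absurd (hηz t ht) (not_le.2 h1)
  have hclose : ∀ t ∈ Icc (0 : ℝ) 1, ‖q (radialProj (P t)) - q (Γ t)‖ < ‖q (Γ t)‖ := by
    intro t ht
    have h1 : dist (Γ t) (P t) < η₁ := by
      rw [dist_comm, dist_eq_norm]
      exact (hPf t ht).trans_le (min_le_left _ _)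
    have h2 : dist (q (radialProj (Γ t))) (q (radialProj (P t))) < ‖q (Γ t₀)‖ :=
      hηu h1 ⟨t, ht, rfl⟩
    rw [radialProj_of_mem (hΓm ht), dist_comm, dist_eq_norm] at h2
    exact h2.trans_le (hmin ht)
  have hne : ∀ t ∈ Icc (0 : ℝ) 1, q (radialProj (P t)) ≠ 0 := by
    intro t ht h
    have h1 := hclose t ht
    rw [h, zero_sub, norm_neg] at h1
    exact lt_irrefl _ h1
  have hPc : ContinuousOn P (Icc 0 1) := hP.continuous.continuousOn
  have hqP : ContinuousOn (fun t => q (radialProj (P t))) (Icc 0 1) := hqr.comp hPc hP0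
  have hrad : ContinuousOn (fun t => radialProj (P t)) (Icc 0 1) := fun t ht =>
    (contDiffAt_radialProj (n := 0) (hP0 t ht)).continuousAt.comp_continuousWithinAt (hPc t ht)
  have hdense : Dense (lineCone (0 : ℂ × ℂ) (P '' Icc 0 1))ᶜ := by
    refine dense_compl_of_dimH_lt_finrank
      ((dimH_lineCone_image_le 0 (convex_Icc 0 1) hP.contDiffOn).trans_lt ?_)
    have : Module.finrank ℝ (ℂ × ℂ) = 4 := by simp [Module.finrank_prod]
    rw [this]
    norm_num
  have hnear : ∀ᶠ p in 𝓝 (Γ 0), p ≠ 0 ∧ q (radialProj p) ≠ 0 := by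
    have hm : (0 : ℝ) ∈ Icc (0 : ℝ) 1 := by simp
    have h1 := isOpen_compl_singleton.mem_nhds (ne_zero_of_mem_S3 (hΓm hm))
    have h2 := (hqr.continuousAt h1).eventually_ne
      (by rw [radialProj_of_mem (hΓm hm)]; exact h0 0 hm)
    exact Filter.Eventually.and (p := fun p => p ≠ 0) h1 h2
  obtain ⟨p, ⟨hp0, hqp⟩, hpc⟩ := mem_closure_iff_nhds.1 (hdense (Γ 0)) _ hnear
  refine ⟨fun t => radialProj (P t), radialProj p, ⟨hrad, by simp only [hP01],
    fun t ht => radialProj_mem (hP0 t ht)⟩, hne,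
    hn.of_norm_sub_lt hqP hqc (by simp only [hP01]) (by simp only [hΓ01]) hclose,
    radialProj_mem hp0, hqp, fun t ht h => hpc ⟨P t, ⟨t, ht, rfl⟩,
      euclNorm p * (euclNorm (P t))⁻¹, ?_⟩⟩
  rw [zero_add, sub_zero, mul_smul]
  change p = euclNorm p • radialProj (P t)
  rw [show radialProj (P t) = radialProj p from h, euclNorm_smul_radialProj hp0]

/-- Multiplication by a non-zero constant does not change the winding number. -/
theorem HasWinding.const_mul {f : ℝ → ℂ} {n : ℤ} (h : HasWinding f n) {c : ℂ} (hc : c ≠ 0) :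
    HasWinding (fun t => c * f t) n := by
  obtain ⟨θ, h1, h2, h3⟩ := h
  refine ⟨fun t => Complex.log c + θ t, continuousOn_const.add h1, fun t ht => ?_, ?_⟩
  · rw [Complex.exp_add, Complex.exp_log hc, h2 t ht]
  · rw [add_sub_add_left_eq_sub, h3]

section

/-- A parametrization by `ℝ³` of a part of the zero set of `ρ`, on which `J̃` is close to `1`, with
the behaviour of `det A₃` inherited from `Q'`: it has a logarithm near infinity and a non-zero
winding number along some closed curve. -/
structure IsUmbilicChart (Ω : Set (ℂ × ℂ)) (ρ : ℂ × ℂ → ℝ) (W : Set (ℂ × ℂ))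
    (Φ : ℝ × ℝ × ℝ → ℂ × ℂ) (Ψ : ℂ × ℂ → ℝ × ℝ × ℝ) : Prop where
  chart : IsGlobalChart (hypersurface Ω ρ) W Φ Ψ
  smooth : ContDiffOn ℝ ∞ ρ Ω
  jtilde : ∀ x, ‖Jtilde ρ (Φ x) - 1‖ < 1 / 2
  analytic : AnalyticOnNhd ℝ ρ Ω → ∀ x, AnalyticAt ℝ Φ x
  log_at_infty : ∃ (R : ℝ) (h : ℝ × ℝ × ℝ → ℂ), ContinuousOn h {x | R < ‖x‖} ∧
    ∀ x, R < ‖x‖ → Complex.exp (h x) = (A3 ρ (Φ x)).det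
  loop : ∃ (γ : ℝ → ℝ × ℝ × ℝ) (n : ℤ), ContinuousOn γ (Icc 0 1) ∧ γ 0 = γ 1 ∧ n ≠ 0 ∧
    HasWinding (fun t => (A3 ρ (Φ (γ t))).det) n

variable {Ω : Set (ℂ × ℂ)} {ρ : ℝ → ℂ × ℂ → ℝ} {ρ' : ℂ × ℂ → ℝ}

theorem mem_slitPlane_of_norm_sub_one_lt {z : ℂ} (h : ‖z - 1‖ < 1) : z ∈ Complex.slitPlane :=
  Complex.ball_one_subset_slitPlane (by rwa [Metric.mem_ball, dist_eq_norm])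

/-- For small `ε` the perturbed hypersurface has a chart that misses only the radius through a point
`a` of the sphere with `Q' a ≠ 0`, off a closed curve along which `Q'` has the given winding number.
On that curve and near `a`, `det A₃` is so close to `12 ε Q'` that it inherits the winding number and
the local logarithm of `Q'`. -/
theorem IsSpherePerturbation.exists_isUmbilicChart (h : IsSpherePerturbation Ω ρ ρ')
    (hΩ : IsOpen Ω) (hS : S3 ⊆ Ω) {Γ : ℝ → ℂ × ℂ} (hΓ : IsClosedCurveIn Γ S3)
    (h0 : ∀ t ∈ Icc (0 : ℝ) 1, Qprime ρ' (Γ t) ≠ 0) {n : ℤ} (hn0 : n ≠ 0)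
    (hn : HasWinding (fun t => Qprime ρ' (Γ t)) n) :
    ∀ᶠ ε in 𝓝[>] (0 : ℝ), ∃ W Φ Ψ, IsUmbilicChart Ω (ρ ε) W Φ Ψ := by
  have hqΩ := h.continuousOn_Qprime hΩ
  obtain ⟨Γ', a, ⟨hΓc, hΓ01, hΓm⟩, hΓ0, hΓn, ha, hqa, hΓa⟩ :=
    exists_sphere_loop (hqΩ.mono hS) hΓ h0 hn
  obtain ⟨σ, τ, D, hσ, hD, hτ, hσD, hτσ, hστ, hDa⟩ := exists_sphere_chart ha
  have hqΓ : ContinuousOn (fun t => Qprime ρ' (Γ' t)) (Icc 0 1) :=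
    hqΩ.comp hΓc fun t ht => hS (hΓm ht)
  obtain ⟨t₀, ht₀, hmin⟩ := isCompact_Icc.exists_isMinOn (nonempty_Icc.2 zero_le_one) hqΓ.norm
  -- a bound for the error in `det A₃ / ε ≈ 12 Q'` that is harmless along the curve and near `a`
  have hm0 : 0 < min ‖Qprime ρ' (Γ' t₀)‖ ‖Qprime ρ' a‖ :=
    lt_min (norm_pos_iff.2 (hΓ0 t₀ ht₀)) (norm_pos_iff.2 hqa)
  obtain ⟨m, hm, hmm⟩ : ∃ m > 0, m ≤ ‖Qprime ρ' (Γ' t₀)‖ ∧ m ≤ ‖Qprime ρ' a‖ :=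
    ⟨_, hm0, min_le_left _ _, min_le_right _ _⟩
  -- Near the missing point `a`, that is near infinity in the chart, `Q'` is almost constant.
  have hR : ∃ R : ℝ, ∀ x, R < ‖x‖ → ‖Qprime ρ' (σ x) - Qprime ρ' a‖ < ‖Qprime ρ' a‖ / 2 := by
    have h1 : ∀ᶠ u in 𝓝 a, ‖Qprime ρ' u - Qprime ρ' a‖ < ‖Qprime ρ' a‖ / 2 := by
      have h2 := ((hqΩ.continuousAt (hΩ.mem_nhds (hS ha))).tendsto.sub_const
        (Qprime ρ' a)).norm
      rw [sub_self, norm_zero] at h2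
      exact h2.eventually_lt_const (half_pos (norm_pos_iff.2 hqa))
    obtain ⟨N, hN, hNo, haN⟩ := eventually_nhds_iff.1 h1
    have hK : IsCompact (S3 \ N) := isCompact_S3.diff hNo
    have hKD : ∀ p ∈ S3 \ N, p ∈ D := fun p hp => hDa p hp.1 fun hpa => hp.2 (hpa ▸ haN)
    obtain ⟨R, hR⟩ := (hK.image_of_continuousOn (f := τ) fun p hp =>
      (hτ 0 p (hKD p hp)).continuousAt.continuousWithinAt).isBounded.exists_norm_le
    refine ⟨R, fun x hx => hN _ ?_⟩
    by_contra hxN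
    exact absurd (hR _ ⟨σ x, ⟨(hσD x).1, hxN⟩, hτσ x⟩) (not_le.2 hx)
  obtain ⟨R, hR⟩ := hR
  obtain ⟨δ, hδ⟩ := h.exists_isRadialShell hΩ hS hm
  filter_upwards [hδ] with ε hε
  obtain ⟨r, W, hr, hW, han⟩ := hε.exists_isGlobalChart hΩ hσ hD hτ hσD hτσ hστ
  have hε0 : (ε : ℂ) ≠ 0 := by exact_mod_cast hε.pos.ne'
  have hdetΩ : ContinuousOn (fun p => (A3 (ρ ε) p).det) Ω :=
    (contDiffOn_det_A3 hΩ infty_add_one_le hε.smooth).continuousOn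
  have hdet : Continuous fun x => (A3 (ρ ε) (r x • σ x)).det :=
    have key : ∀ d : ℂ × ℂ → ℂ, ContinuousOn d Ω → Continuous fun x => d (r x • σ x) :=
      fun d hd => hd.comp_continuous hW.continuous fun x => (hW.mem x).2.1
    key _ hdetΩ
  refine ⟨W, _, _, hW, hε.smooth, fun x => hε.jtilde _ (hσD x).1 _ (hr x), han, ?_, ?_⟩
  · set c : ℂ := ε * (12 * Qprime ρ' a) with hc
    have hc0 : c ≠ 0 := mul_ne_zero hε0 (mul_ne_zero (by norm_num) hqa)
    have hslit : ∀ x, R < ‖x‖ → (A3 (ρ ε) (r x • σ x)).det / c ∈ Complex.slitPlane := by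
      intro x hx
      have h1 := hε.det _ (hσD x).1 _ (hr x)
      have h2 := hR x hx
      have hq : (12 * Qprime ρ' a : ℂ) ≠ 0 := mul_ne_zero (by norm_num) hqa
      apply mem_slitPlane_of_norm_sub_one_lt
      rw [show (A3 (ρ ε) (r x • σ x)).det / c - 1 =
        (((A3 (ρ ε) (r x • σ x)).det / ε - 12 * Qprime ρ' (σ x)) +
          12 * (Qprime ρ' (σ x) - Qprime ρ' a)) / (12 * Qprime ρ' a) by
            rw [hc]; field_simp; ring, norm_div, div_lt_one (norm_pos_iff.2 hq)]
      refine (norm_add_le _ _).trans_lt ?_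
      rw [norm_mul, norm_mul, Complex.norm_ofNat]
      linarith [hmm.2, norm_nonneg (Qprime ρ' a)]
    refine ⟨R, fun x => Complex.log c + Complex.log ((A3 (ρ ε) (r x • σ x)).det / c), ?_,
      fun x hx => ?_⟩
    · exact continuousOn_const.add ((hdet.div_const c).continuousOn.clog hslit)
    · rw [Complex.exp_add, Complex.exp_log hc0,
        Complex.exp_log (Complex.slitPlane_ne_zero (hslit x hx)), mul_div_cancel₀ _ hc0]
  · have hΓD : ∀ t ∈ Icc (0 : ℝ) 1, Γ' t ∈ D := fun t ht => hDa _ (hΓm ht) (hΓa t ht)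
    have hγc : ContinuousOn (fun t => τ (Γ' t)) (Icc 0 1) := fun t ht =>
      (hτ 0 _ (hΓD t ht)).continuousAt.comp_continuousWithinAt (hΓc t ht)
    have hdetγ : ContinuousOn
        (fun t => (A3 (ρ ε) (r (τ (Γ' t)) • σ (τ (Γ' t)))).det / (ε : ℂ)) (Icc 0 1) := by
      have key : ∀ d : ℝ × ℝ × ℝ → ℂ, Continuous d →
          ContinuousOn (fun t => d (τ (Γ' t)) / (ε : ℂ)) (Icc 0 1) :=
        fun d hd => (hd.comp_continuousOn hγc).div_const _
      exact key _ hdet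
    have hwin : HasWinding (fun t => (A3 (ρ ε) (r (τ (Γ' t)) • σ (τ (Γ' t)))).det / ε) n := by
      refine (hΓn.const_mul (c := 12) (by norm_num)).of_norm_sub_lt
        hdetγ (continuousOn_const.mul hqΓ)
        (by simp only [hΓ01]) (by simp only [hΓ01]) fun t ht => ?_
      have h1 := hε.det _ (hσD (τ (Γ' t))).1 _ (hr (τ (Γ' t)))
      rw [hστ _ (hΓm ht) (hΓD t ht)] at h1 ⊢
      refine h1.trans_le ?_
      rw [norm_mul, Complex.norm_ofNat]
      have h2 : ‖Qprime ρ' (Γ' t₀)‖ ≤ ‖Qprime ρ' (Γ' t)‖ := hmin ht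
      linarith [hmm.1, norm_nonneg (Qprime ρ' (Γ' t))]
    refine ⟨fun t => τ (Γ' t), n, hγc, by simp only [hΓ01], hn0, ?_⟩
    have h3 := hwin.const_mul hε0
    simp only [mul_div_cancel₀ _ hε0] at h3
    exact h3

end

/-! ### Umbilical points of the perturbed hypersurface -/

namespace IsUmbilicChart

variable {Ω : Set (ℂ × ℂ)} {ρ : ℂ × ℂ → ℝ} {W : Set (ℂ × ℂ)}
    {Φ : ℝ × ℝ × ℝ → ℂ × ℂ} {Ψ : ℂ × ℂ → ℝ × ℝ × ℝ}

/-- `det A₃` in the chart. -/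
def coeff (ρ : ℂ × ℂ → ℝ) (Φ : ℝ × ℝ × ℝ → ℂ × ℂ) (x : ℝ × ℝ × ℝ) : ℂ := (A3 ρ (Φ x)).det

theorem continuous_coeff (h : IsUmbilicChart Ω ρ W Φ Ψ) (hΩ : IsOpen Ω) :
    Continuous (coeff ρ Φ) := by
  have h1 : ContinuousOn (fun p => (A3 ρ p).det) Ω :=
    (contDiffOn_det_A3 hΩ infty_add_one_le h.smooth).continuousOn
  have key : ∀ d : ℂ × ℂ → ℂ, ContinuousOn d Ω → Continuous fun x => d (Φ x) :=
    fun d hd => hd.comp_continuous h.chart.continuous fun x => (h.chart.mem x).2.1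
  exact key _ h1

theorem continuous_Jtilde (h : IsUmbilicChart Ω ρ W Φ Ψ) (hΩ : IsOpen Ω) :
    Continuous fun x => Jtilde ρ (Φ x) := by
  have h1 : ContinuousOn (Jtilde ρ) Ω :=
    (contDiffOn_Jtilde hΩ infty_add_one_le h.smooth).continuousOn
  exact h1.comp_continuous h.chart.continuous fun x => (h.chart.mem x).2.1

theorem Jtilde_mem_slitPlane (h : IsUmbilicChart Ω ρ W Φ Ψ) (x : ℝ × ℝ × ℝ) :
    Jtilde ρ (Φ x) ∈ Complex.slitPlane :=
  mem_slitPlane_of_norm_sub_one_lt ((h.jtilde x).trans (by norm_num))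

theorem Jtilde_ne_zero (h : IsUmbilicChart Ω ρ W Φ Ψ) (x : ℝ × ℝ × ℝ) : Jtilde ρ (Φ x) ≠ 0 :=
  Complex.slitPlane_ne_zero (h.Jtilde_mem_slitPlane x)

theorem mem_umbilicLocus_iff (h : IsUmbilicChart Ω ρ W Φ Ψ) {x : ℝ × ℝ × ℝ} :
    Φ x ∈ umbilicLocus Ω ρ ↔ coeff ρ Φ x = 0 := by
  have h1 := h.Jtilde_ne_zero x
  constructor
  · rintro ⟨-, -, h2⟩
    rw [Q, div_eq_zero_iff] at h2
    exact h2.resolve_right fun h3 => h1 ((Complex.cpow_eq_zero_iff _ _).1 h3).1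
  · intro h2
    exact ⟨(h.chart.mem x).2, h1, by rw [Q, show (A3 ρ (Φ x)).det = 0 from h2, zero_div]⟩

/-- In the chart, `J̃` has a logarithm, so `Q` and `det A₃` have the same winding numbers. -/
theorem hasWinding_Q (h : IsUmbilicChart Ω ρ W Φ Ψ) (hΩ : IsOpen Ω) {γ : ℝ → ℝ × ℝ × ℝ}
    (hγ : ContinuousOn γ (Icc 0 1)) (hγ01 : γ 0 = γ 1) {n : ℤ}
    (hn : HasWinding (fun t => coeff ρ Φ (γ t)) n) :
    HasWinding (fun t => Q ρ (Φ (γ t))) n := by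
  obtain ⟨θ, h1, h2, h3⟩ := hn
  have h4 : ContinuousOn (fun t => Jtilde ρ (Φ (γ t))) (Icc 0 1) :=
    (h.continuous_Jtilde hΩ).comp_continuousOn hγ
  refine ⟨fun t => θ t - Complex.log (Jtilde ρ (Φ (γ t))) * (25 / 3), h1.sub
    ((h4.clog fun t _ => h.Jtilde_mem_slitPlane _).mul continuousOn_const), fun t ht => ?_, ?_⟩
  · beta_reduce
    rw [Complex.exp_sub, h2 t ht, Q, Complex.cpow_def_of_ne_zero (h.Jtilde_ne_zero _)]
    rfl
  · beta_reduce
    rw [hγ01, sub_sub_sub_cancel_right, h3]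

/-- Near an umbilical point that is not stable all closed curves have winding number `0`. -/
theorem exists_ball_of_not_stable (h : IsUmbilicChart Ω ρ W Φ Ψ) (hΩ : IsOpen Ω)
    {x : ℝ × ℝ × ℝ} (hx : coeff ρ Φ x = 0) (hst : ¬ IsStableUmbilic Ω ρ (Φ x)) :
    ∃ r > 0, ∀ y ∈ Metric.ball x r, ¬ IsStableUmbilic Ω ρ (Φ y) ∧
      ∀ γ : ℝ → ℝ × ℝ × ℝ, ContinuousOn γ (Icc 0 1) → γ 0 = γ 1 →
        MapsTo γ (Icc 0 1) (Metric.ball x r \ {x | coeff ρ Φ x = 0}) →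
        ∀ n : ℤ, HasWinding (fun t => coeff ρ Φ (γ t)) n → n = 0 := by
  have h1 : ∃ V ∈ 𝓝 (Φ x), ¬ ∃ γ : ℝ → ℂ × ℂ,
      IsClosedCurveIn γ (V ∩ (hypersurface Ω ρ \ umbilicLocus Ω ρ)) ∧
      ∃ I : ℚ, I ≠ 0 ∧ HasUmbilicalIndex ρ γ I := by
    by_contra! h2
    exact hst ⟨h.mem_umbilicLocus_iff.2 hx, h2⟩
  obtain ⟨V, hV, hVn⟩ := h1
  have h2 : ∀ᶠ y in 𝓝 x, ∀ᶠ p in 𝓝 (Φ y), p ∈ V :=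
    (h.chart.continuous.tendsto x).eventually (eventually_eventually_nhds.2 hV)
  obtain ⟨r, hr, hball⟩ := Metric.eventually_nhds_iff_ball.1 h2
  refine ⟨r, hr, fun y hy => ⟨fun hs => hVn (hs.2 V (hball y hy)), fun γ hγ h01 hm n hn => ?_⟩⟩
  by_contra hn0
  refine hVn ⟨fun t => Φ (γ t), ⟨h.chart.continuous.comp_continuousOn hγ, by simp only [h01],
    fun t ht => ⟨(hball _ (hm ht).1).self_of_nhds, (h.chart.mem _).2,
      fun hu => (hm ht).2 (h.mem_umbilicLocus_iff.1 hu)⟩⟩, -(1 / 2) * n, ?_, n,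
      h.hasWinding_Q hΩ hγ h01 hn, rfl⟩
  exact mul_ne_zero (by norm_num) (by exact_mod_cast hn0)

theorem isClosed_stable (h : IsUmbilicChart Ω ρ W Φ Ψ) (hΩ : IsOpen Ω) :
    IsClosed {x | IsStableUmbilic Ω ρ (Φ x)} := by
  rw [← isOpen_compl_iff, Metric.isOpen_iff]
  intro x hx
  by_cases hx0 : coeff ρ Φ x = 0
  · obtain ⟨r, hr, hball⟩ := h.exists_ball_of_not_stable hΩ hx0 hx
    exact ⟨r, hr, fun y hy => (hball y hy).1⟩
  · obtain ⟨r, hr, hball⟩ := Metric.eventually_nhds_iff_ball.1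
      ((h.continuous_coeff hΩ).continuousAt.eventually_ne hx0)
    exact ⟨r, hr, fun y hy hs => hball y hy (h.mem_umbilicLocus_iff.1 hs.1)⟩

/-- A closed set of umbilical points, off which the umbilical locus neither separates locally nor
carries local winding, contains a continuum: otherwise `det A₃` would have no winding at all. -/
theorem exists_continuum (h : IsUmbilicChart Ω ρ W Φ Ψ) (hΩ : IsOpen Ω)
    {Y : Set (ℝ × ℝ × ℝ)} (hYc : IsClosed Y) (hYZ : Y ⊆ {x | coeff ρ Φ x = 0})
    (hN : ∀ O : Set (ℝ × ℝ × ℝ), IsOpen O → Convex ℝ O → O.Nonempty → Disjoint O Y →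
      IsConnected (O \ {x | coeff ρ Φ x = 0}))
    (hY : ∀ x, coeff ρ Φ x = 0 → x ∉ Y → ∃ r > 0, ∀ γ : ℝ → ℝ × ℝ × ℝ,
      ContinuousOn γ (Icc 0 1) → γ 0 = γ 1 →
      MapsTo γ (Icc 0 1) (Metric.ball x r \ {x | coeff ρ Φ x = 0}) →
      ∀ n : ℤ, HasWinding (fun t => coeff ρ Φ (γ t)) n → n = 0) :
    ∃ C ⊆ Y, IsCompact C ∧ IsConnected C ∧ C.Nontrivial := by
  have hFc := h.continuous_coeff hΩ
  obtain ⟨R, lg, hlg, hlge⟩ := h.log_at_infty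
  have hYcomp : IsCompact Y := by
    refine Metric.isCompact_of_isClosed_isBounded hYc
      ((Metric.isBounded_closedBall (x := (0 : ℝ × ℝ × ℝ)) (r := R)).subset fun x hx => ?_)
    rw [mem_closedBall_zero_iff]
    by_contra hxR
    have h1 := hlge x (not_le.1 hxR)
    exact Complex.exp_ne_zero _ (h1.trans (hYZ hx))
  have hntd : ¬ IsTotallyDisconnected Y := by
    intro htd
    obtain ⟨γ, n, hγ, hγ01, hn0, hn⟩ := h.loop
    obtain ⟨θ, h1, h2, h3⟩ := id hn
    have h4 := log_periodic_of_isTotallyDisconnected (F := coeff ρ Φ) hYcomp htd hYZ hN ?_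
      ⟨R, lg, hlg.mono sdiff_subset, fun y hy => hlge y hy.1⟩ hγ hγ01
      (fun t ht h0 => Complex.exp_ne_zero _ ((h2 t ht).trans h0)) h1 h2
    · rw [h4, sub_self, eq_comm] at h3
      simp [Real.pi_ne_zero, hn0] at h3
    · intro x hx
      by_cases hx0 : coeff ρ Φ x = 0
      · obtain ⟨r₁, hr₁, hw⟩ := hY x hx0 hx
        obtain ⟨r₂, hr₂, hdis⟩ := Metric.isOpen_iff.1 hYc.isOpen_compl x hx
        have hr := lt_min hr₁ hr₂
        have hsub : Metric.ball x (min r₁ r₂) ⊆ Metric.ball x r₁ :=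
          Metric.ball_subset_ball (min_le_left _ _)
        obtain ⟨l, hl, hle⟩ := exists_log_of_forall_winding
          (O := Metric.ball x (min r₁ r₂) \ {x | coeff ρ Φ x = 0}) (F := coeff ρ Φ)
          (Metric.isOpen_ball.sdiff (isClosed_eq hFc continuous_const))
          (hN _ Metric.isOpen_ball (convex_ball _ _) (Metric.nonempty_ball.2 hr)
            (disjoint_left.2 fun y hy =>
              hdis (Metric.ball_subset_ball (min_le_right _ _) hy)))
          hFc.continuousOn (fun y hy => hy.2) fun γ hγ h01 hm n hn =>
            hw γ hγ h01 (fun t ht => ⟨hsub (hm ht).1, (hm ht).2⟩) n hn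
        exact ⟨_, hr, l, hl, hle⟩
      · have h5 : ∀ᶠ y in 𝓝 x, coeff ρ Φ y / coeff ρ Φ x ∈ Complex.slitPlane := by
          refine (hFc.div_const _).continuousAt.eventually (Complex.isOpen_slitPlane.mem_nhds ?_)
          beta_reduce
          rw [div_self hx0]
          exact Complex.one_mem_slitPlane
        obtain ⟨r, hr, hball⟩ := Metric.eventually_nhds_iff_ball.1 h5
        refine ⟨r, hr, fun y => Complex.log (coeff ρ Φ x) +
          Complex.log (coeff ρ Φ y / coeff ρ Φ x), ?_, fun y hy => ?_⟩
        · exact continuousOn_const.add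
            ((hFc.div_const _).continuousOn.clog fun y hy => hball y hy.1)
        · rw [Complex.exp_add, Complex.exp_log hx0,
            Complex.exp_log (Complex.slitPlane_ne_zero (hball y hy.1)), mul_div_cancel₀ _ hx0]
  obtain ⟨t, htY, htp, htn⟩ : ∃ t ⊆ Y, IsPreconnected t ∧ ¬ t.Subsingleton := by
    by_contra! h1
    exact hntd fun t ht htp => h1 t ht htp
  have htn' := not_subsingleton_iff.1 htn
  exact ⟨closure t, closure_minimal htY hYc,
    hYcomp.of_isClosed_subset isClosed_closure (closure_minimal htY hYc),
    (IsConnected.closure ⟨htn'.nonempty, htp⟩), htn'.mono subset_closure⟩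

end IsUmbilicChart

theorem omega_add_one_le : (ω : WithTop ℕ∞) + 1 ≤ ω := le_of_eq (by rfl)

theorem IsGlobalChart.image_continuum {M W : Set (ℂ × ℂ)} {Φ : ℝ × ℝ × ℝ → ℂ × ℂ}
    {Ψ : ℂ × ℂ → ℝ × ℝ × ℝ} (h : IsGlobalChart M W Φ Ψ) {C : Set (ℝ × ℝ × ℝ)} (hC : IsCompact C)
    (hCc : IsConnected C) (hCn : C.Nontrivial) : IsNondegenerateContinuum (Φ '' C) :=
  ⟨hC.image h.continuous, hCc.image Φ h.continuous.continuousOn,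
    hCn.image (Function.LeftInverse.injective h.left_inv)⟩

/-- The image under the chart of an open set is relatively open. -/
theorem IsGlobalChart.image_eq {M W : Set (ℂ × ℂ)} {Φ : ℝ × ℝ × ℝ → ℂ × ℂ}
    {Ψ : ℂ × ℂ → ℝ × ℝ × ℝ} (h : IsGlobalChart M W Φ Ψ) {O : Set (ℝ × ℝ × ℝ)} (hO : IsOpen O) :
    ∃ W' : Set (ℂ × ℂ), IsOpen W' ∧ W' ⊆ W ∧ Φ '' O = W' ∩ M := by
  have hΨ : ContinuousOn Ψ W := fun p hp => (h.smooth 0 p hp).continuousAt.continuousWithinAt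
  refine ⟨W ∩ Ψ ⁻¹' O, hΨ.isOpen_inter_preimage h.isOpen hO, inter_subset_left, ?_⟩
  ext p
  constructor
  · rintro ⟨x, hx, rfl⟩
    refine ⟨⟨(h.mem x).1, ?_⟩, (h.mem x).2⟩
    rw [mem_preimage, h.left_inv]
    exact hx
  · rintro ⟨⟨h1, h2⟩, h3⟩
    exact ⟨Ψ p, h2, h.right_inv p h1 h3⟩

namespace IsUmbilicChart

variable {Ω : Set (ℂ × ℂ)} {ρ : ℂ × ℂ → ℝ} {W : Set (ℂ × ℂ)}
    {Φ : ℝ × ℝ × ℝ → ℂ × ℂ} {Ψ : ℂ × ℂ → ℝ × ℝ × ℝ}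

/-- If the umbilical locus were totally disconnected, `det A₃` would have no winding. -/
theorem exists_umbilic_continuum (h : IsUmbilicChart Ω ρ W Φ Ψ) (hΩ : IsOpen Ω) :
    ∃ C, IsNondegenerateContinuum C ∧ C ⊆ umbilicLocus Ω ρ := by
  obtain ⟨C, hC, h1, h2, h3⟩ := h.exists_continuum hΩ
    (isClosed_eq (h.continuous_coeff hΩ) continuous_const) Subset.rfl
    (fun O _ hconv hne hdis => by
      rw [hdis.sdiff_eq_left]
      exact ⟨hne, hconv.isPreconnected⟩)
    (fun x hx hx' => absurd hx hx')
  refine ⟨Φ '' C, h.chart.image_continuum h1 h2 h3, ?_⟩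
  rintro _ ⟨x, hx, rfl⟩
  exact h.mem_umbilicLocus_iff.2 (hC hx)

/-- If the umbilical locus does not separate locally, the stable umbilical points contain a
continuum. -/
theorem exists_stable_continuum (h : IsUmbilicChart Ω ρ W Φ Ψ) (hΩ : IsOpen Ω)
    (hN : ∀ O : Set (ℝ × ℝ × ℝ), IsOpen O → Convex ℝ O → O.Nonempty →
      IsConnected (O \ {x | coeff ρ Φ x = 0})) :
    ∃ C ⊆ {x | IsStableUmbilic Ω ρ (Φ x)}, IsCompact C ∧ IsConnected C ∧ C.Nontrivial :=
  h.exists_continuum hΩ (h.isClosed_stable hΩ) (fun _ hx => h.mem_umbilicLocus_iff.1 hx.1)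
    (fun O hO hconv hne _ => hN O hO hconv hne) fun x hx hxs => by
      obtain ⟨r, hr, hball⟩ := h.exists_ball_of_not_stable hΩ hx hxs
      exact ⟨r, hr, (hball x (Metric.mem_ball_self hr)).2⟩

theorem isConnected_sdiff_of_not_locallySeparates (h : IsUmbilicChart Ω ρ W Φ Ψ)
    (hs : ¬ LocallySeparates (hypersurface Ω ρ) (umbilicLocus Ω ρ))
    {O : Set (ℝ × ℝ × ℝ)} (hO : IsOpen O) (hconv : Convex ℝ O) (hne : O.Nonempty) :
    IsConnected (O \ {x | coeff ρ Φ x = 0}) := by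
  obtain ⟨W', hW', hW'W, hW'O⟩ := h.chart.image_eq hO
  have h1 : IsConnected (Φ '' O \ umbilicLocus Ω ρ) := by
    by_contra h2
    exact hs ⟨Φ '' O, ⟨W', hW', hW'O⟩,
      IsConnected.image ⟨hne, hconv.isPreconnected⟩ Φ h.chart.continuous.continuousOn, h2⟩
  have h2 : Ψ '' (Φ '' O \ umbilicLocus Ω ρ) = O \ {x | coeff ρ Φ x = 0} := by
    ext x
    constructor
    · rintro ⟨_, ⟨⟨y, hy, rfl⟩, hyU⟩, rfl⟩
      rw [h.chart.left_inv]
      exact ⟨hy, fun hy0 => hyU (h.mem_umbilicLocus_iff.2 hy0)⟩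
    · rintro ⟨hx, hx0⟩
      exact ⟨Φ x, ⟨⟨x, hx, rfl⟩, fun hU => hx0 (h.mem_umbilicLocus_iff.1 hU)⟩, h.chart.left_inv x⟩
  rw [← h2]
  refine h1.image Ψ fun p hp => (h.chart.smooth 0 p ?_).continuousAt.continuousWithinAt
  obtain ⟨⟨x, -, rfl⟩, -⟩ := hp
  exact (h.chart.mem x).1

theorem analyticAt_normSq_coeff (h : IsUmbilicChart Ω ρ W Φ Ψ) (hΩ : IsOpen Ω)
    (han : AnalyticOnNhd ℝ ρ Ω) (x : ℝ × ℝ × ℝ) :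
    AnalyticAt ℝ (fun x => Complex.normSq (coeff ρ Φ x)) x := by
  have h1 : ContDiffOn ℝ ω (fun p => (A3 ρ p).det) Ω :=
    contDiffOn_det_A3 hΩ omega_add_one_le fun p hp => (han p hp).contDiffAt.contDiffWithinAt
  have h2 : AnalyticAt ℝ (fun p => (A3 ρ p).det) (Φ x) :=
    (h1.contDiffAt (hΩ.mem_nhds (h.chart.mem x).2.1)).analyticAt
  have key : ∀ d : ℂ × ℂ → ℂ, AnalyticAt ℝ d (Φ x) →
      AnalyticAt ℝ (fun x => Complex.normSq (d (Φ x))) x := by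
    intro d hd
    have h3 : AnalyticAt ℝ (fun x => d (Φ x)) x := hd.fun_comp (h.analytic han x)
    have h4 := AnalyticAt.fun_comp_of_eq (Complex.reCLM.analyticAt (d (Φ x))) h3 rfl
    have h5 := AnalyticAt.fun_comp_of_eq (Complex.imCLM.analyticAt (d (Φ x))) h3 rfl
    exact (h4.mul h4).add (h5.mul h5)
  exact key _ h2

/-- An analytic surface in the chart is a smooth surface in `ℂ²`, after rescaling its parameter
domain to the unit disk. -/
theorem containsSmoothSurface (h : IsUmbilicChart Ω ρ W Φ Ψ) (han : AnalyticOnNhd ℝ ρ Ω)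
    {A : Set (ℝ × ℝ × ℝ)} (hA : ContainsAnalyticSurface A)
    (hAU : ∀ x ∈ A, Φ x ∈ umbilicLocus Ω ρ) : ContainsSmoothSurface (umbilicLocus Ω ρ) := by
  obtain ⟨π, ψ, x, hψ, hx⟩ := hA
  obtain ⟨r, hr, hball⟩ := Metric.eventually_nhds_iff_ball.1 (hψ.eventually_analyticAt.and hx)
  set L : ℂ →L[ℝ] ℝ × ℝ := (r / 2) • (Complex.reCLM.prod Complex.imCLM) with hL
  have hLinj : Function.Injective L := by
    intro s t hst
    have h1 : (r / 2) • (s.re, s.im) = (r / 2) • (t.re, t.im) := hst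
    have h2 := smul_right_injective (ℝ × ℝ) (half_pos hr).ne' h1
    exact Complex.ext (congrArg Prod.fst h2) (congrArg Prod.snd h2)
  have hmem : ∀ t ∈ Metric.ball (0 : ℂ) 1, x + L t ∈ Metric.ball x r := by
    intro t ht
    rw [mem_ball_zero_iff] at ht
    have h1 : L t = (r / 2) • (t.re, t.im) := rfl
    have h2 : ‖(t.re, t.im)‖ ≤ 1 := by
      rw [Prod.norm_def]
      exact max_le ((Complex.abs_re_le_norm t).trans ht.le) ((Complex.abs_im_le_norm t).trans ht.le)
    rw [mem_ball_iff_norm, add_sub_cancel_left, h1, norm_smul, Real.norm_of_nonneg (half_pos hr).le]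
    nlinarith [norm_nonneg (t.re, t.im)]
  have hφa : ∀ t ∈ Metric.ball (0 : ℂ) 1, AnalyticAt ℝ (fun t => Φ (ψ (x + L t))) t := by
    intro t ht
    have h1 : AnalyticAt ℝ (fun t => x + L t) t := analyticAt_const.add (L.analyticAt t)
    have h2 : AnalyticAt ℝ (fun t => ψ (x + L t)) t :=
      AnalyticAt.fun_comp (hball _ (hmem t ht)).1 h1
    exact AnalyticAt.fun_comp (h.analytic han _) h2
  have hinv : ∀ t ∈ Metric.ball (0 : ℂ) 1, π (Ψ (Φ (ψ (x + L t)))) = x + L t := fun t ht => by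
    rw [h.chart.left_inv, (hball _ (hmem t ht)).2.1]
  refine ⟨fun t => Φ (ψ (x + L t)), fun t ht => (hφa t ht).contDiffAt.contDiffWithinAt,
    fun s hs t ht hst => ?_, fun t ht => ?_, fun t ht => hAU _ (hball _ (hmem t ht)).2.2⟩
  · have h1 := hinv s hs
    rw [show Φ (ψ (x + L s)) = Φ (ψ (x + L t)) from hst, hinv t ht] at h1
    exact hLinj (add_left_cancel h1).symm
  · have h1 : HasFDerivAt (fun p => π (Ψ p)) _ (Φ (ψ (x + L t))) :=
      π.hasFDerivAt.comp _
        ((h.chart.smooth 1 _ (h.chart.mem _).1).differentiableAt (by simp)).hasFDerivAt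
    have h2 := h1.comp t (hφa t ht).differentiableAt.hasFDerivAt
    have h3 : HasFDerivAt (fun t => x + L t) L t := L.hasFDerivAt.const_add x
    have h4 : (fun t => x + L t) =ᶠ[𝓝 t] (fun p => π (Ψ p)) ∘ fun t => Φ (ψ (x + L t)) := by
      filter_upwards [Metric.isOpen_ball.mem_nhds ht] with s hs using (hinv s hs).symm
    have h5 := (h2.congr_of_eventuallyEq h4).unique h3
    intro v w hvw
    apply hLinj
    rw [← h5]
    exact congrArg (π.comp _) hvw

/-- An arc of curve points of the umbilical locus in the chart is a smooth arc in `ℂ²`, after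
rescaling its parameter interval. -/
theorem isSmoothCurvePiece (h : IsUmbilicChart Ω ρ W Φ Ψ) (han : AnalyticOnNhd ℝ ρ Ω)
    {ℓ : ℝ × ℝ × ℝ →L[ℝ] ℝ} {γ : ℝ → ℝ × ℝ × ℝ} {a b : ℝ} (hab : a < b)
    (hγ : ∀ t ∈ Ioo a b, AnalyticAt ℝ γ t ∧ ℓ (γ t) = t ∧ coeff ρ Φ (γ t) = 0 ∧
      ∀ᶠ q in 𝓝 (γ t), coeff ρ Φ q = 0 → γ (ℓ q) = q) :
    IsSmoothCurvePiece (umbilicLocus Ω ρ) ((fun t => Φ (γ (a + (b - a) * t))) '' Ioo 0 1) := by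
  have hba : 0 < b - a := sub_pos.2 hab
  have hmem : ∀ t ∈ Ioo (0 : ℝ) 1, a + (b - a) * t ∈ Ioo a b := fun t ht =>
    ⟨by nlinarith [ht.1], by nlinarith [ht.2]⟩
  have hφa : ∀ t ∈ Ioo (0 : ℝ) 1, AnalyticAt ℝ (fun t => Φ (γ (a + (b - a) * t))) t := by
    intro t ht
    have h1 : AnalyticAt ℝ (fun t => a + (b - a) * t) t :=
      analyticAt_const.add (analyticAt_const.mul analyticAt_id)
    have h2 : AnalyticAt ℝ (fun t => γ (a + (b - a) * t)) t :=
      AnalyticAt.fun_comp (hγ _ (hmem t ht)).1 h1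
    exact AnalyticAt.fun_comp (h.analytic han _) h2
  have hinv : ∀ t ∈ Ioo (0 : ℝ) 1, ℓ (Ψ (Φ (γ (a + (b - a) * t)))) = a + (b - a) * t :=
    fun t ht => by rw [h.chart.left_inv, (hγ _ (hmem t ht)).2.1]
  refine ⟨_, fun t ht => (hφa t ht).contDiffAt.contDiffWithinAt, fun s hs t ht hst => ?_,
    fun t ht h0 => ?_, rfl, ?_, fun t ht δ hδ => ?_⟩
  · have h1 := hinv s hs
    rw [show Φ (γ (a + (b - a) * s)) = Φ (γ (a + (b - a) * t)) from hst, hinv t ht] at h1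
    exact (mul_left_cancel₀ hba.ne' (add_left_cancel h1)).symm
  · have h1 : HasFDerivAt (fun p => ℓ (Ψ p)) _ (Φ (γ (a + (b - a) * t))) :=
      ℓ.hasFDerivAt.comp _
        ((h.chart.smooth 1 _ (h.chart.mem _).1).differentiableAt (by simp)).hasFDerivAt
    have h2 := h1.comp_hasDerivAt t (hφa t ht).differentiableAt.hasDerivAt
    rw [h0, map_zero] at h2
    have h3 : HasDerivAt (fun t => a + (b - a) * t) (b - a) t := by
      simpa using ((hasDerivAt_id t).const_mul (b - a)).const_add a
    have h4 : (fun t => a + (b - a) * t) =ᶠ[𝓝 t]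
        (fun p => ℓ (Ψ p)) ∘ fun t => Φ (γ (a + (b - a) * t)) := by
      filter_upwards [isOpen_Ioo.mem_nhds ht] with s hs using (hinv s hs).symm
    exact hba.ne ((h2.congr_of_eventuallyEq h4).unique h3)
  · rintro _ ⟨t, ht, rfl⟩
    exact h.mem_umbilicLocus_iff.2 (hγ _ (hmem t ht)).2.2.1
  · obtain ⟨-, hℓ, -, hev⟩ := hγ _ (hmem t ht)
    set q := γ (a + (b - a) * t) with hq
    have hΨ : Tendsto Ψ (𝓝 (Φ q)) (𝓝 q) := by
      have h1 := (h.chart.smooth 0 _ (h.chart.mem q).1).continuousAt.tendsto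
      rwa [h.chart.left_inv] at h1
    have hs : Tendsto (fun y => (ℓ y - a) / (b - a)) (𝓝 q) (𝓝 t) := by
      have h1 : Continuous fun y => (ℓ y - a) / (b - a) := by fun_prop
      have h2 := h1.tendsto q
      rwa [hℓ, add_sub_cancel_left, mul_div_cancel_left₀ _ hba.ne'] at h2
    have hI : Ioo (t - δ) (t + δ) ∩ Ioo 0 1 ∈ 𝓝 t :=
      inter_mem (Ioo_mem_nhds (by linarith) (by linarith)) (isOpen_Ioo.mem_nhds ht)
    refine ⟨_, ((hΨ.eventually hev).and ((hs.comp hΨ).eventually hI)).and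
      (h.chart.isOpen.mem_nhds (h.chart.mem q).1), ?_⟩
    rintro p ⟨hpU, ⟨hp1, hp2⟩, hpW⟩
    have hp3 : Φ (Ψ p) = p := h.chart.right_inv p hpW hpU.1
    have hp4 : coeff ρ Φ (Ψ p) = 0 := h.mem_umbilicLocus_iff.1 (by rwa [hp3])
    refine ⟨(ℓ (Ψ p) - a) / (b - a), hp2, ?_⟩
    beta_reduce
    rw [mul_div_cancel₀ _ hba.ne', add_sub_cancel, hp1 hp4, hp3]

/-- In the chart the umbilical locus is the zero set of the real analytic function `|det A₃|²`. If it
contains no surface, it does not separate locally, and the continuum of stable points contains an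
arc of curve points. -/
theorem surface_or_curve (h : IsUmbilicChart Ω ρ W Φ Ψ) (hΩ : IsOpen Ω)
    (han : AnalyticOnNhd ℝ ρ Ω) : ContainsSmoothSurface (umbilicLocus Ω ρ) ∨
      ∃ C, IsSmoothCurvePiece (umbilicLocus Ω ρ) C ∧ ∀ p ∈ C, IsStableUmbilic Ω ρ p := by
  have hf := h.analyticAt_normSq_coeff hΩ han
  have hd : Module.finrank ℝ (ℝ × ℝ × ℝ) = 3 := by simp [Module.finrank_prod]
  have hZ : {x | Complex.normSq (coeff ρ Φ x) = 0} = {x | coeff ρ Φ x = 0} := by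
    ext x
    exact Complex.normSq_eq_zero
  by_cases hns : ContainsAnalyticSurface {x | Complex.normSq (coeff ρ Φ x) = 0}
  · exact Or.inl (h.containsSmoothSurface han hns fun x hx =>
      h.mem_umbilicLocus_iff.2 (Complex.normSq_eq_zero.1 hx))
  · right
    obtain ⟨C, hC, -, hCc, hCn⟩ := h.exists_stable_continuum hΩ fun O hO hconv hne =>
      hZ ▸ isConnected_diff_zeros hd hf hns hO hconv hne
    have hCA : C ⊆ {x | Complex.normSq (coeff ρ Φ x) = 0} := fun x hx =>
      Complex.normSq_eq_zero.2 (h.mem_umbilicLocus_iff.1 (hC hx).1)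
    obtain ⟨ℓ, γ, a, b, hab, hγ⟩ := exists_arc_subset
      (A := {x | Complex.normSq (coeff ρ Φ x) = 0}) (countable_not_isCurvePoint hd hf hns) hCA
      hCc.isPreconnected hCn
    refine ⟨_, h.isSmoothCurvePiece (ℓ := ℓ) (γ := γ) han hab fun t ht => ?_, ?_⟩
    · obtain ⟨h1, h2, h3, h4⟩ := hγ t ht
      exact ⟨h1, h2, Complex.normSq_eq_zero.1 (hCA h3), h4.mono fun q hq hq0 =>
        hq (Complex.normSq_eq_zero.2 hq0)⟩
    · rintro _ ⟨t, ht, rfl⟩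
      exact hC (hγ _ ⟨by nlinarith [ht.1], by nlinarith [ht.2]⟩).2.2.1

end IsUmbilicChart

end

end CRUmbilic

theorem proposition4p2 (Ω : Set (ℂ × ℂ)) (hΩ : IsOpen Ω) (hS : CRUmbilic.S3 ⊆ Ω)
    (ρ : ℝ → ℂ × ℂ → ℝ) (ρ' : ℂ × ℂ → ℝ)
    (hρ : CRUmbilic.IsSpherePerturbation Ω ρ ρ')
    (Γ : ℝ → ℂ × ℂ) (hΓ : CRUmbilic.IsClosedCurveIn Γ CRUmbilic.S3)
    (hQ' : ∀ t ∈ Set.Icc (0 : ℝ) 1, CRUmbilic.Qprime ρ' (Γ t) ≠ 0)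
    (hwind : ∃ n : ℤ, n ≠ 0 ∧ CRUmbilic.HasWinding (fun t => CRUmbilic.Qprime ρ' (Γ t)) n) :
    ∀ᶠ ε in nhdsWithin (0 : ℝ) (Set.Ioi 0),
      (∃ C : Set (ℂ × ℂ), CRUmbilic.IsNondegenerateContinuum C ∧
        C ⊆ CRUmbilic.umbilicLocus Ω (ρ ε)) ∧
      (CRUmbilic.LocallySeparates (CRUmbilic.hypersurface Ω (ρ ε))
          (CRUmbilic.umbilicLocus Ω (ρ ε)) ∨
        ∃ C : Set (ℂ × ℂ), CRUmbilic.IsNondegenerateContinuum C ∧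
          ∀ p ∈ C, CRUmbilic.IsStableUmbilic Ω (ρ ε) p) ∧
      (AnalyticOnNhd ℝ (ρ ε) Ω →
        CRUmbilic.ContainsSmoothSurface (CRUmbilic.umbilicLocus Ω (ρ ε)) ∨
        ∃ C : Set (ℂ × ℂ), CRUmbilic.IsSmoothCurvePiece (CRUmbilic.umbilicLocus Ω (ρ ε)) C ∧
          ∀ p ∈ C, CRUmbilic.IsStableUmbilic Ω (ρ ε) p) := by
  obtain ⟨n, hn0, hn⟩ := hwind
  filter_upwards [hρ.exists_isUmbilicChart hΩ hS hΓ hQ' hn0 hn] with ε hε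
  obtain ⟨W, Φ, Ψ, h⟩ := hε
  refine ⟨h.exists_umbilic_continuum hΩ, or_iff_not_imp_left.2 fun hs => ?_,
    h.surface_or_curve hΩ⟩
  obtain ⟨C, hC, h1, h2, h3⟩ := h.exists_stable_continuum hΩ fun O hO hconv hne =>
    h.isConnected_sdiff_of_not_locallySeparates hs hO hconv hne
  refine ⟨Φ '' C, h.chart.image_continuum h1 h2 h3, ?_⟩
  rintro _ ⟨x, hx, rfl⟩
  exact hC hx
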